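/- Let $n\ge 4$ and let $(M^n,g)$ be a smooth Riemannian manifold with Ricci tensor $\mathrm{Ric}$ and scalar curvature $R$. Suppose that $(M,g,f)$ is a vacuum static space, i.e. $f:M\to\mathbb R$ is a smooth function, not identically zero, with $$\mathrm{Hess}\, f=f\Big(\mathrm{Ric}-\frac{R}{n-1}\,g\Big),$$ and that $g$ has harmonic curvature, i.e. the divergence of its Riemann curvature tensor vanishes. Let $M_{\mathrm{Ric}}$ be the set of points $x\in M$ such that the number of distinct eigenvalues of the Ricci tensor is constant in a neighborhood of $x$. Then every point $p\in M_{\mathrm{Ric}}\cap\{\nabla f\neq 0\}$ has an open neighborhood $U\subset M_{\mathrm{Ric}}\cap\{\nabla f\ne 0\}$ such that at each $x\in U$ the following holds. There is an orthonormal basis $E_1=\nabla f/|\nabla f|,E_2,\dots,E_n$ of $T_xM$ with $\mathrm{Ric}(E_i,E_j)=\lambda_i\delta_{ij}$ for some real numbers $\lambda_1,\dots,\lambda_n$; and for every such basis the Ricci eigenvalues $\lambda_2,\dots,\lambda_n$ take at most two distinct values. -/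

import Mathlib

open scoped Manifold ContDiff Topology

noncomputable section

namespace StaticSpace

/-! ### Classical tensor calculus in coordinates

Here `G` is the matrix field `(g_ij)` of a metric, written in coordinates on an open part
of `ℝⁿ`. All formulas are meant at points where `G` is smooth and positive definite.
-/

section Coordinates

variable {n : ℕ}

/-- The partial derivative `∂_i F` at `y`. -/
def partialDeriv (i : Fin n) (F : EuclideanSpace ℝ (Fin n) → ℝ)
    (y : EuclideanSpace ℝ (Fin n)) : ℝ :=
  fderiv ℝ F y (EuclideanSpace.single i 1)

/-- The Christoffel symbols
`Γ^k_{ij} = ½ ∑_l g^{kl} (∂_i g_{jl} + ∂_j g_{il} - ∂_l g_{ij})`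
of the Levi-Civita connection. -/
def christoffel (G : EuclideanSpace ℝ (Fin n) → Matrix (Fin n) (Fin n) ℝ)
    (k i j : Fin n) (y : EuclideanSpace ℝ (Fin n)) : ℝ :=
  (1 / 2) * ∑ l, (G y)⁻¹ k l *
    (partialDeriv i (fun z => G z j l) y + partialDeriv j (fun z => G z i l) y
      - partialDeriv l (fun z => G z i j) y)

/-- The Riemann curvature tensor with its first index raised: `R^l_{ijk}` is the `l`-th component
of `R(∂_j, ∂_k) ∂_i = ∇_j ∇_k ∂_i - ∇_k ∇_j ∂_i`. -/
def riemann (G : EuclideanSpace ℝ (Fin n) → Matrix (Fin n) (Fin n) ℝ)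
    (l i j k : Fin n) (y : EuclideanSpace ℝ (Fin n)) : ℝ :=
  partialDeriv j (christoffel G l k i) y - partialDeriv k (christoffel G l j i) y
    + ∑ m, (christoffel G l j m y * christoffel G m k i y
        - christoffel G l k m y * christoffel G m j i y)

/-- The Ricci tensor `R_{ij} = ∑_l R^l_{ilj}` (positive on round spheres). -/
def ricciCoord (G : EuclideanSpace ℝ (Fin n) → Matrix (Fin n) (Fin n) ℝ)
    (i j : Fin n) (y : EuclideanSpace ℝ (Fin n)) : ℝ :=
  ∑ l, riemann G l i l j y

/-- The scalar curvature `R = ∑_{i,j} g^{ij} R_{ij}`. -/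
def scalarCoord (G : EuclideanSpace ℝ (Fin n) → Matrix (Fin n) (Fin n) ℝ)
    (y : EuclideanSpace ℝ (Fin n)) : ℝ :=
  ∑ i, ∑ j, (G y)⁻¹ i j * ricciCoord G i j y

/-- The covariant derivative `∇_m R^l_{ijk}` of the curvature tensor. -/
def nablaRiemann (G : EuclideanSpace ℝ (Fin n) → Matrix (Fin n) (Fin n) ℝ)
    (m l i j k : Fin n) (y : EuclideanSpace ℝ (Fin n)) : ℝ :=
  partialDeriv m (riemann G l i j k) y
    + ∑ p, (christoffel G l m p y * riemann G p i j k y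
        - christoffel G p m i y * riemann G l p j k y
        - christoffel G p m j y * riemann G l i p k y
        - christoffel G p m k y * riemann G l i j p y)

/-- The divergence `∑_l ∇_l R^l_{ijk}` of the curvature tensor. -/
def divRiemann (G : EuclideanSpace ℝ (Fin n) → Matrix (Fin n) (Fin n) ℝ)
    (i j k : Fin n) (y : EuclideanSpace ℝ (Fin n)) : ℝ :=
  ∑ l, nablaRiemann G l l i j k y

/-- The Hessian `∂_i ∂_j F - ∑_k Γ^k_{ij} ∂_k F` of a function `F`. -/
def hessCoord (G : EuclideanSpace ℝ (Fin n) → Matrix (Fin n) (Fin n) ℝ)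
    (F : EuclideanSpace ℝ (Fin n) → ℝ)
    (i j : Fin n) (y : EuclideanSpace ℝ (Fin n)) : ℝ :=
  partialDeriv i (partialDeriv j F) y - ∑ k, christoffel G k i j y * partialDeriv k F y

end Coordinates

/-! ### Riemannian manifolds -/

section Manifold

variable {n : ℕ} {M : Type*} [TopologicalSpace M] [ChartedSpace (EuclideanSpace ℝ (Fin n)) M]
  [IsManifold (𝓡 n) ∞ M]

variable (n M) in
/-- Smooth Riemannian metrics on the `n`-dimensional manifold `M`. -/
abbrev Metric : Type _ :=
  Bundle.ContMDiffRiemannianMetric (𝓡 n) ∞ (EuclideanSpace ℝ (Fin n))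
    (fun x : M => TangentSpace (𝓡 n) x)

/-- The coordinate vector field `∂_i` of the chart `φ`, at the point with coordinates `y`. -/
def coordVec (φ : OpenPartialHomeomorph M (EuclideanSpace ℝ (Fin n))) (i : Fin n)
    (y : EuclideanSpace ℝ (Fin n)) : TangentSpace (𝓡 n) (φ.symm y) :=
  mfderiv (𝓡 n) (𝓡 n) φ.symm y (EuclideanSpace.single i (1 : ℝ) : EuclideanSpace ℝ (Fin n))

/-- The matrix `g_ij = g(∂_i, ∂_j)` of the metric in the chart `φ`; meaningful on `φ.target`. -/
def metricCoord (g : Metric n M) (φ : OpenPartialHomeomorph M (EuclideanSpace ℝ (Fin n)))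
    (y : EuclideanSpace ℝ (Fin n)) : Matrix (Fin n) (Fin n) ℝ :=
  Matrix.of fun i j => g.inner (φ.symm y) (coordVec φ i y) (coordVec φ j y)

/-- The `i`-th component in the chart `φ` of a tangent vector at `x`. -/
def component (φ : OpenPartialHomeomorph M (EuclideanSpace ℝ (Fin n))) (x : M)
    (v : TangentSpace (𝓡 n) x) (i : Fin n) : ℝ :=
  (show EuclideanSpace ℝ (Fin n) from mfderiv (𝓡 n) (𝓡 n) φ x v) i

/-- The Ricci tensor `Ric_x(v, w)` of `g`, computed in the preferred chart at `x`. -/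
def ricci (g : Metric n M) (x : M) (v w : TangentSpace (𝓡 n) x) : ℝ :=
  let φ := chartAt (EuclideanSpace ℝ (Fin n)) x
  ∑ i, ∑ j, ricciCoord (metricCoord g φ) i j (φ x) * component φ x v i * component φ x w j

/-- `g` has harmonic curvature: the divergence of its curvature tensor vanishes. -/
def HasHarmonicCurvature (g : Metric n M) : Prop :=
  ∀ φ ∈ atlas (EuclideanSpace ℝ (Fin n)) M, ∀ y ∈ φ.target, ∀ i j k : Fin n,
    divRiemann (metricCoord g φ) i j k y = 0

/-- `(M, g, f)` is a vacuum static space: `f` is smooth, not identically zero, and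
`Hess f = f (Ric - R / (n - 1) g)`. -/
structure IsVacuumStatic (g : Metric n M) (f : M → ℝ) : Prop where
  smooth : ContMDiff (𝓡 n) 𝓘(ℝ, ℝ) ∞ f
  ne_zero : f ≠ 0
  static : ∀ φ ∈ atlas (EuclideanSpace ℝ (Fin n)) M, ∀ y ∈ φ.target, ∀ i j : Fin n,
    hessCoord (metricCoord g φ) (f ∘ φ.symm) i j y =
      f (φ.symm y) * (ricciCoord (metricCoord g φ) i j y
        - scalarCoord (metricCoord g φ) y / ((n : ℝ) - 1) * metricCoord g φ y i j)

/-- The metric at `x` as a bilinear form on the tangent space. -/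
def metricBilin (g : Metric n M) (x : M) : LinearMap.BilinForm ℝ (TangentSpace (𝓡 n) x) :=
  LinearMap.mk₂ ℝ (fun v w => g.inner x v w) (by simp) (by simp) (by simp) (by simp)

theorem metricBilin_nondegenerate (g : Metric n M) (x : M) :
    (metricBilin g x).Nondegenerate := by
  refine ⟨fun v hv => ?_, fun v hv => ?_⟩ <;>
  · by_contra h
    exact (g.pos x v h).ne' (hv v)

instance (x : M) : FiniteDimensional ℝ (TangentSpace (𝓡 n) x) :=
  inferInstanceAs (FiniteDimensional ℝ (EuclideanSpace ℝ (Fin n)))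

/-- The differential of `f` at `x`. -/
def differential (f : M → ℝ) (x : M) : TangentSpace (𝓡 n) x →ₗ[ℝ] ℝ :=
  (show TangentSpace (𝓡 n) x →L[ℝ] ℝ from mfderiv (𝓡 n) 𝓘(ℝ, ℝ) f x).toLinearMap

/-- The gradient `∇f` at `x`: the vector with `g(∇f, w) = df(w)` for all `w`. -/
def grad (g : Metric n M) (f : M → ℝ) (x : M) : TangentSpace (𝓡 n) x :=
  ((metricBilin g x).toDual (metricBilin_nondegenerate g x)).symm (differential f x)

theorem inner_grad (g : Metric n M) (f : M → ℝ) (x : M) (w : TangentSpace (𝓡 n) x) :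
    g.inner x (grad g f x) w = mfderiv (𝓡 n) 𝓘(ℝ, ℝ) f x w :=
  LinearMap.BilinForm.apply_toDual_symm_apply (B := metricBilin g x)
    (hB := metricBilin_nondegenerate g x) (differential f x) w

/-- The set of eigenvalues of the Ricci tensor at `x`. -/
def ricciEigenvalues (g : Metric n M) (x : M) : Set ℝ :=
  {μ | ∃ v : TangentSpace (𝓡 n) x, v ≠ 0 ∧
    ∀ w : TangentSpace (𝓡 n) x, ricci g x v w = μ * g.inner x v w}

/-- The set `M_Ric` of points near which the number of distinct Ricci eigenvalues is constant. -/
def ricciRegularSet (g : Metric n M) : Set M :=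
  {x | ∀ᶠ y in 𝓝 x, (ricciEigenvalues g y).encard = (ricciEigenvalues g x).encard}

/-- `e` is an orthonormal basis of `T_x M` with first vector `∇f / |∇f|` that diagonalizes the
Ricci tensor: `Ric(e_i, e_j) = lam_i δ_ij`. The index `0` here is the index `1` of the usual
counting `1, …, n`. -/
structure IsAdaptedRicciFrame (g : Metric n M) (f : M → ℝ) (x : M)
    (e : Fin n → TangentSpace (𝓡 n) x) (lam : Fin n → ℝ) : Prop where
  orthonormal : ∀ i j, g.inner x (e i) (e j) = if i = j then 1 else 0
  first : ∀ i : Fin n, (i : ℕ) = 0 →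
    e i = (Real.sqrt (g.inner x (grad g f x) (grad g f x)))⁻¹ • grad g f x
  diagonal : ∀ i j, ricci g x (e i) (e j) = if i = j then lam i else 0

end Manifold

end StaticSpace

end

/-!
Put `s = R / (n - 1)`, `T = Ric - s g`, `N = ∇f`, so that the static equation reads `Hess f = f T`.
The theorem holds because, at every point with `N ≠ 0`, the form `T` has at most one nonzero
eigenvalue on `N^⊥`; the Ricci eigenvalues there are then `s` and at most one further number.

*Identities.* By the second Bianchi identity, harmonic curvature makes `Ric` a Codazzi tensor
(`StaticPatch.ric_codazzi`). Commuting third derivatives of `f` (`StaticPatch.hess_comm`) and taking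
a trace gives `f ds = 0`, so `s` is constant (`StaticPatch.ds_eq_zero`) and `T` is Codazzi as well.
The commutation formula becomes `df(R(u, v) w) = df(v) T(u, w) - df(u) T(v, w)`; hence `N` is an
eigenvector of `T` (`StaticPatch.T_gradG`), and differentiating once more determines `∇_N T` and
`∇_N Rm` on `N^⊥` algebraically (`StaticPatch.covT_gradG`, `StaticPatch.covCurv_gradG`).

*Evolution.* Follow the flow of `N / |N|²`, along which `f = f₀ + t`, and let `e_i` be the Lie
transports of an orthonormal eigenbasis of `T` on `N^⊥`. With a parameter `x` such that
`dx/dt = f / |N|`, these identities integrate explicitly: the `e_i` stay orthogonal eigenvectors,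
`|e_i| = 1 + a_i x`, and `T(e_i, e_i) = |N| a_i (1 + a_i x)` for constants `a_i`
(`StaticPatch.exists_frameCurve`). In the same way
`Rm(e_i, e_j, e_j, e_i) / ((1 + a_i x) (1 + a_j x)) + f² a_i a_j` is a constant `k_ij = k_ji`, and
`Ric(e_i, e_i)` as a sum of sectional curvatures becomes
`2 |N| a_i + s (1 + a_i x) + f² a_i ∑_{j ≠ i} a_j / (1 + a_j x) = ∑_{j ≠ i} k_ij / (1 + a_j x)`
(`StaticPatch.frameCurve_equations`).

*Algebra.* Suppose that the `a_i` had two distinct nonzero values. Eliminating `|N|` between the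
equations of two indices shows that `f² = p(x)` for a polynomial `p` of degree at most two
(`exists_polynomial`), and then `2 |N| = p'(x)`, which turns the equations into identities between
rational functions of `x`. Their residues at `-1 / v`, summed over the indices with the same value
of `a`, show with `k_ij = k_ji` that `p` takes the same value at all the points `-1 / v`. This makes
`p` constant if there are three such points, and leaves `p = p₀ + β (1 + u x) (1 + v x)` if there
are two, where a second summation gives `β = 0` (`derivative_eq_zero_of_identities`). So `p' = 0`,
against `|N| > 0`. Hence the `a_i`, which are proportional to the eigenvalues of `T`, have at most
one nonzero value (`card_nonzeroValues_le_one`).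
-/

noncomputable section

-- needed to find instances on the nested spaces of continuous linear maps
set_option maxSynthPendingDepth 3

namespace StaticSpace

/-! ### Curvature of a torsion-free connection -/

section Connection

/-- Smooth maps are regular enough for the symmetry of the second derivative. -/
theorem two_le_smooth : minSmoothness ℝ 2 ≤ (∞ : ℕ∞ω) := by
  rw [minSmoothness_of_isRCLikeNormedField]; exact WithTop.coe_le_coe.2 (le_top : (2 : ℕ∞) ≤ ⊤)

variable {E : Type*} [NormedAddCommGroup E] [NormedSpace ℝ E]

/-- The quadratic term `(u, v) ↦ Γ_u ∘ Γ_v` of the curvature. -/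
def connSq (A : E →L[ℝ] E →L[ℝ] E) : E →L[ℝ] E →L[ℝ] E →L[ℝ] E :=
  (ContinuousLinearMap.compL ℝ E E E).bilinearComp A A

/-- The curvature `R(u, v) w` of the connection `∇_u w = D_u w + Γ(u, w)`. -/
def curv (Γ : E → E →L[ℝ] E →L[ℝ] E) (y : E) : E →L[ℝ] E →L[ℝ] E →L[ℝ] E :=
  fderiv ℝ Γ y - (fderiv ℝ Γ y).flip + connSq (Γ y) - (connSq (Γ y)).flip

theorem curv_apply (Γ : E → E →L[ℝ] E →L[ℝ] E) (y u v w : E) :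
    curv Γ y u v w = fderiv ℝ Γ y u v w - fderiv ℝ Γ y v u w
      + Γ y u (Γ y v w) - Γ y v (Γ y u w) := rfl

/-- The covariant derivative `(∇_m R)(u, v) w`. -/
def covCurv (Γ : E → E →L[ℝ] E →L[ℝ] E) (y m u v w : E) : E :=
  fderiv ℝ (curv Γ) y m u v w + Γ y m (curv Γ y u v w) - curv Γ y (Γ y m u) v w
    - curv Γ y u (Γ y m v) w - curv Γ y u v (Γ y m w)

theorem curv_swap (Γ : E → E →L[ℝ] E →L[ℝ] E) (y u v w : E) :
    curv Γ y u v w = - curv Γ y v u w := by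
  simp only [curv_apply]; abel

theorem contDiffAt_connSq {m : ℕ∞ω} {Γ : E → E →L[ℝ] E →L[ℝ] E} {y : E}
    (h : ContDiffAt ℝ m Γ y) : ContDiffAt ℝ m (fun z => connSq (Γ z)) y := by
  have h1 : ContDiffAt ℝ m (fun z => (ContinuousLinearMap.compL ℝ E E E).comp (Γ z)) y :=
    contDiffAt_const.clm_comp h
  have hf := (ContinuousLinearMap.flipₗᵢ ℝ E (E →L[ℝ] E) (E →L[ℝ] E)).contDiff (n := m)
  have h2 := (hf.contDiffAt.comp y h1).clm_comp h
  have hg := (ContinuousLinearMap.flipₗᵢ ℝ E E (E →L[ℝ] E)).contDiff (n := m)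
  exact hg.contDiffAt.comp y h2

theorem contDiffAt_curv {Γ : E → E →L[ℝ] E →L[ℝ] E} {y : E}
    (h : ContDiffAt ℝ ∞ Γ y) : ContDiffAt ℝ ∞ (curv Γ) y := by
  have h1 : ContDiffAt ℝ ∞ (fderiv ℝ Γ) y := h.fderiv_right (by simp)
  have hg := (ContinuousLinearMap.flipₗᵢ ℝ E E (E →L[ℝ] E)).contDiff (n := ∞)
  have h2 := contDiffAt_connSq h
  exact ((h1.sub (hg.contDiffAt.comp y h1)).add h2).sub (hg.contDiffAt.comp y h2)

theorem fderiv_curv_apply {Γ : E → E →L[ℝ] E →L[ℝ] E} {y : E}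
    (h : ContDiffAt ℝ ∞ Γ y) (m u v w : E) :
    fderiv ℝ (curv Γ) y m u v w =
      fderiv ℝ (fderiv ℝ Γ) y m u v w - fderiv ℝ (fderiv ℝ Γ) y m v u w
      + (fderiv ℝ Γ y m u (Γ y v w) + Γ y u (fderiv ℝ Γ y m v w))
      - (fderiv ℝ Γ y m v (Γ y u w) + Γ y v (fderiv ℝ Γ y m u w)) := by
  have hd : DifferentiableAt ℝ Γ y := h.differentiableAt (by simp)
  have hd1 : DifferentiableAt ℝ (fderiv ℝ Γ) y :=
    (h.fderiv_right (m := ∞) (by simp)).differentiableAt (by simp)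
  have hc : DifferentiableAt ℝ (curv Γ) y := (contDiffAt_curv h).differentiableAt (by simp)
  have hu : ∀ u, HasFDerivAt (fun z => Γ z u) ((fderiv ℝ Γ y).flip u) y := fun u => by
    have := hd.hasFDerivAt.clm_apply (hasFDerivAt_const u y)
    simpa using this
  have huv : ∀ u v, HasFDerivAt (fun z => Γ z u v) (((fderiv ℝ Γ y).flip u).flip v) y :=
    fun u v => by
    have := (hu u).clm_apply (hasFDerivAt_const v y)
    simpa using this
  have hq : ∀ u v w, HasFDerivAt (fun z => Γ z u (Γ z v w)) _ y := fun u v w =>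
    (hu u).clm_apply (huv v w)
  have h1 : ∀ u v w, HasFDerivAt (fun z => fderiv ℝ Γ z u v w) _ y := fun u v w =>
    ((hd1.hasFDerivAt.clm_apply (hasFDerivAt_const u y)).clm_apply
      (hasFDerivAt_const v y)).clm_apply (hasFDerivAt_const w y)
  have h2 : HasFDerivAt (fun z => curv Γ z u v w) _ y :=
    ((hc.hasFDerivAt.clm_apply (hasFDerivAt_const u y)).clm_apply
      (hasFDerivAt_const v y)).clm_apply (hasFDerivAt_const w y)
  have h3 : HasFDerivAt (fun z => curv Γ z u v w) _ y :=
    (((h1 u v w).sub (h1 v u w)).add (hq u v w)).sub (hq v u w)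
  have := congrArg (fun L => L m) (h2.unique h3)
  simp at this
  rw [this]; abel

/-- The second Bianchi identity for a torsion-free connection. -/
theorem second_bianchi {Γ : E → E →L[ℝ] E →L[ℝ] E} {y : E} (h : ContDiffAt ℝ ∞ Γ y)
    (hs : ∀ u v, Γ y u v = Γ y v u) (m u v w : E) :
    covCurv Γ y m u v w + covCurv Γ y u v m w + covCurv Γ y v m u w = 0 := by
  have hsym : ∀ a b c d, fderiv ℝ (fderiv ℝ Γ) y a b c d = fderiv ℝ (fderiv ℝ Γ) y b a c d :=
    fun a b c d => by
      have := (h.isSymmSndFDerivAt two_le_smooth).eq a b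
      rw [this]
  unfold covCurv
  rw [fderiv_curv_apply h, fderiv_curv_apply h, fderiv_curv_apply h]
  rw [hsym u m, hsym v m, hsym v u, hs u m, hs v m, hs v u]
  rw [curv_swap Γ y v (Γ y m u), curv_swap Γ y m (Γ y u v), curv_swap Γ y u (Γ y m v)]
  simp only [curv_apply, map_add, map_sub]
  abel

/-- The first Bianchi identity. -/
theorem first_bianchi {Γ : E → E →L[ℝ] E →L[ℝ] E} {y : E} (h : ContDiffAt ℝ ∞ Γ y)
    (hs : ∀ᶠ z in 𝓝 y, ∀ u v, Γ z u v = Γ z v u) (u v w : E) :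
    curv Γ y u v w + curv Γ y v w u + curv Γ y w u v = 0 := by
  have hd : DifferentiableAt ℝ Γ y := h.differentiableAt (by simp)
  have hsd : ∀ m u v, fderiv ℝ Γ y m u v = fderiv ℝ Γ y m v u := fun m u v => by
    have hu : ∀ u v, HasFDerivAt (fun z => Γ z u v) _ y := fun u v =>
      (hd.hasFDerivAt.clm_apply (hasFDerivAt_const u y)).clm_apply (hasFDerivAt_const v y)
    have h1 := (hu v u).congr_of_eventuallyEq (hs.mono fun z hz => hz u v)
    have := congrArg (fun L => L m) ((hu u v).unique h1)
    simpa using this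
  have hs0 := hs.self_of_nhds
  simp only [curv_apply]
  rw [hsd u w v, hsd v w u, hsd w v u, hs0 w v, hs0 w u, hs0 v u]
  abel

end Connection

section Metric

variable {E : Type*} [NormedAddCommGroup E] [NormedSpace ℝ E]

/-- Skew-symmetry of `R(u, v)` for a metric connection. -/
theorem metric_curv_skew {Γ : E → E →L[ℝ] E →L[ℝ] E} {G : E → E →L[ℝ] E →L[ℝ] ℝ} {y : E}
    (hΓ : ContDiffAt ℝ ∞ Γ y) (hG : ContDiffAt ℝ ∞ G y)
    (hc : ∀ᶠ z in 𝓝 y, ∀ a v w, fderiv ℝ G z a v w = G z (Γ z a v) w + G z v (Γ z a w))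
    (u v w z : E) : G y (curv Γ y u v w) z = - G y w (curv Γ y u v z) := by
  have hd : DifferentiableAt ℝ Γ y := hΓ.differentiableAt (by simp)
  have hdG : DifferentiableAt ℝ G y := hG.differentiableAt (by simp)
  have hd1 : DifferentiableAt ℝ (fderiv ℝ G) y :=
    (hG.fderiv_right (m := ∞) (by simp)).differentiableAt (by simp)
  have h0 := hc.self_of_nhds
  have key : ∀ u v w z, fderiv ℝ (fderiv ℝ G) y v u w z =
      G y (Γ y v (Γ y u w)) z + G y (Γ y u w) (Γ y v z) + G y (fderiv ℝ Γ y v u w) z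
      + (G y (Γ y v w) (Γ y u z) + G y w (Γ y v (Γ y u z)) + G y w (fderiv ℝ Γ y v u z)) := by
    intro u v w z
    have h1 : HasFDerivAt (fun x => fderiv ℝ G x u w z) _ y :=
      ((hd1.hasFDerivAt.clm_apply (hasFDerivAt_const u y)).clm_apply
        (hasFDerivAt_const w y)).clm_apply (hasFDerivAt_const z y)
    have hu : ∀ u v, HasFDerivAt (fun z => Γ z u v) _ y := fun u v =>
      (hd.hasFDerivAt.clm_apply (hasFDerivAt_const u y)).clm_apply (hasFDerivAt_const v y)
    have h2 := (((hdG.hasFDerivAt.clm_apply (hu u w)).clm_apply (hasFDerivAt_const z y)).add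
      ((hdG.hasFDerivAt.clm_apply (hasFDerivAt_const w y)).clm_apply (hu u z)))
    have h3 := h2.congr_of_eventuallyEq (hc.mono fun x hx => hx u w z)
    have := congrArg (fun L => L v) (h1.unique h3)
    simp [h0] at this
    rw [this]; ring
  have hsym := (hG.isSymmSndFDerivAt two_le_smooth).eq u v
  have := congrArg (fun L => L w z) hsym
  rw [key, key] at this
  simp only [curv_apply, map_add, map_sub, add_apply, sub_apply]
  linarith

/-- The pair symmetry of an algebraic curvature tensor: add up four cyclic identities. -/
theorem pair_symm_of_bianchi {V : Type*} (Q : V → V → V → V → ℝ)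
    (h1 : ∀ u v w z, Q u v w z = - Q v u w z) (h2 : ∀ u v w z, Q u v w z = - Q u v z w)
    (h3 : ∀ u v w z, Q u v w z + Q v w u z + Q w u v z = 0) (u v w z : V) :
    Q u v w z = Q w z u v := by
  have a1 := h3 u v w z
  have a2 := h3 v w z u
  have a3 := h3 w z u v
  have a4 := h3 z u v w
  have b1 := h2 v w z u
  have b2 := h2 w z u v
  have c := h1 w u v z
  have c' := h2 u w v z
  have d := h1 z v w u
  have d' := h2 v z w u
  have e4 := h2 u v z w
  have e5 := h2 z u w v
  linarith

theorem hasFDerivAt_apply₂ {F H K : Type*} [NormedAddCommGroup F] [NormedSpace ℝ F]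
    [NormedAddCommGroup H] [NormedSpace ℝ H] [NormedAddCommGroup K] [NormedSpace ℝ K]
    {S : E → F →L[ℝ] H →L[ℝ] K} {y : E}
    (hS : DifferentiableAt ℝ S y) (v : F) (w : H) :
    HasFDerivAt (fun z => S z v w) (((fderiv ℝ S y).flip v).flip w) y := by
  simpa using (hS.hasFDerivAt.clm_apply (hasFDerivAt_const v y)).clm_apply (hasFDerivAt_const w y)

end Metric

/-! ### Static patches and the Codazzi equation -/

section Patch

variable {E : Type*} [NormedAddCommGroup E] [NormedSpace ℝ E] [FiniteDimensional ℝ E]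

/-- The trace as a continuous linear form on endomorphisms. -/
def traceL : (E →L[ℝ] E) →L[ℝ] ℝ :=
  LinearMap.toContinuousLinearMap
    ((LinearMap.trace ℝ E).comp (ContinuousLinearMap.coeLM ℝ))

theorem traceL_apply (L : E →L[ℝ] E) : traceL L = LinearMap.trace ℝ E (L : E →ₗ[ℝ] E) := rfl

/-- The contraction `u ↦ Q(u, w) v` of a curvature-like tensor `Q`, as a linear form in `Q`. -/
def ricL (v w : E) : (E →L[ℝ] E →L[ℝ] E →L[ℝ] E) →L[ℝ] ℝ :=
  LinearMap.toContinuousLinearMap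
    { toFun := fun Q => traceL ((Q.flip w).flip v)
      map_add' := fun P Q => by rw [← map_add]; rfl
      map_smul' := fun c Q => by rw [RingHom.id_apply, ← map_smul]; rfl }

theorem ricL_apply (v w : E) (Q : E →L[ℝ] E →L[ℝ] E →L[ℝ] E) :
    ricL v w Q = traceL ((Q.flip w).flip v) := rfl

/-- The covariant derivative `(∇_a S)(v, w)` of a bilinear form. -/
def covForm (Γ : E → E →L[ℝ] E →L[ℝ] E) (S : E → E →L[ℝ] E →L[ℝ] ℝ) (y a v w : E) : ℝ :=
  fderiv ℝ S y a v w - S y (Γ y a v) w - S y v (Γ y a w)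

/-- A vacuum static space with harmonic curvature on an open set `Ω` of a vector space: `G` is the
metric, `Γ` its Levi-Civita connection, `s = R / (n - 1)` and `T = Ric - s G`, so that the static
equation reads `Hess f = f T`. The function `f` is assumed to have no critical point in `Ω`.
Traces that need a raised index (`scal`) or a derivative of the curvature (`harmonic`) are expressed
through an arbitrary endomorphism `L` with the prescribed values, which determine it. -/
structure StaticPatch (Ω : Set E) (G : E → E →L[ℝ] E →L[ℝ] ℝ) (Γ : E → E →L[ℝ] E →L[ℝ] E)
    (T : E → E →L[ℝ] E →L[ℝ] ℝ) (f s : E → ℝ) : Prop where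
  isOpen : IsOpen Ω
  smoothG : ∀ y ∈ Ω, ContDiffAt ℝ ∞ G y
  smoothΓ : ∀ y ∈ Ω, ContDiffAt ℝ ∞ Γ y
  smoothT : ∀ y ∈ Ω, ContDiffAt ℝ ∞ T y
  smoothf : ∀ y ∈ Ω, ContDiffAt ℝ ∞ f y
  smooths : ∀ y ∈ Ω, ContDiffAt ℝ ∞ s y
  symm : ∀ y ∈ Ω, ∀ u v, G y u v = G y v u
  pos : ∀ y ∈ Ω, ∀ u, u ≠ 0 → 0 < G y u u
  torsion : ∀ y ∈ Ω, ∀ u v, Γ y u v = Γ y v u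
  compat : ∀ y ∈ Ω, ∀ a v w, fderiv ℝ G y a v w = G y (Γ y a v) w + G y v (Γ y a w)
  ric : ∀ y ∈ Ω, ∀ v w,
    T y v w + s y * G y v w = traceL (((curv Γ y).flip w).flip v)
  scal : ∀ y ∈ Ω, ∀ L : E →L[ℝ] E, (∀ u v, G y (L u) v = T y u v) → traceL L = - s y
  static : ∀ y ∈ Ω, ∀ u v,
    fderiv ℝ (fderiv ℝ f) y u v - fderiv ℝ f y (Γ y u v) = f y * T y u v
  harmonic : ∀ y ∈ Ω, ∀ u v w, ∀ L : E →L[ℝ] E,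
    (∀ m, L m = covCurv Γ y m u v w) → traceL L = 0
  df_ne : ∀ y ∈ Ω, fderiv ℝ f y ≠ 0
  two_le : 2 ≤ Module.finrank ℝ E

/-- The musical isomorphism `♯` of the metric `G`. It is a proper inverse of `v ↦ G(v, ·)` only where
`G` is nondegenerate, in particular on a static patch. -/
def sharp (G : E → E →L[ℝ] E →L[ℝ] ℝ) (y : E) : (E →L[ℝ] ℝ) →L[ℝ] E :=
  ContinuousLinearMap.inverse (G y)

namespace StaticPatch

variable {Ω : Set E} {G : E → E →L[ℝ] E →L[ℝ] ℝ} {Γ : E → E →L[ℝ] E →L[ℝ] E}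
    {T : E → E →L[ℝ] E →L[ℝ] ℝ} {f s : E → ℝ}

theorem eventually_mem (h : StaticPatch Ω G Γ T f s) {y : E} (hy : y ∈ Ω) : ∀ᶠ z in 𝓝 y, z ∈ Ω :=
  h.isOpen.mem_nhds hy

theorem exists_equiv (h : StaticPatch Ω G Γ T f s) {y : E} (hy : y ∈ Ω) :
    ∃ e : E ≃L[ℝ] (E →L[ℝ] ℝ), (e : E →L[ℝ] (E →L[ℝ] ℝ)) = G y := by
  have hinj : Function.Injective (G y : E →ₗ[ℝ] (E →L[ℝ] ℝ)) := by
    rw [← LinearMap.ker_eq_bot, LinearMap.ker_eq_bot']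
    intro u hu
    by_contra hne
    have := h.pos y hy u hne
    have h2 : G y u = 0 := hu
    simp [h2] at this
  have hfr : Module.finrank ℝ E = Module.finrank ℝ (E →L[ℝ] ℝ) := by
    rw [← LinearEquiv.finrank_eq (LinearMap.toContinuousLinearMap (𝕜 := ℝ) (E := E) (F' := ℝ))]
    exact (Subspace.dual_finrank_eq).symm
  refine ⟨(LinearEquiv.ofInjectiveOfFinrankEq _ hinj hfr).toContinuousLinearEquiv, ?_⟩
  ext u v; rfl

theorem sharp_spec (h : StaticPatch Ω G Γ T f s) {y : E} (hy : y ∈ Ω) (ξ : E →L[ℝ] ℝ) (w : E) :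
    G y (sharp G y ξ) w = ξ w := by
  obtain ⟨e, he⟩ := h.exists_equiv hy
  unfold sharp
  rw [← he, ContinuousLinearMap.inverse_equiv]
  simp

theorem contDiffAt_sharp (h : StaticPatch Ω G Γ T f s) {y : E} (hy : y ∈ Ω) :
    ContDiffAt ℝ ∞ (sharp G) y := by
  obtain ⟨e, he⟩ := h.exists_equiv hy
  have h1 := contDiffAt_map_inverse (𝕜 := ℝ) (n := ∞) e
  rw [he] at h1
  exact h1.comp y (h.smoothG y hy)

theorem eq_of_forall (h : StaticPatch Ω G Γ T f s) {y : E} (hy : y ∈ Ω) {u v : E}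
    (huv : ∀ w, G y u w = G y v w) : u = v := by
  by_contra hne
  have := h.pos y hy (u - v) (sub_ne_zero.2 hne)
  have h2 := huv (u - v)
  simp [h2] at this

theorem skew (h : StaticPatch Ω G Γ T f s) {y : E} (hy : y ∈ Ω) (u v w z : E) :
    G y (curv Γ y u v w) z = - G y (curv Γ y u v z) w := by
  rw [metric_curv_skew (h.smoothΓ y hy) (h.smoothG y hy)
    ((h.eventually_mem hy).mono fun z hz => h.compat z hz), h.symm y hy w]

theorem pair (h : StaticPatch Ω G Γ T f s) {y : E} (hy : y ∈ Ω) (u v w z : E) :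
    G y (curv Γ y u v w) z = G y (curv Γ y w z u) v := by
  refine pair_symm_of_bianchi (fun u v w z => G y (curv Γ y u v w) z) ?_ (h.skew hy) ?_ u v w z
  · intro u v w z
    rw [curv_swap]; simp
  · intro u v w z
    have := first_bianchi (h.smoothΓ y hy)
      ((h.eventually_mem hy).mono fun z hz => h.torsion z hz) u v w
    have h2 := congrArg (fun x => G y x z) this
    simpa using h2

/-- Endomorphisms that are `G`-adjoint to each other have the same trace. -/
theorem trace_adjoint (h : StaticPatch Ω G Γ T f s) {y : E} (hy : y ∈ Ω) (L L' : E →L[ℝ] E)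
    (hL : ∀ u z, G y (L u) z = G y (L' z) u) : traceL L = traceL L' := by
  obtain ⟨e, he⟩ := h.exists_equiv hy
  let e' : E ≃ₗ[ℝ] Module.Dual ℝ E :=
    e.toLinearEquiv.trans (LinearMap.toContinuousLinearMap (𝕜 := ℝ) (E := E) (F' := ℝ)).symm
  have h1 : e'.conj (L' : E →ₗ[ℝ] E) = Module.Dual.transpose (R := ℝ) (L : E →ₗ[ℝ] E) := by
    apply LinearMap.ext
    intro ξ
    obtain ⟨z, rfl⟩ := e'.surjective ξ
    ext u
    have hee : ∀ z u, e' z u = G y z u := fun z u => by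
      rw [← he]; rfl
    rw [LinearEquiv.conj_apply]
    simp only [LinearMap.comp_apply, LinearEquiv.coe_coe, LinearEquiv.symm_apply_apply]
    rw [hee, Module.Dual.transpose_apply, LinearMap.comp_apply, hee]
    simp [← hL, h.symm y hy z]
  rw [traceL_apply, traceL_apply, ← LinearMap.trace_conj' (L' : E →ₗ[ℝ] E) e', h1,
    LinearMap.trace_transpose']

theorem T_symm (h : StaticPatch Ω G Γ T f s) {y : E} (hy : y ∈ Ω) (v w : E) :
    T y v w = T y w v := by
  have h1 := h.ric y hy v w
  have h2 := h.ric y hy w v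
  have h3 := h.trace_adjoint hy (((curv Γ y).flip w).flip v) (((curv Γ y).flip v).flip w) (by
    intro u z
    simp only [ContinuousLinearMap.flip_apply]
    rw [h.pair hy, h.skew hy, curv_swap]; simp)
  rw [h.symm y hy w v] at h2
  linarith

theorem differentiableAt (h : StaticPatch Ω G Γ T f s) {y : E} (hy : y ∈ Ω) :
    DifferentiableAt ℝ G y ∧ DifferentiableAt ℝ Γ y ∧ DifferentiableAt ℝ T y ∧
      DifferentiableAt ℝ f y ∧ DifferentiableAt ℝ s y ∧ DifferentiableAt ℝ (fderiv ℝ f) y ∧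
      DifferentiableAt ℝ (curv Γ) y :=
  ⟨(h.smoothG y hy).differentiableAt (by simp), (h.smoothΓ y hy).differentiableAt (by simp),
    (h.smoothT y hy).differentiableAt (by simp), (h.smoothf y hy).differentiableAt (by simp),
    (h.smooths y hy).differentiableAt (by simp),
    ((h.smoothf y hy).fderiv_right (m := ∞) (by simp)).differentiableAt (by simp),
    (contDiffAt_curv (h.smoothΓ y hy)).differentiableAt (by simp)⟩

/-- Commuting the third covariant derivatives of `f`. -/
theorem hess_comm (h : StaticPatch Ω G Γ T f s) {y : E} (hy : y ∈ Ω) (u v w : E) :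
    f y * (covForm Γ T y u v w - covForm Γ T y v u w) + fderiv ℝ f y u * T y v w
      - fderiv ℝ f y v * T y u w = - fderiv ℝ f y (curv Γ y u v w) := by
  obtain ⟨-, hΓ, hT, hf, -, hf1, -⟩ := h.differentiableAt hy
  have hf2 : DifferentiableAt ℝ (fderiv ℝ (fderiv ℝ f)) y :=
    (((h.smoothf y hy).fderiv_right (m := ∞) (by simp)).fderiv_right (m := ∞)
      (by simp)).differentiableAt (by simp)
  have key : ∀ u v w, fderiv ℝ (fderiv ℝ (fderiv ℝ f)) y u v w
      - (fderiv ℝ (fderiv ℝ f) y u (Γ y v w) + fderiv ℝ f y (fderiv ℝ Γ y u v w))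
      = fderiv ℝ f y u * T y v w + f y * fderiv ℝ T y u v w := by
    intro u v w
    have h1 := (hasFDerivAt_apply₂ hf2 v w).sub
      (hf1.hasFDerivAt.clm_apply (hasFDerivAt_apply₂ hΓ v w))
    have h2 := hf.hasFDerivAt.mul (hasFDerivAt_apply₂ hT v w)
    have h3 := h1.congr_of_eventuallyEq (f₁ := fun z => f z * T z v w)
      ((h.eventually_mem hy).mono fun z hz => (h.static z hz v w).symm)
    have := congrArg (fun L => L u) (h2.unique h3)
    simp at this
    linarith
  have hsym := congrArg (fun L => L w)
    ((((h.smoothf y hy).fderiv_right (m := ∞) (by simp)).isSymmSndFDerivAt two_le_smooth).eq u v)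
  have k1 := key u v w
  have k2 := key v u w
  have s1 := h.static y hy u (Γ y v w)
  have s2 := h.static y hy v (Γ y u w)
  simp only [covForm, curv_apply, map_add, map_sub]
  rw [h.torsion y hy v u]
  linear_combination hsym - k1 + k2 - s1 + s2

/-- The Ricci tensor `T + s G` is a Codazzi tensor, since the curvature is harmonic. -/
theorem ric_codazzi (h : StaticPatch Ω G Γ T f s) {y : E} (hy : y ∈ Ω) (u v w : E) :
    covForm Γ T y u v w + fderiv ℝ s y u * G y v w =
      covForm Γ T y w v u + fderiv ℝ s y w * G y v u := by
  obtain ⟨hG, hΓ, hT, hf, hs, hf1, hR⟩ := h.differentiableAt hy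
  -- the trace of the covariant derivative of the curvature is that of the Ricci tensor
  have key : ∀ m v w, ∀ L : E →L[ℝ] E, (∀ u, L u = covCurv Γ y m u w v) →
      covForm Γ T y m v w + fderiv ℝ s y m * G y v w = traceL L := by
    intro m v w L hL
    have h1 : HasFDerivAt (fun z => T z v w + s z * G z v w) _ y :=
      (hasFDerivAt_apply₂ hT v w).add (hs.hasFDerivAt.mul (hasFDerivAt_apply₂ hG v w))
    have h2 : HasFDerivAt (fun z => traceL (((curv Γ z).flip w).flip v)) _ y :=
      (ricL v w).hasFDerivAt.comp y hR.hasFDerivAt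
    have h3 := h2.congr_of_eventuallyEq (f₁ := fun z => T z v w + s z * G z v w)
      ((h.eventually_mem hy).mono fun z hz => h.ric z hz v w)
    have h4 := congrArg (fun L => L m) (h1.unique h3)
    have r1 := h.ric y hy (Γ y m v) w
    have r2 := h.ric y hy v (Γ y m w)
    have c := h.compat y hy m v w
    -- a commutator has no trace
    have hcomm : traceL ((Γ y m).comp (((curv Γ y).flip w).flip v)
        - (((curv Γ y).flip w).flip v).comp (Γ y m)) = 0 := by
      rw [map_sub, sub_eq_zero, traceL_apply, traceL_apply]
      exact LinearMap.trace_mul_comm ℝ (Γ y m : E →ₗ[ℝ] E)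
        ((((curv Γ y).flip w).flip v : E →L[ℝ] E) : E →ₗ[ℝ] E)
    have hLe : L = ((fderiv ℝ (curv Γ) y m).flip w).flip v
        + ((Γ y m).comp (((curv Γ y).flip w).flip v)
          - (((curv Γ y).flip w).flip v).comp (Γ y m))
        - ((curv Γ y).flip (Γ y m w)).flip v - ((curv Γ y).flip w).flip (Γ y m v) := by
      ext u
      rw [hL]
      simp [covCurv]
      abel
    rw [hLe, map_sub, map_sub, map_add, hcomm, ← r1, ← r2]
    have h5 : fderiv ℝ T y m v w + (s y * fderiv ℝ G y m v w + G y v w * fderiv ℝ s y m)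
        = traceL (((fderiv ℝ (curv Γ) y m).flip w).flip v) := by
      simpa [ricL_apply] using h4
    rw [← h5, c]
    simp only [covForm]
    ring
  have hlin : ∀ w v u : E, ∃ L : E →L[ℝ] E, ∀ m, L m = covCurv Γ y w m u v := fun w v u =>
    ⟨((fderiv ℝ (curv Γ) y w).flip u).flip v + ((Γ y w).comp (((curv Γ y).flip u).flip v)
          - (((curv Γ y).flip u).flip v).comp (Γ y w))
        - ((curv Γ y).flip (Γ y w u)).flip v - ((curv Γ y).flip u).flip (Γ y w v), fun m => by
      simp [covCurv]; abel⟩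
  have hswap : ∀ m u v w, covCurv Γ y m u v w = - covCurv Γ y m v u w := fun m u v w => by
    have hd : fderiv ℝ (curv Γ) y m u v w = - fderiv ℝ (curv Γ) y m v u w := by
      rw [fderiv_curv_apply (h.smoothΓ y hy), fderiv_curv_apply (h.smoothΓ y hy)]; abel
    simp only [covCurv]
    rw [hd, curv_swap Γ y u v, curv_swap Γ y (Γ y m u) v, curv_swap Γ y u (Γ y m v),
      curv_swap Γ y u v (Γ y m w)]
    simp only [map_neg]
    abel
  obtain ⟨L1, hL1⟩ := hlin u v w
  obtain ⟨L2, hL2⟩ := hlin w v u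
  rw [key u v w L1 hL1, key w v u L2 hL2]
  -- by the second Bianchi identity, the difference of the two sides is a divergence of the curvature
  have := h.harmonic y hy u w v (L1 - L2) (fun m => by
    have hb := second_bianchi (h.smoothΓ y hy) (h.torsion y hy) m u w v
    rw [hswap u w m] at hb
    simp only [sub_apply, hL1, hL2]
    have : covCurv Γ y u m w v - covCurv Γ y w m u v = covCurv Γ y m u w v
      - (covCurv Γ y m u w v + -covCurv Γ y u m w v + covCurv Γ y w m u v) := by abel
    rw [this, hb, sub_zero])
  rw [map_sub] at this
  linarith

end StaticPatch
end Patch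

/-! ### The gradient of the static potential -/

section Identities

variable {E : Type*} [NormedAddCommGroup E] [NormedSpace ℝ E] [FiniteDimensional ℝ E]

/-- The gradient of `f` with respect to the metric `G`. -/
def gradG (G : E → E →L[ℝ] E →L[ℝ] ℝ) (f : E → ℝ) (y : E) : E := sharp G y (fderiv ℝ f y)

/-- The endomorphism of the tangent space that the bilinear form `T` defines through `G`. -/
def sharpT (G T : E → E →L[ℝ] E →L[ℝ] ℝ) (y : E) : E →L[ℝ] E := (sharp G y).comp (T y)

namespace StaticPatch

variable {Ω : Set E} {G : E → E →L[ℝ] E →L[ℝ] ℝ} {Γ : E → E →L[ℝ] E →L[ℝ] E}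
    {T : E → E →L[ℝ] E →L[ℝ] ℝ} {f s : E → ℝ} {y : E}

theorem G_gradG (h : StaticPatch Ω G Γ T f s) (hy : y ∈ Ω) (w : E) :
    G y (gradG G f y) w = fderiv ℝ f y w := h.sharp_spec hy _ w

theorem G_sharpT (h : StaticPatch Ω G Γ T f s) (hy : y ∈ Ω) (v w : E) :
    G y (sharpT G T y v) w = T y v w := h.sharp_spec hy _ w

theorem gradG_ne (h : StaticPatch Ω G Γ T f s) (hy : y ∈ Ω) : gradG G f y ≠ 0 := by
  intro h0
  apply h.df_ne y hy
  ext w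
  rw [← h.G_gradG hy, h0]; simp

theorem df_gradG_pos (h : StaticPatch Ω G Γ T f s) (hy : y ∈ Ω) :
    0 < fderiv ℝ f y (gradG G f y) := by
  rw [← h.G_gradG hy]; exact h.pos y hy _ (h.gradG_ne hy)

theorem covT_symm (h : StaticPatch Ω G Γ T f s) (hy : y ∈ Ω) (a v w : E) :
    covForm Γ T y a v w = covForm Γ T y a w v := by
  have hT := (h.differentiableAt hy).2.2.1
  have h1 := (hasFDerivAt_apply₂ hT w v).congr_of_eventuallyEq (f₁ := fun z => T z v w)
    ((h.eventually_mem hy).mono fun z hz => h.T_symm hz v w)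
  have h2 := congrArg (fun L => L a) ((hasFDerivAt_apply₂ hT v w).unique h1)
  simp only [ContinuousLinearMap.flip_apply] at h2
  simp only [covForm]
  rw [h2, h.T_symm hy _ w, h.T_symm hy v]; ring

/-- A trace of `hess_comm`, in which the Codazzi equation for `Ric` leaves only `ds`. -/
theorem f_mul_ds (h : StaticPatch Ω G Γ T f s) (hy : y ∈ Ω) (u : E) :
    f y * fderiv ℝ s y u = 0 := by
  -- the commutation formula, contracted with the metric in its last two arguments
  have hendo : fderiv ℝ f y u • sharpT G T y
      - (fderiv ℝ f y).smulRight (sharpT G T y u)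
      + f y • ((fderiv ℝ s y).smulRight u - fderiv ℝ s y u • ContinuousLinearMap.id ℝ E)
      = (curv Γ y u).flip (gradG G f y) := by
    ext v
    apply h.eq_of_forall hy
    intro w
    have h1 := h.hess_comm hy u v w
    have h2 := h.ric_codazzi hy u w v
    rw [h.covT_symm hy u w v] at h2
    have h3 : fderiv ℝ f y (curv Γ y u v w) = - G y (curv Γ y u v (gradG G f y)) w := by
      rw [h.skew hy, h.symm y hy _ (gradG G f y), h.G_gradG hy, neg_neg]
    simp [h.G_sharpT hy]
    rw [h.symm y hy w v, h.symm y hy w u, h.covT_symm hy v w u] at h2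
    linear_combination h1 - f y * h2 - h3
  have htr := congrArg traceL hendo
  have hric := h.ric y hy (gradG G f y) u
  have hflip : ((curv Γ y).flip u).flip (gradG G f y) = - (curv Γ y u).flip (gradG G f y) := by
    ext v
    simp [curv_swap Γ y v u]
  rw [hflip, map_neg] at hric
  have hsm : ∀ (ξ : E →L[ℝ] ℝ) (v : E), traceL (ξ.smulRight v) = ξ v := fun ξ v =>
    LinearMap.trace_smulRight (R := ℝ) (ξ : E →ₗ[ℝ] ℝ) v
  have hid : traceL (ContinuousLinearMap.id ℝ E) = Module.finrank ℝ E := LinearMap.trace_id ℝ E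
  rw [← neg_eq_iff_eq_neg.2 hric] at htr
  simp only [map_add, map_sub, map_smul, hsm, hid, smul_eq_mul] at htr
  rw [h.scal y hy _ (h.G_sharpT hy), ← h.G_gradG hy (sharpT G T y u), ← h.symm y hy,
    h.G_sharpT hy, h.T_symm hy u, h.G_gradG hy] at htr
  have hn : (2 : ℝ) ≤ Module.finrank ℝ E := by exact_mod_cast h.two_le
  have : ((Module.finrank ℝ E : ℝ) - 1) * (f y * fderiv ℝ s y u) = 0 := by linarith
  rcases mul_eq_zero.1 this with h0 | h0
  · linarith
  · exact h0

/-- The scalar curvature is constant. -/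
theorem ds_eq_zero (h : StaticPatch Ω G Γ T f s) (hy : y ∈ Ω) : fderiv ℝ s y = 0 := by
  by_contra hne
  have hc : ContinuousAt (fderiv ℝ s) y :=
    ((h.smooths y hy).fderiv_right (m := ∞) (by simp)).continuousAt
  have h1 : ∀ᶠ z in 𝓝 y, fderiv ℝ s z ≠ 0 := hc.eventually_ne hne
  -- `f` would vanish near `y`, against `df ≠ 0`
  have h2 : f =ᶠ[𝓝 y] fun _ => (0 : ℝ) := by
    filter_upwards [h1, h.eventually_mem hy] with z hz hzΩ
    by_contra hf
    apply hz
    ext u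
    simpa [hf] using h.f_mul_ds hzΩ u
  apply h.df_ne y hy
  rw [h2.fderiv_eq]; simp

/-- Since `s` is constant, `T` is a Codazzi tensor. -/
theorem covT_codazzi (h : StaticPatch Ω G Γ T f s) (hy : y ∈ Ω) (u v w : E) :
    covForm Γ T y u v w = covForm Γ T y v u w := by
  have h1 := h.ric_codazzi hy u w v
  simp only [h.ds_eq_zero hy, zero_apply, zero_mul, add_zero] at h1
  rw [h.covT_symm hy u, h1, h.covT_symm hy v]

/-- By the Codazzi equation, the commutation formula for the derivatives of `f` is algebraic in `T`. -/
theorem df_curv (h : StaticPatch Ω G Γ T f s) (hy : y ∈ Ω) (u v w : E) :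
    fderiv ℝ f y (curv Γ y u v w) =
      fderiv ℝ f y v * T y u w - fderiv ℝ f y u * T y v w := by
  have h1 := h.hess_comm hy u v w
  rw [h.covT_codazzi hy u v w] at h1
  linarith

/-- The formula for `df(R(w, z)∇f)`, which vanishes since `R(w, z)` is skew. -/
theorem T_gradG_swap (h : StaticPatch Ω G Γ T f s) (hy : y ∈ Ω) (w z : E) :
    T y (gradG G f y) w * fderiv ℝ f y z = T y (gradG G f y) z * fderiv ℝ f y w := by
  have h1 := h.df_curv hy w z (gradG G f y)
  rw [← h.G_gradG hy (curv Γ y w z (gradG G f y))] at h1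
  have h2 := h.skew hy w z (gradG G f y) (gradG G f y)
  rw [h.symm y hy] at h2
  have h3 := h.symm y hy (gradG G f y) (curv Γ y w z (gradG G f y))
  rw [h.T_symm hy w, h.T_symm hy z] at h1
  linarith

/-- `∇f` is an eigenvector of `T`, hence of the Ricci tensor. -/
theorem T_gradG (h : StaticPatch Ω G Γ T f s) (hy : y ∈ Ω) (w : E) :
    T y (gradG G f y) w = T y (gradG G f y) (gradG G f y) / fderiv ℝ f y (gradG G f y)
      * fderiv ℝ f y w := by
  have := h.df_gradG_pos hy
  rw [div_mul_eq_mul_div, eq_div_iff this.ne', h.T_gradG_swap hy]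

theorem curv_gradG (h : StaticPatch Ω G Γ T f s) (hy : y ∈ Ω) (u c d : E) :
    G y (curv Γ y u (gradG G f y) c) d =
      fderiv ℝ f y d * T y c u - fderiv ℝ f y c * T y d u := by
  rw [h.pair hy, h.symm y hy, h.G_gradG hy, h.df_curv hy]

theorem contDiffAt_gradG (h : StaticPatch Ω G Γ T f s) (hy : y ∈ Ω) :
    ContDiffAt ℝ ∞ (gradG G f) y :=
  (h.contDiffAt_sharp hy).clm_apply ((h.smoothf y hy).fderiv_right (by simp))

theorem contDiffAt_sharpT (h : StaticPatch Ω G Γ T f s) (hy : y ∈ Ω) :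
    ContDiffAt ℝ ∞ (sharpT G T) y :=
  (h.contDiffAt_sharp hy).clm_comp (h.smoothT y hy)

/-- `∇_a ∇f = f T a`. -/
theorem cov_gradG (h : StaticPatch Ω G Γ T f s) (hy : y ∈ Ω) (a : E) :
    fderiv ℝ (gradG G f) y a = f y • sharpT G T y a - Γ y a (gradG G f y) := by
  obtain ⟨hG, -, -, -, -, hf1, -⟩ := h.differentiableAt hy
  have hN : DifferentiableAt ℝ (gradG G f) y := (h.contDiffAt_gradG hy).differentiableAt (by simp)
  rw [eq_sub_iff_add_eq]
  apply h.eq_of_forall hy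
  intro w
  have h1 := (hG.hasFDerivAt.clm_apply hN.hasFDerivAt).clm_apply (hasFDerivAt_const w y)
  have h2 := (hf1.hasFDerivAt.clm_apply (hasFDerivAt_const w y)).congr_of_eventuallyEq
    (f₁ := fun z => G z (gradG G f z) w)
    ((h.eventually_mem hy).mono fun z hz => h.G_gradG hz w)
  have h3 := congrArg (fun L => L a) (h1.unique h2)
  simp [h.compat y hy, h.G_gradG hy] at h3
  have h4 := h.static y hy a w
  simp [h.G_sharpT hy]
  linarith

theorem fderiv_normSq_gradG (h : StaticPatch Ω G Γ T f s) (hy : y ∈ Ω) (a : E) :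
    fderiv ℝ (fun z => fderiv ℝ f z (gradG G f z)) y a = 2 * f y * T y (gradG G f y) a := by
  obtain ⟨hG, -, -, -, -, hf1, -⟩ := h.differentiableAt hy
  have hN : DifferentiableAt ℝ (gradG G f) y := (h.contDiffAt_gradG hy).differentiableAt (by simp)
  have h1 := hf1.hasFDerivAt.clm_apply hN.hasFDerivAt
  rw [h1.fderiv]
  have h4 := h.static y hy a (gradG G f y)
  simp only [add_apply, ContinuousLinearMap.comp_apply, ContinuousLinearMap.flip_apply,
    h.cov_gradG hy, map_sub, map_smul, smul_eq_mul]
  rw [← h.G_gradG hy (sharpT G T y a), h.symm y hy, h.G_sharpT hy]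
  rw [h.T_symm hy a] at *
  linarith

/-- The covariant derivative of `T` in the direction of `∇f`: by the Codazzi equation it is
`(∇_v T)(∇f, w)`, which comes from differentiating the eigenvector equation of `∇f`. -/
theorem covT_gradG (h : StaticPatch Ω G Γ T f s) (hy : y ∈ Ω) (v w : E)
    (hw : fderiv ℝ f y w = 0) :
    covForm Γ T y (gradG G f y) v w = f y *
      (T y (gradG G f y) (gradG G f y) / fderiv ℝ f y (gradG G f y) * T y v w
        - T y (sharpT G T y v) w) := by
  obtain ⟨hG, -, hT, -, -, hf1, -⟩ := h.differentiableAt hy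
  have hN : DifferentiableAt ℝ (gradG G f) y := (h.contDiffAt_gradG hy).differentiableAt (by simp)
  have hq := h.df_gradG_pos hy
  have d1 : ∀ w, HasFDerivAt (fun z => T z (gradG G f z) w) _ y := fun w =>
    (hT.hasFDerivAt.clm_apply hN.hasFDerivAt).clm_apply (hasFDerivAt_const w y)
  have d2 : ∀ w, HasFDerivAt (fun z => fderiv ℝ f z w) _ y := fun w =>
    hf1.hasFDerivAt.clm_apply (hasFDerivAt_const w y)
  have h1 := (d1 w).mul (d2 (gradG G f y))
  have h2 := ((d1 (gradG G f y)).mul (d2 w)).congr_of_eventuallyEq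
    (f₁ := fun z => T z (gradG G f z) w * fderiv ℝ f z (gradG G f y))
    ((h.eventually_mem hy).mono fun z hz => h.T_gradG_swap hz w (gradG G f y))
  have h3 := congrArg (fun L => L v) (h1.unique h2)
  have hw0 : T y (gradG G f y) w = 0 := by rw [h.T_gradG hy, hw, mul_zero]
  simp [hw, hw0, h.cov_gradG hy] at h3
  have h4 := h.static y hy v w
  rw [h.covT_codazzi hy, covForm, h.T_gradG hy (Γ y v w)]
  generalize fderiv ℝ f y (gradG G f y) = q at *
  field_simp
  linear_combination h3 + T y (gradG G f y) (gradG G f y) * h4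

/-- The derivative of the identity `curv_gradG`, for vectors `c` and `d` orthogonal to `∇f`. -/
theorem covCurv_gradG_right (h : StaticPatch Ω G Γ T f s) (hy : y ∈ Ω) (a u c d : E)
    (hc : fderiv ℝ f y c = 0) (hd : fderiv ℝ f y d = 0) :
    G y (covCurv Γ y a u (gradG G f y) c) d =
      f y * (T y a d * T y c u - T y a c * T y d u - G y (curv Γ y u (sharpT G T y a) c) d) := by
  obtain ⟨hG, hΓ, hT, -, -, hf1, hR⟩ := h.differentiableAt hy
  have hN : DifferentiableAt ℝ (gradG G f) y := (h.contDiffAt_gradG hy).differentiableAt (by simp)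
  have d2 : ∀ w, HasFDerivAt (fun z => fderiv ℝ f z w) _ y := fun w =>
    hf1.hasFDerivAt.clm_apply (hasFDerivAt_const w y)
  have hRd := ((hR.hasFDerivAt.clm_apply (hasFDerivAt_const u y)).clm_apply hN.hasFDerivAt).clm_apply
    (hasFDerivAt_const c y)
  have h1 := (hG.hasFDerivAt.clm_apply hRd).clm_apply (hasFDerivAt_const d y)
  have h2 := (((d2 d).mul (hasFDerivAt_apply₂ hT c u)).sub
    ((d2 c).mul (hasFDerivAt_apply₂ hT d u))).congr_of_eventuallyEq
    (f₁ := fun z => G z (curv Γ z u (gradG G f z) c) d)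
    ((h.eventually_mem hy).mono fun z hz => h.curv_gradG hz u c d)
  have h3 := congrArg (fun L => L a) (h1.unique h2)
  simp [hc, hd, h.compat y hy, h.cov_gradG hy] at h3
  have e1 := h.curv_gradG hy (Γ y a u) c d
  have e2 := h.curv_gradG hy u (Γ y a c) d
  have e3 := h.curv_gradG hy u c (Γ y a d)
  have s1 := h.static y hy a c
  have s2 := h.static y hy a d
  rw [hc, hd] at e1
  rw [hd] at e2
  rw [hc] at e3
  simp only [covCurv, map_add, map_sub, add_apply, sub_apply]
  linear_combination h3 - e1 - e2 - e3 - T y d u * s1 + T y c u * s2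

/-- The covariant derivative of the curvature tensor in the direction of `∇f`: by the second
Bianchi identity it is determined by the curvature and by `T`. -/
theorem covCurv_gradG (h : StaticPatch Ω G Γ T f s) (hy : y ∈ Ω) (a b c d : E)
    (hc : fderiv ℝ f y c = 0) (hd : fderiv ℝ f y d = 0) :
    G y (covCurv Γ y (gradG G f y) a b c) d =
      f y * (2 * (T y a c * T y b d - T y a d * T y b c)
        - G y (curv Γ y (sharpT G T y a) b c) d - G y (curv Γ y a (sharpT G T y b) c) d) := by
  have hb := second_bianchi (h.smoothΓ y hy) (h.torsion y hy) (gradG G f y) a b c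
  have h1 := h.covCurv_gradG_right hy a b c d hc hd
  have h2 := h.covCurv_gradG_right hy b a c d hc hd
  have h3 := congrArg (fun x => G y x d) hb
  have hsw : covCurv Γ y b (gradG G f y) a c = - covCurv Γ y b a (gradG G f y) c := by
    have hd : fderiv ℝ (curv Γ) y b (gradG G f y) a c
        = - fderiv ℝ (curv Γ) y b a (gradG G f y) c := by
      rw [fderiv_curv_apply (h.smoothΓ y hy), fderiv_curv_apply (h.smoothΓ y hy)]; abel
    simp only [covCurv]
    rw [hd, curv_swap Γ y (gradG G f y) a, curv_swap Γ y _ a, curv_swap Γ y (gradG G f y) _,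
      curv_swap Γ y (gradG G f y) a]
    simp only [map_neg]
    abel
  rw [hsw] at h3
  rw [curv_swap Γ y b] at h1
  simp at h1 h3
  rw [h.T_symm hy c b, h.T_symm hy d b] at h1
  rw [h.T_symm hy c a, h.T_symm hy d a] at h2
  linear_combination h3 - h1 + h2

end StaticPatch
end Identities

/-! ### Evolution along the normalized gradient flow -/

section Velocity

variable {E : Type*} [NormedAddCommGroup E] [NormedSpace ℝ E]

/-- The squared norm `|∇f|² = df(∇f)`. -/
def normSqGrad (G : E → E →L[ℝ] E →L[ℝ] ℝ) (f : E → ℝ) (y : E) : ℝ :=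
  fderiv ℝ f y (gradG G f y)

/-- The vector field `∇f / |∇f|²`, along which `f` grows with unit speed. -/
def vel (G : E → E →L[ℝ] E →L[ℝ] ℝ) (f : E → ℝ) (y : E) : E :=
  (normSqGrad G f y)⁻¹ • gradG G f y

theorem covForm_vel (Γ : E → E →L[ℝ] E →L[ℝ] E) (G S : E → E →L[ℝ] E →L[ℝ] ℝ)
    (f : E → ℝ) (y v w : E) :
    covForm Γ S y (vel G f y) v w = (normSqGrad G f y)⁻¹ * covForm Γ S y (gradG G f y) v w := by
  simp [covForm, vel]; ring

/-- The Leibniz rule for a bilinear form along a curve: `U` and `W` are the covariant derivatives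
of the vector fields `u` and `w`. -/
theorem hasDerivAt_form {Γ : E → E →L[ℝ] E →L[ℝ] E} {S : E → E →L[ℝ] E →L[ℝ] ℝ} {Y u w : ℝ → E}
    {t : ℝ} {V U W : E}
    (hS : DifferentiableAt ℝ S (Y t)) (hY : HasDerivAt Y V t)
    (hu : HasDerivAt u (U - Γ (Y t) V (u t)) t) (hw : HasDerivAt w (W - Γ (Y t) V (w t)) t) :
    HasDerivAt (fun r => S (Y r) (u r) (w r))
      (covForm Γ S (Y t) V (u t) (w t) + S (Y t) U (w t) + S (Y t) (u t) W) t := by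
  have h1 := ((hS.hasFDerivAt.comp_hasDerivAt t hY).clm_apply hu).clm_apply hw
  refine h1.congr_deriv ?_
  simp [covForm]
  ring

end Velocity

section Curve

variable {E : Type*} [NormedAddCommGroup E] [NormedSpace ℝ E] [FiniteDimensional ℝ E]

namespace StaticPatch

variable {Ω : Set E} {G : E → E →L[ℝ] E →L[ℝ] ℝ} {Γ : E → E →L[ℝ] E →L[ℝ] E}
    {T : E → E →L[ℝ] E →L[ℝ] ℝ} {f s : E → ℝ} {y : E}

theorem normSqGrad_pos (h : StaticPatch Ω G Γ T f s) (hy : y ∈ Ω) : 0 < normSqGrad G f y :=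
  h.df_gradG_pos hy

theorem contDiffAt_normSqGrad (h : StaticPatch Ω G Γ T f s) (hy : y ∈ Ω) :
    ContDiffAt ℝ ∞ (normSqGrad G f) y :=
  ((h.smoothf y hy).fderiv_right (by simp)).clm_apply (h.contDiffAt_gradG hy)

theorem contDiffAt_vel (h : StaticPatch Ω G Γ T f s) (hy : y ∈ Ω) :
    ContDiffAt ℝ ∞ (vel G f) y :=
  ((h.contDiffAt_normSqGrad hy).inv (h.normSqGrad_pos hy).ne').smul (h.contDiffAt_gradG hy)

theorem df_vel (h : StaticPatch Ω G Γ T f s) (hy : y ∈ Ω) : fderiv ℝ f y (vel G f y) = 1 := by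
  rw [vel, map_smul, smul_eq_mul]
  exact inv_mul_cancel₀ (h.normSqGrad_pos hy).ne'

theorem T_gradG_of_tangent (h : StaticPatch Ω G Γ T f s) (hy : y ∈ Ω) {w : E}
    (hw : fderiv ℝ f y w = 0) : T y (gradG G f y) w = 0 := by
  rw [h.T_gradG hy, hw, mul_zero]

theorem df_sharpT (h : StaticPatch Ω G Γ T f s) (hy : y ∈ Ω) {w : E}
    (hw : fderiv ℝ f y w = 0) : fderiv ℝ f y (sharpT G T y w) = 0 := by
  rw [← h.G_gradG hy, h.symm y hy, h.G_sharpT hy, h.T_symm hy, h.T_gradG_of_tangent hy hw]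

theorem T_sharpT_comm (h : StaticPatch Ω G Γ T f s) (hy : y ∈ Ω) (v w : E) :
    T y v (sharpT G T y w) = T y (sharpT G T y v) w := by
  rw [← h.G_sharpT hy, h.symm y hy, h.G_sharpT hy, h.T_symm hy]

/-- On vectors orthogonal to `∇f`, the covariant derivative of `∇f / |∇f|²` is `f / |∇f|² T`, because
`|∇f|²` is constant to first order in their directions. -/
theorem fderiv_vel (h : StaticPatch Ω G Γ T f s) (hy : y ∈ Ω) {w : E}
    (hw : fderiv ℝ f y w = 0) :
    fderiv ℝ (vel G f) y w =
      (f y / normSqGrad G f y) • sharpT G T y w - Γ y (vel G f y) w := by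
  have hN : DifferentiableAt ℝ (gradG G f) y := (h.contDiffAt_gradG hy).differentiableAt (by simp)
  have hq : DifferentiableAt ℝ (normSqGrad G f) y :=
    (h.contDiffAt_normSqGrad hy).differentiableAt (by simp)
  have hqd : fderiv ℝ (normSqGrad G f) y w = 0 := by
    have := h.fderiv_normSq_gradG hy w
    rw [h.T_gradG_of_tangent hy hw, mul_zero] at this
    exact this
  have h1 : HasFDerivAt (vel G f) _ y :=
    ((hasDerivAt_inv (h.normSqGrad_pos hy).ne').comp_hasFDerivAt y hq.hasFDerivAt).smul hN.hasFDerivAt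
  rw [h1.fderiv, h.torsion y hy]
  simp [hqd, h.cov_gradG hy, vel, smul_sub, smul_smul]
  rw [div_eq_inv_mul]

/-- Along the flow of `vel`, Lie transported vectors keep their `df`. -/
theorem hasDerivAt_df (h : StaticPatch Ω G Γ T f s) {Y e : ℝ → E} {t : ℝ} (hy : Y t ∈ Ω)
    (hY : HasDerivAt Y (vel G f (Y t)) t)
    (he : HasDerivAt e (fderiv ℝ (vel G f) (Y t) (e t)) t) :
    HasDerivAt (fun r => fderiv ℝ f (Y r) (e r)) 0 t := by
  have hf1 := (h.differentiableAt hy).2.2.2.2.2.1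
  have hV : DifferentiableAt ℝ (vel G f) (Y t) := (h.contDiffAt_vel hy).differentiableAt (by simp)
  have h1 := (hf1.hasFDerivAt.comp_hasDerivAt t hY).clm_apply he
  have h2 := (hf1.hasFDerivAt.clm_apply hV.hasFDerivAt).congr_of_eventuallyEq
    (f₁ := fun _ => (1 : ℝ)) ((h.eventually_mem hy).mono fun z hz => (h.df_vel hz).symm)
  have h3 := congrArg (fun L => L (e t)) (h2.unique (hasFDerivAt_const (1 : ℝ) (Y t)))
  have hsym := ((h.smoothf (Y t) hy).isSymmSndFDerivAt two_le_smooth).eq (vel G f (Y t)) (e t)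
  refine h1.congr_deriv ?_
  simp at h3
  rw [hsym]
  simp only [Function.comp_apply]
  linarith

/-- The Leibniz rule for the curvature tensor along a curve, with the covariant derivatives `A`, `B`,
`C`, `D` of the four vector fields. -/
theorem hasDerivAt_curv {Y a b c d : ℝ → E} {t : ℝ} {V A B C D : E}
    (h : StaticPatch Ω G Γ T f s) (hy : Y t ∈ Ω) (hY : HasDerivAt Y V t)
    (ha : HasDerivAt a (A - Γ (Y t) V (a t)) t) (hb : HasDerivAt b (B - Γ (Y t) V (b t)) t)
    (hc : HasDerivAt c (C - Γ (Y t) V (c t)) t) (hd : HasDerivAt d (D - Γ (Y t) V (d t)) t) :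
    HasDerivAt (fun r => G (Y r) (curv Γ (Y r) (a r) (b r) (c r)) (d r))
      (G (Y t) (covCurv Γ (Y t) V (a t) (b t) (c t)) (d t)
        + G (Y t) (curv Γ (Y t) A (b t) (c t)) (d t) + G (Y t) (curv Γ (Y t) (a t) B (c t)) (d t)
        + G (Y t) (curv Γ (Y t) (a t) (b t) C) (d t)
        + G (Y t) (curv Γ (Y t) (a t) (b t) (c t)) D) t := by
  obtain ⟨hG, -, -, -, -, -, hR⟩ := h.differentiableAt hy
  have h0 := (((hR.hasFDerivAt.comp_hasDerivAt t hY).clm_apply ha).clm_apply hb).clm_apply hc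
  have h1 := ((hG.hasFDerivAt.comp_hasDerivAt t hY).clm_apply h0).clm_apply hd
  refine h1.congr_deriv ?_
  simp [covCurv, h.compat _ hy]
  ring

variable {Y u w : ℝ → E} {t : ℝ}

/-- The equation of Lie transport along `vel`, in covariant form. -/
theorem transport_eq (h : StaticPatch Ω G Γ T f s) (hy : Y t ∈ Ω)
    (hu : HasDerivAt u (fderiv ℝ (vel G f) (Y t) (u t)) t) (hu0 : fderiv ℝ f (Y t) (u t) = 0) :
    HasDerivAt u ((f (Y t) / normSqGrad G f (Y t)) • sharpT G T (Y t) (u t)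
      - Γ (Y t) (vel G f (Y t)) (u t)) t := by
  rwa [h.fderiv_vel hy hu0] at hu

theorem hasDerivAt_normSqGrad (h : StaticPatch Ω G Γ T f s) (hy : Y t ∈ Ω)
    (hY : HasDerivAt Y (vel G f (Y t)) t) :
    HasDerivAt (fun r => normSqGrad G f (Y r))
      (2 * f (Y t) * (T (Y t) (gradG G f (Y t)) (gradG G f (Y t)) / normSqGrad G f (Y t))) t := by
  have hq : DifferentiableAt ℝ (normSqGrad G f) (Y t) :=
    (h.contDiffAt_normSqGrad hy).differentiableAt (by simp)
  have h1 := hq.hasFDerivAt.comp_hasDerivAt t hY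
  refine h1.congr_deriv ?_
  have := h.fderiv_normSq_gradG hy (vel G f (Y t))
  change fderiv ℝ (normSqGrad G f) (Y t) _ = _ at this
  rw [this, vel, map_smul, smul_eq_mul]
  ring

theorem hasDerivAt_G (h : StaticPatch Ω G Γ T f s) (hy : Y t ∈ Ω)
    (hY : HasDerivAt Y (vel G f (Y t)) t)
    (hu : HasDerivAt u (fderiv ℝ (vel G f) (Y t) (u t)) t) (hu0 : fderiv ℝ f (Y t) (u t) = 0)
    (hw : HasDerivAt w (fderiv ℝ (vel G f) (Y t) (w t)) t) (hw0 : fderiv ℝ f (Y t) (w t) = 0) :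
    HasDerivAt (fun r => G (Y r) (u r) (w r))
      (2 * (f (Y t) / normSqGrad G f (Y t)) * T (Y t) (u t) (w t)) t := by
  have h1 := hasDerivAt_form (Γ := Γ) (h.differentiableAt hy).1 hY (h.transport_eq hy hu hu0)
    (h.transport_eq hy hw hw0)
  refine h1.congr_deriv ?_
  have h2 := h.symm _ hy (u t) (sharpT G T (Y t) (w t))
  simp [covForm, h.compat _ hy, h2, h.G_sharpT hy, h.T_symm hy (w t)]
  ring

theorem hasDerivAt_T (h : StaticPatch Ω G Γ T f s) (hy : Y t ∈ Ω)
    (hY : HasDerivAt Y (vel G f (Y t)) t)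
    (hu : HasDerivAt u (fderiv ℝ (vel G f) (Y t) (u t)) t) (hu0 : fderiv ℝ f (Y t) (u t) = 0)
    (hw : HasDerivAt w (fderiv ℝ (vel G f) (Y t) (w t)) t) (hw0 : fderiv ℝ f (Y t) (w t) = 0) :
    HasDerivAt (fun r => T (Y r) (u r) (w r))
      (f (Y t) / normSqGrad G f (Y t) *
        (T (Y t) (gradG G f (Y t)) (gradG G f (Y t)) / normSqGrad G f (Y t) * T (Y t) (u t) (w t)
          + T (Y t) (sharpT G T (Y t) (u t)) (w t))) t := by
  have h1 := hasDerivAt_form (Γ := Γ) (h.differentiableAt hy).2.2.1 hY (h.transport_eq hy hu hu0)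
    (h.transport_eq hy hw hw0)
  refine h1.congr_deriv ?_
  rw [covForm_vel, h.covT_gradG hy _ _ hw0]
  simp only [map_smul, smul_apply, smul_eq_mul, h.T_sharpT_comm hy (u t)]
  rw [← normSqGrad]
  ring

/-- The logarithmic derivative of `T²` on Lie transported vectors is that of `|∇f|²`. -/
theorem hasDerivAt_T_sharpT (h : StaticPatch Ω G Γ T f s) (hy : Y t ∈ Ω)
    (hY : HasDerivAt Y (vel G f (Y t)) t)
    (hu : HasDerivAt u (fderiv ℝ (vel G f) (Y t) (u t)) t) (hu0 : fderiv ℝ f (Y t) (u t) = 0)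
    (hw : HasDerivAt w (fderiv ℝ (vel G f) (Y t) (w t)) t) (hw0 : fderiv ℝ f (Y t) (w t) = 0) :
    HasDerivAt (fun r => T (Y r) (u r) (sharpT G T (Y r) (w r)))
      (2 * (f (Y t) / normSqGrad G f (Y t)) *
        (T (Y t) (gradG G f (Y t)) (gradG G f (Y t)) / normSqGrad G f (Y t))
          * T (Y t) (u t) (sharpT G T (Y t) (w t))) t := by
  obtain ⟨hG, -, hT, -⟩ := h.differentiableAt hy
  have hTs : DifferentiableAt ℝ (sharpT G T) (Y t) :=
    (h.contDiffAt_sharpT hy).differentiableAt (by simp)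
  have h0 := (hTs.hasFDerivAt.comp_hasDerivAt t hY).clm_apply hw
  -- the covariant derivative of `sharpT` is obtained by raising an index of that of `T`
  have hcov : ∀ z, G (Y t) (fderiv ℝ (sharpT G T) (Y t) (vel G f (Y t)) (w t)
      + Γ (Y t) (vel G f (Y t)) (sharpT G T (Y t) (w t))) z
      = covForm Γ T (Y t) (vel G f (Y t)) (w t) z
        + T (Y t) (Γ (Y t) (vel G f (Y t)) (w t)) z := by
    intro z
    have k1 := (hG.hasFDerivAt.clm_apply (hTs.hasFDerivAt.clm_apply
      (hasFDerivAt_const (w t) (Y t)))).clm_apply (hasFDerivAt_const z (Y t))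
    have k2 := (hasFDerivAt_apply₂ hT (w t) z).congr_of_eventuallyEq
      (f₁ := fun x => G x (sharpT G T x (w t)) z)
      ((h.eventually_mem hy).mono fun x hx => h.G_sharpT hx (w t) z)
    have k3 := congrArg (fun L => L (vel G f (Y t))) (k1.unique k2)
    simp [h.compat _ hy, h.G_sharpT hy] at k3
    simp [covForm]
    linarith
  have h1 := hasDerivAt_form (Γ := Γ) hT hY (h.transport_eq hy hu hu0)
    (W := fderiv ℝ (sharpT G T) (Y t) (vel G f (Y t)) (w t)
      + sharpT G T (Y t) (fderiv ℝ (vel G f) (Y t) (w t))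
      + Γ (Y t) (vel G f (Y t)) (sharpT G T (Y t) (w t)))
    (w := fun r => sharpT G T (Y r) (w r)) (by simpa using h0)
  refine h1.congr_deriv ?_
  have e1 := hcov (sharpT G T (Y t) (u t))
  rw [covForm_vel, h.covT_gradG hy _ _ (h.df_sharpT hy hu0)] at e1
  rw [covForm_vel, h.covT_gradG hy _ _ (h.df_sharpT hy hw0), ← h.G_sharpT hy (u t) (_ + _),
    h.symm _ hy (sharpT G T (Y t) (u t)) (_ + _), add_right_comm, map_add (G (Y t)),
    add_apply, h.fderiv_vel hy hw0]
  have e2 := h.T_symm hy (w t) (sharpT G T (Y t) (u t))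
  have e3 := h.T_symm hy (sharpT G T (Y t) (w t)) (sharpT G T (Y t) (u t))
  have e4 := h.T_sharpT_comm hy (u t) (w t)
  rw [← normSqGrad] at *
  simp only [map_add, add_apply, map_smul, smul_apply, smul_eq_mul, map_sub, sub_apply, e2, e3,
    e4, h.G_sharpT hy] at e1 ⊢
  linear_combination e1

/-- The derivative of the numerator of the sectional curvature of the plane of two Lie transported
vectors. -/
theorem hasDerivAt_sect (h : StaticPatch Ω G Γ T f s) (hy : Y t ∈ Ω)
    (hY : HasDerivAt Y (vel G f (Y t)) t)
    (hu : HasDerivAt u (fderiv ℝ (vel G f) (Y t) (u t)) t) (hu0 : fderiv ℝ f (Y t) (u t) = 0)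
    (hw : HasDerivAt w (fderiv ℝ (vel G f) (Y t) (w t)) t) (hw0 : fderiv ℝ f (Y t) (w t) = 0) :
    HasDerivAt (fun r => G (Y r) (curv Γ (Y r) (u r) (w r) (w r)) (u r))
      (f (Y t) / normSqGrad G f (Y t) *
        (2 * (T (Y t) (u t) (w t) ^ 2 - T (Y t) (u t) (u t) * T (Y t) (w t) (w t))
          + G (Y t) (curv Γ (Y t) (u t) (w t) (sharpT G T (Y t) (w t))) (u t)
          + G (Y t) (curv Γ (Y t) (u t) (w t) (w t)) (sharpT G T (Y t) (u t)))) t := by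
  have Hu := h.transport_eq hy hu hu0
  have Hw := h.transport_eq hy hw hw0
  have h1 := h.hasDerivAt_curv hy hY Hu Hw Hw Hu
  refine h1.congr_deriv ?_
  have h2 : covCurv Γ (Y t) (vel G f (Y t)) (u t) (w t) (w t) =
      (normSqGrad G f (Y t))⁻¹ • covCurv Γ (Y t) (gradG G f (Y t)) (u t) (w t) (w t) := by
    simp [covCurv, vel, smul_sub]
  rw [h2]
  simp only [map_smul, smul_apply, smul_eq_mul, h.covCurv_gradG hy _ _ _ _ hw0 hu0]
  rw [h.T_symm hy (w t) (u t)]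
  ring

/-- In a `G`-orthogonal frame, a vector is determined by its products with the frame, and the trace
of an endomorphism is the sum of its diagonal entries. -/
theorem orthogonal_frame (h : StaticPatch Ω G Γ T f s) (hy : y ∈ Ω) {κ : Type*} [Fintype κ]
    (hcard : Fintype.card κ = Module.finrank ℝ E) (b : κ → E)
    (hb : ∀ i j, i ≠ j → G y (b i) (b j) = 0) (hb0 : ∀ i, b i ≠ 0) :
    (∀ v, (∀ i, G y v (b i) = 0) → v = 0) ∧
      ∀ L : E →L[ℝ] E, traceL L = ∑ i, G y (L (b i)) (b i) / G y (b i) (b i) := by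
  classical
  have hpos : ∀ i, 0 < G y (b i) (b i) := fun i => h.pos y hy _ (hb0 i)
  have hsum : ∀ (c : κ → ℝ) j, G y (∑ i, c i • b i) (b j) = c j * G y (b j) (b j) := by
    intro c j
    rw [map_sum, sum_apply, Finset.sum_eq_single j]
    · simp
    · intro i _ hij
      simp [hb i j hij]
    · simp
  have hli : LinearIndependent ℝ b := by
    rw [Fintype.linearIndependent_iff]
    intro c hc j
    have := hsum c j
    rw [hc] at this
    simp at this
    exact this.resolve_right (hpos j).ne'
  let B := basisOfLinearIndependentOfCardEqFinrank' b hli hcard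
  have hB : ∀ i, B i = b i := fun i => by simp [B]
  have hrepr : ∀ v j, G y v (b j) = B.repr v j * G y (b j) (b j) := by
    intro v j
    rw [← hsum]
    congr 2
    conv_lhs => rw [← B.sum_repr v]
    simp only [hB]
  constructor
  · intro v hv
    apply B.repr.injective
    ext j
    have := hrepr v j
    rw [hv] at this
    simpa using (mul_eq_zero.1 this.symm).resolve_right (hpos j).ne'
  · intro L
    rw [traceL_apply, LinearMap.trace_eq_matrix_trace ℝ B, Matrix.trace]
    refine Finset.sum_congr rfl fun i _ => ?_
    rw [Matrix.diag_apply, LinearMap.toMatrix_apply, eq_div_iff (hpos i).ne', hB]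
    exact (hrepr _ i).symm

end StaticPatch
end Curve

/-! ### Frames transported by the gradient flow -/

theorem eq_at_zero_of_hasDerivAt_zero {u : ℝ → ℝ} {ε : ℝ} (hε : 0 < ε)
    (hu : ∀ t ∈ Set.Ioo (-ε) ε, HasDerivAt u 0 t) : ∀ t ∈ Set.Ioo (-ε) ε, u t = u 0 := by
  intro t ht
  exact isOpen_Ioo.is_const_of_deriv_eq_zero isPreconnected_Ioo
    (fun r hr => (hu r hr).differentiableAt.differentiableWithinAt)
    (fun r hr => (hu r hr).deriv) ht ⟨by linarith, hε⟩

section Curve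

variable {E : Type*} [NormedAddCommGroup E] [NormedSpace ℝ E] [FiniteDimensional ℝ E]
  {ι : Type*} [Fintype ι] [DecidableEq ι]

/-- An integral curve `Y` of `∇f / |∇f|²`, starting where `f = f₀`, with Lie transported vector fields
`e i` along it, which stay orthogonal eigenvectors of `T`. The parameter `x` satisfies `dx/dt = f / |∇f|`; in terms of it,
`|e i| = 1 + a i * x` and `e i` has the eigenvalue `|∇f| * a i / (1 + a i * x)`. -/
structure FrameCurve (Ω : Set E) (G T : E → E →L[ℝ] E →L[ℝ] ℝ) (f : E → ℝ) (a : ι → ℝ)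
    (f₀ ε : ℝ) (Y : ℝ → E) (e : ι → ℝ → E) (x : ℝ → ℝ) : Prop where
  mem : ∀ t ∈ Set.Ioo (-ε) ε, Y t ∈ Ω
  hasDerivAt_Y : ∀ t ∈ Set.Ioo (-ε) ε, HasDerivAt Y (vel G f (Y t)) t
  hasDerivAt_e : ∀ t ∈ Set.Ioo (-ε) ε, ∀ i,
    HasDerivAt (e i) (fderiv ℝ (vel G f) (Y t) (e i t)) t
  df_e : ∀ t ∈ Set.Ioo (-ε) ε, ∀ i, fderiv ℝ f (Y t) (e i t) = 0
  f_Y : ∀ t ∈ Set.Ioo (-ε) ε, f (Y t) = f₀ + t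
  hasDerivAt_x : ∀ t ∈ Set.Ioo (-ε) ε, HasDerivAt x ((f₀ + t) / √(normSqGrad G f (Y t))) t
  pos : ∀ t ∈ Set.Ioo (-ε) ε, ∀ i, 0 < 1 + a i * x t
  G_e : ∀ t ∈ Set.Ioo (-ε) ε, ∀ i j,
    G (Y t) (e i t) (e j t) = if i = j then (1 + a i * x t) ^ 2 else 0
  T_e : ∀ t ∈ Set.Ioo (-ε) ε, ∀ i j, T (Y t) (e i t) (e j t) =
    if i = j then √(normSqGrad G f (Y t)) * (a i * (1 + a i * x t)) else 0

namespace StaticPatch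

variable {Ω : Set E} {G : E → E →L[ℝ] E →L[ℝ] ℝ} {Γ : E → E →L[ℝ] E →L[ℝ] E}
    {T : E → E →L[ℝ] E →L[ℝ] ℝ} {f s : E → ℝ} {y : E}

theorem hasDerivAt_sqrt_normSqGrad (h : StaticPatch Ω G Γ T f s) {Y : ℝ → E} {t : ℝ}
    (hy : Y t ∈ Ω) (hY : HasDerivAt Y (vel G f (Y t)) t) :
    HasDerivAt (fun r => √(normSqGrad G f (Y r)))
      (f (Y t) * (T (Y t) (gradG G f (Y t)) (gradG G f (Y t)) / normSqGrad G f (Y t))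
        / √(normSqGrad G f (Y t))) t := by
  have hq := h.normSqGrad_pos hy
  refine ((h.hasDerivAt_normSqGrad hy hY).sqrt hq.ne').congr_deriv ?_
  have := Real.sqrt_pos.2 hq
  field_simp

/-- Through each point there is a frame curve that starts with a given orthonormal family of
eigenvectors of `T` orthogonal to `∇f`. -/
theorem exists_frameCurve (h : StaticPatch Ω G Γ T f s) (hy : y ∈ Ω) (e₀ : ι → E) (μ : ι → ℝ)
    (horth : ∀ i j, G y (e₀ i) (e₀ j) = if i = j then 1 else 0)
    (hdf : ∀ i, fderiv ℝ f y (e₀ i) = 0)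
    (hT : ∀ i w, T y (e₀ i) w = μ i * G y (e₀ i) w) :
    ∃ ε > 0, ∃ Y e x, FrameCurve Ω G T f (fun i => μ i / √(normSqGrad G f y)) (f y) ε Y e x ∧
      Y 0 = y ∧ (∀ i, e i 0 = e₀ i) ∧ x 0 = 0 := by
  set a : ι → ℝ := fun i => μ i / √(normSqGrad G f y) with ha
  -- the vector field whose integral curves are the triples of the base curve, the frame and `x`
  let Φ : E × (ι → E) × ℝ → E × (ι → E) × ℝ := fun z =>
    (vel G f z.1, fun i => fderiv ℝ (vel G f) z.1 (z.2.1 i), f z.1 / √(normSqGrad G f z.1))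
  have hq0 := h.normSqGrad_pos hy
  have hF0 := Real.sqrt_pos.2 hq0
  have hΦ : ContDiffAt ℝ 1 Φ (y, e₀, 0) := by
    have hfst : ContDiffAt ℝ ∞ (fun z : E × (ι → E) × ℝ => z.1) (y, e₀, (0 : ℝ)) := contDiffAt_fst
    have h1 : ContDiffAt ℝ ∞ (fun z : E × (ι → E) × ℝ => vel G f z.1) (y, e₀, (0 : ℝ)) :=
      ContDiffAt.comp (y, e₀, (0 : ℝ)) (h.contDiffAt_vel hy) hfst
    have h2 : ContDiffAt ℝ ∞ (fun z : E × (ι → E) × ℝ => fun i => fderiv ℝ (vel G f) z.1 (z.2.1 i))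
        (y, e₀, (0 : ℝ)) := by
      rw [contDiffAt_pi]
      intro i
      have hi : ContDiffAt ℝ ∞ (fun z : E × (ι → E) × ℝ => z.2.1 i) (y, e₀, (0 : ℝ)) := by fun_prop
      have hd : ContDiffAt ℝ ∞ (fderiv ℝ (vel G f)) y := (h.contDiffAt_vel hy).fderiv_right (by simp)
      exact (ContDiffAt.comp (y, e₀, (0 : ℝ)) hd hfst).clm_apply hi
    have h3 : ContDiffAt ℝ ∞ (fun z : E × (ι → E) × ℝ => f z.1 / √(normSqGrad G f z.1))
        (y, e₀, (0 : ℝ)) :=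
      (ContDiffAt.comp (y, e₀, (0 : ℝ)) (h.smoothf y hy) hfst).div
        ((ContDiffAt.comp (y, e₀, (0 : ℝ)) (h.contDiffAt_normSqGrad hy) hfst).sqrt hq0.ne') hF0.ne'
    exact (h1.prodMk (h2.prodMk h3)).of_le (by exact_mod_cast le_top)
  obtain ⟨α, hα0, ε₀, hε₀, hα⟩ :=
    hΦ.exists_forall_mem_closedBall_exists_eq_forall_mem_Ioo_hasDerivAt₀ 0
  have hcont : ContinuousAt α 0 := (hα 0 ⟨by linarith, by linarith⟩).continuousAt
  have hev : ∀ᶠ t in 𝓝 (0 : ℝ), (α t).1 ∈ Ω ∧ ∀ i, 0 < 1 + a i * (α t).2.2 := by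
    refine Filter.Eventually.and ?_ (Filter.eventually_all.2 fun i => ?_)
    · have : ContinuousAt (fun t => (α t).1) 0 := hcont.fst
      exact this.eventually_mem (by rw [hα0]; exact h.isOpen.mem_nhds hy)
    · have : ContinuousAt (fun t => 1 + a i * (α t).2.2) 0 :=
        continuousAt_const.add (continuousAt_const.mul hcont.snd.snd)
      exact this.eventually (lt_mem_nhds (by beta_reduce; rw [hα0]; simp))
  obtain ⟨ε₁, hε₁, hball⟩ := Metric.eventually_nhds_iff.1 hev
  obtain ⟨ε, hε, hle₀, hle₁⟩ : ∃ ε > 0, ε ≤ ε₀ ∧ ε ≤ ε₁ :=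
    ⟨min ε₀ ε₁, lt_min hε₀ hε₁, min_le_left _ _, min_le_right _ _⟩
  set Y : ℝ → E := fun t => (α t).1 with hYdef
  set e : ι → ℝ → E := fun i t => (α t).2.1 i with hedef
  set x : ℝ → ℝ := fun t => (α t).2.2 with hxdef
  have hY0 : Y 0 = y := by simp [Y, hα0]
  have he0 : ∀ i, e i 0 = e₀ i := fun i => by simp [e, hα0]
  have hx0 : x 0 = 0 := by simp [x, hα0]
  have hd : ∀ t ∈ Set.Ioo (-ε) ε, HasDerivAt α (Φ (α t)) t := fun t ht =>
    hα t ⟨by linarith [ht.1], by linarith [ht.2]⟩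
  have hmp : ∀ t ∈ Set.Ioo (-ε) ε, Y t ∈ Ω ∧ ∀ i, 0 < 1 + a i * x t := fun t ht =>
    hball (by rw [Real.dist_eq, sub_zero, abs_lt]; exact ⟨by linarith [ht.1], by linarith [ht.2]⟩)
  have hmem := fun t ht => (hmp t ht).1
  have hYd : ∀ t ∈ Set.Ioo (-ε) ε, HasDerivAt Y (vel G f (Y t)) t := fun t ht => (hd t ht).fst
  have hed : ∀ t ∈ Set.Ioo (-ε) ε, ∀ i,
      HasDerivAt (e i) (fderiv ℝ (vel G f) (Y t) (e i t)) t := fun t ht i =>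
    (hasDerivAt_pi.1 (hd t ht).snd.fst) i
  have hfY : ∀ t ∈ Set.Ioo (-ε) ε, f (Y t) = f y + t := by
    intro t ht
    have := eq_at_zero_of_hasDerivAt_zero (u := fun r => f (Y r) - r) hε (fun r hr => by
      have h1 := (h.differentiableAt (hmem r hr)).2.2.2.1.hasFDerivAt.comp_hasDerivAt r (hYd r hr)
      refine (h1.sub (hasDerivAt_id r)).congr_deriv ?_
      rw [h.df_vel (hmem r hr), sub_self]) t ht
    simp only [hY0, sub_zero] at this
    linarith
  have hxd : ∀ t ∈ Set.Ioo (-ε) ε, HasDerivAt x ((f y + t) / √(normSqGrad G f (Y t))) t :=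
    fun t ht => by
      rw [← hfY t ht]; exact (hd t ht).snd.snd
  have hdfe : ∀ t ∈ Set.Ioo (-ε) ε, ∀ i, fderiv ℝ f (Y t) (e i t) = 0 := by
    intro t ht i
    have := eq_at_zero_of_hasDerivAt_zero hε (fun r hr =>
      h.hasDerivAt_df (hmem r hr) (hYd r hr) (hed r hr i)) t ht
    simpa [hY0, he0, hdf] using this
  have hI0 : (0 : ℝ) ∈ Set.Ioo (-ε) ε := ⟨by linarith, hε⟩
  have hFF : ∀ t ∈ Set.Ioo (-ε) ε, 0 < √(normSqGrad G f (Y t)) ∧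
      normSqGrad G f (Y t) = √(normSqGrad G f (Y t)) ^ 2 := fun t ht => by
    have := h.normSqGrad_pos (hmem t ht)
    exact ⟨Real.sqrt_pos.2 this, (Real.sq_sqrt this.le).symm⟩
  have hF00 := hFF 0 hI0
  rw [hY0] at hF00
  -- `T²(e i, e j) / |∇f|²`, then `T(e i, e j) / |∇f| - a i ^ 2 δ x`, then
  -- `G(e i, e j) - (1 + a i * x) ^ 2 δ` are constant along the curve
  have hC : ∀ t ∈ Set.Ioo (-ε) ε, ∀ i j, T (Y t) (e i t) (sharpT G T (Y t) (e j t)) =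
      if i = j then normSqGrad G f (Y t) * a i ^ 2 else 0 := by
    intro t ht i j
    have hq := h.normSqGrad_pos (hmem t ht)
    have := eq_at_zero_of_hasDerivAt_zero
      (u := fun r => T (Y r) (e i r) (sharpT G T (Y r) (e j r)) / normSqGrad G f (Y r)) hε
      (fun r hr => by
        have hq := h.normSqGrad_pos (hmem r hr)
        refine ((h.hasDerivAt_T_sharpT (hmem r hr) (hYd r hr) (hed r hr i) (hdfe r hr i)
          (hed r hr j) (hdfe r hr j)).div (h.hasDerivAt_normSqGrad (hmem r hr) (hYd r hr))
          hq.ne').congr_deriv ?_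
        field_simp
        ring) t ht
    simp only [hY0, he0] at this
    rw [hT, h.symm y hy, h.G_sharpT hy, hT, horth, div_eq_iff hq.ne'] at this
    rw [this]
    by_cases hij : i = j
    · subst hij
      simp only [if_true, ha]
      rw [hF00.2]
      field_simp
      rw [Real.sqrt_sq hF0.le]
    · simp [hij, Ne.symm hij]
  have hB : ∀ t ∈ Set.Ioo (-ε) ε, ∀ i j, T (Y t) (e i t) (e j t) =
      if i = j then √(normSqGrad G f (Y t)) * (a i * (1 + a i * x t)) else 0 := by
    intro t ht i j
    have hF := hFF t ht
    have := eq_at_zero_of_hasDerivAt_zero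
      (u := fun r => T (Y r) (e i r) (e j r) / √(normSqGrad G f (Y r))
        - (if i = j then a i ^ 2 else 0) * x r) hε
      (fun r hr => by
        have hF := hFF r hr
        refine (((h.hasDerivAt_T (hmem r hr) (hYd r hr) (hed r hr i) (hdfe r hr i)
          (hed r hr j) (hdfe r hr j)).div (h.hasDerivAt_sqrt_normSqGrad (hmem r hr) (hYd r hr))
          hF.1.ne').sub ((hxd r hr).const_mul _)).congr_deriv ?_
        rw [← h.T_sharpT_comm (hmem r hr), hC r hr, hfY r hr]
        generalize T (Y r) (gradG G f (Y r)) (gradG G f (Y r)) = m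
        generalize √(normSqGrad G f (Y r)) = F at hF
        rw [hF.2]
        have := hF.1
        split_ifs
        · field_simp
          ring
        · field_simp
          ring) t ht
    simp only [hY0, he0, hx0] at this
    rw [hT, horth, mul_zero, sub_zero, sub_eq_iff_eq_add, div_eq_iff hF.1.ne'] at this
    rw [this]
    by_cases hij : i = j
    · subst hij
      simp only [if_true, ha]
      field_simp
    · simp [hij]
  have hA : ∀ t ∈ Set.Ioo (-ε) ε, ∀ i j, G (Y t) (e i t) (e j t) =
      if i = j then (1 + a i * x t) ^ 2 else 0 := by
    intro t ht i j
    have := eq_at_zero_of_hasDerivAt_zero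
      (u := fun r => G (Y r) (e i r) (e j r) - if i = j then (1 + a i * x r) ^ 2 else 0) hε
      (fun r hr => by
        have hF := hFF r hr
        have h1 := h.hasDerivAt_G (hmem r hr) (hYd r hr) (hed r hr i) (hdfe r hr i)
          (hed r hr j) (hdfe r hr j)
        rw [hB r hr, hfY r hr] at h1
        by_cases hij : i = j
        · simp only [hij, if_true] at h1 ⊢
          refine (h1.sub ((((hxd r hr).const_mul (a j)).const_add 1).pow 2)).congr_deriv ?_
          generalize √(normSqGrad G f (Y r)) = F at hF
          rw [hF.2]
          have := hF.1
          field_simp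
          ring
        · simp only [hij, if_false, mul_zero] at h1 ⊢
          simpa using h1) t ht
    simp only [hY0, he0, hx0, horth] at this
    rw [sub_eq_iff_eq_add] at this
    rw [this]
    by_cases hij : i = j <;> simp [hij]
  exact ⟨ε, hε, Y, e, x, ⟨hmem, hYd, hed, hdfe, hfY, hxd, fun t ht => (hmp t ht).2, hA, hB⟩,
    hY0, he0, hx0⟩

/-- Along a frame curve the sectional curvatures of the planes spanned by the frame are explicit,
and the Ricci curvature is their sum: this gives one equation for each vector of the frame. -/
theorem frameCurve_equations (h : StaticPatch Ω G Γ T f s)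
    (hcard : Fintype.card ι + 1 = Module.finrank ℝ E) {a : ι → ℝ} {f₀ ε : ℝ} (hε : 0 < ε)
    {Y : ℝ → E} {e : ι → ℝ → E} {x : ℝ → ℝ} (hc : FrameCurve Ω G T f a f₀ ε Y e x)
    (hx0 : x 0 = 0) :
    ∃ k : ι → ι → ℝ, (∀ i j, k i j = k j i) ∧ ∀ t ∈ Set.Ioo (-ε) ε, ∀ i,
      2 * √(normSqGrad G f (Y t)) * a i + s (Y 0) * (1 + a i * x t)
        + (f₀ + t) ^ 2 * a i * ∑ j ∈ Finset.univ.erase i, a j / (1 + a j * x t)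
      = ∑ j ∈ Finset.univ.erase i, k i j / (1 + a j * x t) := by
  have hFF : ∀ t ∈ Set.Ioo (-ε) ε, 0 < √(normSqGrad G f (Y t)) ∧
      normSqGrad G f (Y t) = √(normSqGrad G f (Y t)) ^ 2 := fun t ht => by
    have := h.normSqGrad_pos (hc.mem t ht)
    exact ⟨Real.sqrt_pos.2 this, (Real.sq_sqrt this.le).symm⟩
  have hs : ∀ t ∈ Set.Ioo (-ε) ε, s (Y t) = s (Y 0) := by
    intro t ht
    refine eq_at_zero_of_hasDerivAt_zero (u := fun r => s (Y r)) hε (fun r hr => ?_) t ht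
    have h1 := (h.differentiableAt (hc.mem r hr)).2.2.2.2.1.hasFDerivAt.comp_hasDerivAt r
      (hc.hasDerivAt_Y r hr)
    refine h1.congr_deriv ?_
    rw [h.ds_eq_zero (hc.mem r hr)]; rfl
  -- the orthogonal basis formed by `∇f` and the `e i`
  let b : ℝ → Option ι → E := fun t o => o.elim (gradG G f (Y t)) (fun i => e i t)
  have hframe : ∀ t ∈ Set.Ioo (-ε) ε, _ := fun t ht =>
    h.orthogonal_frame (hc.mem t ht) (κ := Option ι) (by simpa using hcard) (b t)
      (by
        rintro (_ | i) (_ | j) hij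
        · exact absurd rfl hij
        · exact (h.G_gradG (hc.mem t ht) _).trans (hc.df_e t ht j)
        · exact (h.symm _ (hc.mem t ht) _ _).trans
            ((h.G_gradG (hc.mem t ht) _).trans (hc.df_e t ht i))
        · have hne : i ≠ j := fun h0 => hij (by rw [h0])
          exact (hc.G_e t ht i j).trans (by simp [hne]))
      (by
        rintro (_ | i)
        · exact h.gradG_ne (hc.mem t ht)
        · intro h0
          have h1 := hc.G_e t ht i i
          have h2 : e i t = 0 := h0
          have h3 := hc.pos t ht i
          rw [h2, if_pos rfl] at h1
          simp only [map_zero] at h1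
          exact (pow_pos h3 2).ne h1)
  have hsharp : ∀ t ∈ Set.Ioo (-ε) ε, ∀ i, sharpT G T (Y t) (e i t) =
      (√(normSqGrad G f (Y t)) * a i / (1 + a i * x t)) • e i t := by
    intro t ht i
    rw [← sub_eq_zero]
    refine (hframe t ht).1 _ ?_
    have hp := hc.pos t ht i
    rintro (_ | j)
    · change G (Y t) _ (gradG G f (Y t)) = 0
      rw [h.symm _ (hc.mem t ht), h.G_gradG (hc.mem t ht), map_sub,
        h.df_sharpT (hc.mem t ht) (hc.df_e t ht i), map_smul, hc.df_e t ht i]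
      simp
    · change G (Y t) _ (e j t) = 0
      rw [map_sub, sub_apply, h.G_sharpT (hc.mem t ht), hc.T_e t ht, map_smul, smul_apply,
        hc.G_e t ht]
      split_ifs
      · simp only [smul_eq_mul]
        field_simp
        ring
      · simp
  let D : ι → ι → ℝ → ℝ := fun i j t =>
    G (Y t) (curv Γ (Y t) (e i t) (e j t) (e j t)) (e i t)
  have hDsymm : ∀ t ∈ Set.Ioo (-ε) ε, ∀ i j, D i j t = D j i t := fun t ht i j => by
    simp only [D]
    rw [h.pair (hc.mem t ht)]
  -- the constants `k i j` of the statement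
  have hD : ∀ t ∈ Set.Ioo (-ε) ε, ∀ i j, i ≠ j →
      D i j t / ((1 + a i * x t) * (1 + a j * x t)) + (f₀ + t) ^ 2 * (a i * a j)
        = D i j 0 + f₀ ^ 2 * (a i * a j) := by
    intro t ht i j hij
    have := eq_at_zero_of_hasDerivAt_zero
      (u := fun r => D i j r / ((1 + a i * x r) * (1 + a j * x r)) + (f₀ + r) ^ 2 * (a i * a j)) hε
      (fun r hr => by
        have hF := hFF r hr
        have hpi := hc.pos r hr i
        have hpj := hc.pos r hr j
        have h1 := h.hasDerivAt_sect (hc.mem r hr) (hc.hasDerivAt_Y r hr) (hc.hasDerivAt_e r hr i)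
          (hc.df_e r hr i) (hc.hasDerivAt_e r hr j) (hc.df_e r hr j)
        rw [hc.T_e r hr, hc.T_e r hr, hc.T_e r hr, if_neg hij, if_pos rfl, if_pos rfl,
          hsharp r hr, hsharp r hr, hc.f_Y r hr] at h1
        have hl : ∀ i, HasDerivAt (fun r => 1 + a i * x r) _ r := fun i =>
          ((hc.hasDerivAt_x r hr).const_mul (a i)).const_add 1
        have h2 := ((((hasDerivAt_id r).const_add f₀).pow 2).mul_const (a i * a j))
        refine ((h1.div ((hl i).mul (hl j)) (mul_pos hpi hpj).ne').add h2).congr_deriv ?_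
        simp only [map_smul, smul_apply, smul_eq_mul, id, Pi.mul_apply]
        generalize G (Y r) (curv Γ (Y r) (e i r) (e j r) (e j r)) (e i r) = d
        generalize √(normSqGrad G f (Y r)) = F at hF
        generalize 1 + a i * x r = p at hpi ⊢
        generalize 1 + a j * x r = p' at hpj ⊢
        rw [hF.2]
        have := hF.1
        field_simp
        ring) t ht
    simpa [hx0] using this
  refine ⟨fun i j => D i j 0 + f₀ ^ 2 * (a i * a j), fun i j => ?_, fun t ht i => ?_⟩
  · simp only
    rw [hDsymm 0 ⟨by linarith, hε⟩, mul_comm (a i)]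
  · have hy := hc.mem t ht
    have hF := hFF t ht
    have hp := hc.pos t ht
    -- the Ricci curvature of `e i` as a trace over the basis `b`
    have hric := h.ric _ hy (e i t) (e i t)
    rw [(hframe t ht).2, Fintype.sum_option, hc.T_e t ht, hc.G_e t ht, if_pos rfl, if_pos rfl,
      hs t ht] at hric
    have hN : G (Y t) ((((curv Γ (Y t)).flip (e i t)).flip (e i t)) (b t none)) (b t none)
        / G (Y t) (b t none) (b t none) = - (√(normSqGrad G f (Y t)) * (a i * (1 + a i * x t))) := by
      change G (Y t) (curv Γ (Y t) (gradG G f (Y t)) (e i t) (e i t)) (gradG G f (Y t))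
        / G (Y t) (gradG G f (Y t)) (gradG G f (Y t)) = _
      have hpos := h.df_gradG_pos hy
      rw [h.G_gradG hy, div_eq_iff hpos.ne', h.pair hy, h.curv_gradG hy, hc.df_e t ht, hc.T_e t ht,
        if_pos rfl]
      ring
    have hsum : ∑ j, G (Y t) ((((curv Γ (Y t)).flip (e i t)).flip (e i t)) (b t (some j)))
          (b t (some j)) / G (Y t) (b t (some j)) (b t (some j))
        = ∑ j ∈ Finset.univ.erase i, (1 + a i * x t) *
          ((D i j 0 + f₀ ^ 2 * (a i * a j)) / (1 + a j * x t)
            - (f₀ + t) ^ 2 * a i * (a j / (1 + a j * x t))) := by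
      rw [← Finset.sum_erase_add _ _ (Finset.mem_univ i)]
      have h0 : G (Y t) ((((curv Γ (Y t)).flip (e i t)).flip (e i t)) (b t (some i)))
          (b t (some i)) = 0 := by
        change G (Y t) (curv Γ (Y t) (e i t) (e i t) (e i t)) (e i t) = 0
        have := h.skew hy (e i t) (e i t) (e i t) (e i t)
        linarith
      rw [h0, zero_div, add_zero]
      refine Finset.sum_congr rfl fun j hj => ?_
      have hij : i ≠ j := (Finset.ne_of_mem_erase hj).symm
      have hj := hD t ht i j hij
      have hG : G (Y t) (b t (some j)) (b t (some j)) = (1 + a j * x t) ^ 2 :=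
        (hc.G_e t ht j j).trans (if_pos rfl)
      have hDj : G (Y t) ((((curv Γ (Y t)).flip (e i t)).flip (e i t)) (b t (some j)))
          (b t (some j)) = D i j t := hDsymm t ht j i
      rw [hG, hDj, ← hj]
      have hpi := hp i
      have hpj := hp j
      generalize 1 + a i * x t = p at hpi ⊢
      generalize 1 + a j * x t = p' at hpj ⊢
      field_simp
      ring
    rw [hN, hsum, ← Finset.mul_sum, Finset.sum_sub_distrib, ← Finset.mul_sum] at hric
    have hpi := hp i
    refine mul_left_cancel₀ hpi.ne' ?_
    linear_combination hric

end StaticPatch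
end Curve

/-! ### Algebra of the eigenvalue equations -/

section Algebra

open Polynomial

/-- The polynomial `1 + v X`. -/
def lin (v : ℝ) : ℝ[X] := 1 + C v * X

theorem eval_lin (v x : ℝ) : (lin v).eval x = 1 + v * x := by simp [lin]

theorem eval_lin_root {v : ℝ} (hv : v ≠ 0) : (lin v).eval (-v⁻¹) = 0 := by
  rw [eval_lin]; field_simp; ring

theorem natDegree_lin_le (v : ℝ) : (lin v).natDegree ≤ 1 := by
  unfold lin; compute_degree

theorem natDegree_lin {v : ℝ} (hv : v ≠ 0) : (lin v).natDegree = 1 := by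
  unfold lin; compute_degree!

theorem lin_ne_zero (v : ℝ) : lin v ≠ 0 := fun h => by
  have := congrArg (eval 0) h
  simp [eval_lin] at this

theorem isCoprime_lin {u v : ℝ} (h : u ≠ v) : IsCoprime (lin u) (lin v) := by
  have h' : u - v ≠ 0 := sub_ne_zero.2 h
  refine ⟨C (-v / (u - v)), C (u / (u - v)), ?_⟩
  have e1 : C (-v / (u - v)) + C (u / (u - v)) = (1 : ℝ[X]) := by
    rw [← C_add, ← C_1]; congr 1; field_simp; ring
  have e2 : C (-v / (u - v)) * C u + C (u / (u - v)) * C v = (0 : ℝ[X]) := by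
    rw [← C_mul, ← C_mul, ← C_add, ← C_0]; congr 1; field_simp; ring
  unfold lin
  linear_combination e1 + X * e2

variable {ι : Type*} [Fintype ι]

/-- The nonzero values of `a`. -/
def nonzeroValues (a : ι → ℝ) : Finset ℝ := (Finset.univ.image a).erase 0

/-- The product of `1 + v X` over the nonzero values `v` of `a`. -/
def linProd (a : ι → ℝ) : ℝ[X] := ∏ v ∈ nonzeroValues a, lin v

/-- The product of `1 + w X` over the nonzero values `w ≠ v` of `a`. -/
def linProdErase (a : ι → ℝ) (v : ℝ) : ℝ[X] := ∏ w ∈ (nonzeroValues a).erase v, lin w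

theorem mem_nonzeroValues {a : ι → ℝ} {v : ℝ} :
    v ∈ nonzeroValues a ↔ v ≠ 0 ∧ ∃ i, a i = v := by
  simp [nonzeroValues]

theorem linProdErase_mul (a : ι → ℝ) (i : ι) :
    linProdErase a (a i) * lin (a i) = linProd a := by
  by_cases h : a i = 0
  · have : (nonzeroValues a).erase (0 : ℝ) = nonzeroValues a :=
      Finset.erase_eq_of_notMem (by simp [nonzeroValues])
    simp only [linProdErase, linProd, h, this]
    simp [lin]
  · exact Finset.prod_erase_mul _ _ (mem_nonzeroValues.2 ⟨h, i, rfl⟩)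

theorem linProd_ne_zero (a : ι → ℝ) : linProd a ≠ 0 :=
  Finset.prod_ne_zero_iff.2 fun v _ => lin_ne_zero v

theorem natDegree_linProd (a : ι → ℝ) : (linProd a).natDegree = (nonzeroValues a).card := by
  rw [linProd, natDegree_prod _ _ fun v _ => lin_ne_zero v,
    Finset.sum_congr rfl fun v hv => natDegree_lin (mem_nonzeroValues.1 hv).1]
  simp

theorem eval_linProd_root {a : ι → ℝ} {v : ℝ} (hv : v ∈ nonzeroValues a) :
    (linProd a).eval (-v⁻¹) = 0 := by
  rw [linProd, eval_prod]
  exact Finset.prod_eq_zero hv (eval_lin_root (mem_nonzeroValues.1 hv).1)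

theorem eval_linProdErase_root {a : ι → ℝ} {u v : ℝ} (hv : v ∈ nonzeroValues a) (huv : u ≠ v) :
    (linProdErase a u).eval (-v⁻¹) = 0 := by
  rw [linProdErase, eval_prod]
  exact Finset.prod_eq_zero (Finset.mem_erase.2 ⟨huv.symm, hv⟩)
    (eval_lin_root (mem_nonzeroValues.1 hv).1)

theorem eval_linProdErase_self {a : ι → ℝ} {v : ℝ} (hv : v ∈ nonzeroValues a) :
    (linProdErase a v).eval (-v⁻¹) ≠ 0 := by
  rw [linProdErase, eval_prod, Finset.prod_ne_zero_iff]
  intro w hw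
  have hv0 := (mem_nonzeroValues.1 hv).1
  rw [eval_lin]
  intro h
  apply Finset.ne_of_mem_erase hw
  field_simp at h
  linarith

theorem natDegree_linProdErase_le (a : ι → ℝ) (i : ι) :
    (linProdErase a (a i)).natDegree ≤ (linProd a).natDegree := by
  rw [← linProdErase_mul a i]
  exact natDegree_le_of_dvd (dvd_mul_right _ _)
    (by rw [linProdErase_mul]; exact linProd_ne_zero a)

variable [DecidableEq ι]

/-- A family of polynomial identities, with `p = f²` and `p' = 2 |∇f|` as functions of `x`, in which
the residues at `-1 / v` force `p` to be constant as soon as `a` takes two distinct nonzero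
values. -/
theorem derivative_eq_zero_of_identities (a : ι → ℝ) (k : ι → ι → ℝ) (hk : ∀ i j, k i j = k j i)
    (s : ℝ) (p : ℝ[X]) (hp : p.natDegree ≤ 2) (hV : 2 ≤ (nonzeroValues a).card)
    (hE : ∀ i, derivative p * C (a i) * linProd a + C s * lin (a i) * linProd a
      + p * C (a i) * ∑ j ∈ Finset.univ.erase i, C (a j) * linProdErase a (a j)
      = ∑ j ∈ Finset.univ.erase i, C (k i j) * linProdErase a (a j)) :
    derivative p = 0 := by
  -- only the summands with `a j = v` survive at `-1 / v`
  have hsum : ∀ v ∈ nonzeroValues a, ∀ i, ∀ c : ι → ℝ,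
      eval (-v⁻¹) (∑ j ∈ Finset.univ.erase i, C (c j) * linProdErase a (a j)) =
        (∑ j ∈ (Finset.univ.erase i).filter (fun j => a j = v), c j)
          * (linProdErase a v).eval (-v⁻¹) := by
    intro v hv i c
    rw [eval_finsetSum, Finset.sum_filter, Finset.sum_mul]
    refine Finset.sum_congr rfl fun j _ => ?_
    by_cases hj : a j = v
    · simp [hj]
    · simp [hj, eval_linProdErase_root hv hj]
  have hres : ∀ v ∈ nonzeroValues a, ∀ i,
      ∑ j ∈ (Finset.univ.erase i).filter (fun j => a j = v), (k i j - p.eval (-v⁻¹) * a i * a j)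
        = 0 := by
    intro v hv i
    have h1 := congrArg (eval (-v⁻¹)) (hE i)
    simp only [eval_add, eval_mul, eval_C] at h1
    rw [eval_linProd_root hv, hsum v hv, hsum v hv] at h1
    have h2 := eval_linProdErase_self hv
    rw [Finset.sum_sub_distrib, ← Finset.mul_sum]
    refine mul_right_cancel₀ h2 ?_
    linear_combination -h1
  let m : ℝ → Finset ι := fun v => Finset.univ.filter (fun j => a j = v)
  have hm : ∀ v ∈ nonzeroValues a, (0 : ℝ) < (m v).card := fun v hv => by
    obtain ⟨i, hi⟩ := (mem_nonzeroValues.1 hv).2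
    exact_mod_cast Finset.card_pos.2 ⟨i, by simp [m, hi]⟩
  have hres' : ∀ v ∈ nonzeroValues a, ∀ i, a i ≠ v →
      ∑ j ∈ m v, k i j = (m v).card * (p.eval (-v⁻¹) * a i * v) := by
    intro v hv i hi
    have h1 := hres v hv i
    have h2 : (Finset.univ.erase i).filter (fun j => a j = v) = m v := by
      ext j
      simp only [Finset.mem_filter, Finset.mem_erase, Finset.mem_univ, m, and_true, true_and]
      exact ⟨fun h => h.2, fun h => ⟨fun h0 => hi (h0 ▸ h), h⟩⟩
    rw [h2, Finset.sum_sub_distrib, sub_eq_zero] at h1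
    rw [h1, Finset.sum_congr rfl fun j hj => by rw [(Finset.mem_filter.1 hj).2]]
    simp
  -- `p` takes the same value at all the points `-1 / v`, by the symmetry of `k`
  have hval : ∀ u ∈ nonzeroValues a, ∀ v ∈ nonzeroValues a, p.eval (-u⁻¹) = p.eval (-v⁻¹) := by
    intro u hu v hv
    by_cases huv : u = v
    · rw [huv]
    have h1 : ∑ i ∈ m u, ∑ j ∈ m v, k i j
        = (m u).card * ((m v).card * (p.eval (-v⁻¹) * u * v)) := by
      rw [Finset.sum_congr rfl fun i hi => hres' v hv i
        (by rw [(Finset.mem_filter.1 hi).2]; exact huv)]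
      rw [Finset.sum_congr rfl fun i hi => by rw [(Finset.mem_filter.1 hi).2]]
      simp
    have h2 : ∑ j ∈ m v, ∑ i ∈ m u, k j i
        = (m v).card * ((m u).card * (p.eval (-u⁻¹) * v * u)) := by
      rw [Finset.sum_congr rfl fun i hi => hres' u hu i
        (by rw [(Finset.mem_filter.1 hi).2]; exact Ne.symm huv)]
      rw [Finset.sum_congr rfl fun i hi => by rw [(Finset.mem_filter.1 hi).2]]
      simp
    rw [Finset.sum_comm] at h2
    simp only [fun i j => hk j i] at h2
    have h3 : ((m v).card * (m u).card * v * u : ℝ) ≠ 0 :=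
      mul_ne_zero (mul_ne_zero (mul_pos (hm v hv) (hm u hu)).ne' (mem_nonzeroValues.1 hv).1)
        (mem_nonzeroValues.1 hu).1
    refine mul_left_cancel₀ h3 ?_
    have h4 : ∑ i ∈ m u, ∑ j ∈ m v, k i j = ∑ i ∈ m u, ∑ j ∈ m v, k j i := by
      simp only [fun i j => hk i j]
    linear_combination h1 - h2
  obtain ⟨u, hu⟩ : (nonzeroValues a).Nonempty := Finset.card_pos.1 (by omega)
  have hu0 := (mem_nonzeroValues.1 hu).1
  set p₀ := p.eval (-u⁻¹) with hp₀
  have hdvd : linProd a ∣ p - C p₀ := by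
    refine Finset.prod_dvd_of_coprime (fun v _ w _ hvw => isCoprime_lin hvw) fun v hv => ?_
    have hv0 := (mem_nonzeroValues.1 hv).1
    have hroot : IsRoot (p - C p₀) (-v⁻¹) := by
      simp [IsRoot, hval u hu v hv, hp₀]
    have h1 := dvd_iff_isRoot.2 hroot
    refine (dvd_of_eq ?_).trans ((C_mul_dvd hv0).2 h1)
    unfold lin
    rw [C_neg, sub_neg_eq_add, mul_add, ← C_mul, mul_inv_cancel₀ hv0, C_1]
    ring
  obtain ⟨r, hr⟩ := hdvd
  have hr0 : r.natDegree = 0 := by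
    by_cases h0 : r = 0
    · simp [h0]
    have h1 : (p - C p₀).natDegree ≤ 2 := by rw [natDegree_sub_C]; exact hp
    rw [hr, natDegree_mul (linProd_ne_zero a) h0, natDegree_linProd] at h1
    omega
  obtain ⟨β, hβ⟩ := natDegree_eq_zero.1 hr0
  have hpe : p = C p₀ + C β * linProd a := by
    rw [hβ]; linear_combination hr
  suffices hβ0 : β = 0 by
    rw [hpe, hβ0]; simp
  -- the remaining identity, after division by the common factor
  have hE' : ∀ i, C β * derivative (linProd a) * C (a i) + C s * lin (a i)
      + C β * C (a i) * ∑ j ∈ Finset.univ.erase i, C (a j) * linProdErase a (a j)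
      = C (∑ j ∈ (Finset.univ.erase i).filter (fun j => a j = 0), k i j) := by
    intro i
    refine mul_right_cancel₀ (linProd_ne_zero a) ?_
    have hrest : ∑ j ∈ Finset.univ.erase i, C (k i j - p₀ * a i * a j) * linProdErase a (a j)
        = C (∑ j ∈ (Finset.univ.erase i).filter (fun j => a j = 0), k i j) * linProd a := by
      have hmaps : ∀ j ∈ Finset.univ.erase i, a j ∈ insert 0 (nonzeroValues a) := by
        intro j _
        by_cases hj : a j = 0
        · simp [hj]
        · exact Finset.mem_insert_of_mem (mem_nonzeroValues.2 ⟨hj, j, rfl⟩)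
      rw [← Finset.sum_fiberwise_of_maps_to hmaps,
        Finset.sum_insert (by simp [nonzeroValues]), Finset.sum_eq_zero (s := nonzeroValues a)]
      · rw [add_zero, map_sum, Finset.sum_mul]
        refine Finset.sum_congr rfl fun j hj => ?_
        have hj0 := (Finset.mem_filter.1 hj).2
        have := linProdErase_mul a j
        rw [hj0] at this ⊢
        rw [← this]
        simp [lin]
      · intro v hv
        have h1 := hres v hv i
        rw [← hval u hu v hv] at h1
        rw [Finset.sum_congr rfl fun j hj => by rw [(Finset.mem_filter.1 hj).2], ← Finset.sum_mul,
          ← map_sum]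
        rw [Finset.sum_congr rfl fun j hj => by rw [(Finset.mem_filter.1 hj).2]] at h1
        rw [h1]
        simp
    rw [← hrest]
    have h2 := hE i
    rw [hpe] at h2
    simp only [derivative_add, derivative_C, derivative_mul, zero_mul, zero_add] at h2
    simp only [C_sub, sub_mul, Finset.sum_sub_distrib, C_mul, mul_assoc]
    rw [← h2, ← Finset.mul_sum, ← Finset.mul_sum]
    ring
  -- the right-hand side of `hE'`, summed over the indices `i` with `a i = u`
  have hκ : ∑ i ∈ m u, ∑ j ∈ (Finset.univ.erase i).filter (fun j => a j = 0), k i j = 0 := by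
    have h1 : ∀ i ∈ m u, (Finset.univ.erase i).filter (fun j => a j = 0) = m 0 := by
      intro i hi
      have hi' := (Finset.mem_filter.1 hi).2
      ext j
      simp only [Finset.mem_filter, Finset.mem_erase, Finset.mem_univ, m, and_true, true_and]
      refine ⟨fun h => h.2, fun h => ⟨fun h0 => hu0 ?_, h⟩⟩
      rw [← hi', ← h0, h]
    rw [Finset.sum_congr rfl fun i hi => by rw [h1 i hi], Finset.sum_comm]
    refine Finset.sum_eq_zero fun j hj => ?_
    have hj0 := (Finset.mem_filter.1 hj).2
    rw [Finset.sum_congr rfl fun i _ => hk i j, hres' u hu j (by rw [hj0]; exact hu0.symm), hj0]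
    simp
  set δ := (linProdErase a u).eval (-u⁻¹) with hδ
  have hδ0 : δ ≠ 0 := eval_linProdErase_self hu
  obtain ⟨i₀, hi₀⟩ := (mem_nonzeroValues.1 hu).2
  have hder : (derivative (linProd a)).eval (-u⁻¹) = u * δ := by
    have h1 := linProdErase_mul a i₀
    rw [hi₀] at h1
    rw [← h1, derivative_mul, eval_add, eval_mul, eval_mul, eval_lin_root hu0]
    simp [lin, hδ]; ring
  have hEi : ∀ i ∈ m u, β * u * ((m u).card * (u * δ))
      = ∑ j ∈ (Finset.univ.erase i).filter (fun j => a j = 0), k i j := by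
    intro i hi
    have hi' := (Finset.mem_filter.1 hi).2
    have h1 := congrArg (eval (-u⁻¹)) (hE' i)
    simp only [eval_add, eval_mul, eval_C] at h1
    rw [hsum u hu, hi', hder, eval_lin_root hu0, ← hδ] at h1
    have hcard : ∑ j ∈ (Finset.univ.erase i).filter (fun j => a j = u), a j
        = ((m u).card - 1) * u := by
      rw [Finset.sum_congr rfl fun j hj => (Finset.mem_filter.1 hj).2]
      have : (Finset.univ.erase i).filter (fun j => a j = u) = (m u).erase i := by
        ext j; simp [m, and_comm]
      rw [this, Finset.sum_const, nsmul_eq_mul, Finset.card_erase_of_mem hi,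
        Nat.cast_pred (Finset.card_pos.2 ⟨i, hi⟩)]
    rw [hcard] at h1
    linear_combination h1
  rw [← Finset.sum_congr rfl hEi, Finset.sum_const, nsmul_eq_mul] at hκ
  have hmu := (hm u hu).ne'
  simpa [hmu, hu0, hδ0] using hκ

/-- The equations along a frame curve determine `f²` as a polynomial in `x` of degree at most two:
eliminating `|∇f|` between the equations of `i` and `m` clears the poles of `f²` at `-1 / a i` and
`-1 / a m`. -/
theorem exists_polynomial (a : ι → ℝ) (k : ι → ι → ℝ) (s : ℝ) (hV : 2 ≤ (nonzeroValues a).card)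
    {J : Set ℝ} {F P x : ℝ → ℝ} (hJ : (x '' J).Infinite) (hpos : ∀ t ∈ J, ∀ i, 0 < 1 + a i * x t)
    (hE : ∀ t ∈ J, ∀ i, 2 * F t * a i + s * (1 + a i * x t)
        + P t * a i * ∑ j ∈ Finset.univ.erase i, a j / (1 + a j * x t)
      = ∑ j ∈ Finset.univ.erase i, k i j / (1 + a j * x t)) :
    ∃ p : ℝ[X], p.natDegree ≤ 2 ∧ ∀ t ∈ J, P t = p.eval (x t) := by
  have hDpos : ∀ t ∈ J, 0 < (linProd a).eval (x t) := by
    intro t ht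
    rw [linProd, eval_prod]
    refine Finset.prod_pos fun v hv => ?_
    obtain ⟨i, hi⟩ := (mem_nonzeroValues.1 hv).2
    rw [eval_lin, ← hi]
    exact hpos t ht i
  have hext : ∀ A B : ℝ[X], (∀ t ∈ J, A.eval (x t) = B.eval (x t)) → A = B := fun A B h =>
    eq_of_infinite_eval_eq A B (hJ.mono (by rintro _ ⟨t, ht, rfl⟩; exact h t ht))
  have hDe : ∀ t ∈ J, ∀ i, (linProdErase a (a i)).eval (x t)
      = (linProd a).eval (x t) / (1 + a i * x t) := by
    intro t ht i
    rw [eq_div_iff (hpos t ht i).ne', ← linProdErase_mul a i, eval_mul, eval_lin]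
  let H : ι → ℝ[X] := fun i => ∑ j ∈ Finset.univ.erase i, C (k i j) * linProdErase a (a j)
  -- the product of `P` with `linProd a`, as it results from the equations of `i` and `m`
  let Q : ι → ι → ℝ[X] := fun i m => C (a i * a m * (a m - a i))⁻¹ * (lin (a i) * lin (a m)) *
    (C (a m) * H i - C (a i) * H m - C (s * (a m - a i)) * linProd a)
  have hQ : ∀ i m, a i ≠ 0 → a m ≠ 0 → a i ≠ a m → ∀ t ∈ J,
      P t * (linProd a).eval (x t) = (Q i m).eval (x t) := by
    intro i m hi hm him t ht
    have hne : a m - a i ≠ 0 := sub_ne_zero.2 (Ne.symm him)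
    have hH : ∀ i, (H i).eval (x t) = (linProd a).eval (x t) * ∑ j ∈ Finset.univ.erase i,
        k i j / (1 + a j * x t) := by
      intro i
      simp only [H, eval_finsetSum, eval_mul, eval_C, Finset.mul_sum, hDe t ht]
      exact Finset.sum_congr rfl fun j _ => by ring
    have hsum : ∀ i, ∑ j ∈ Finset.univ.erase i, a j / (1 + a j * x t)
        = ∑ j, a j / (1 + a j * x t) - a i / (1 + a i * x t) := fun i => by
      rw [← Finset.sum_erase_add _ _ (Finset.mem_univ i), add_sub_cancel_right]
    simp only [Q, eval_mul, eval_sub, eval_C, hH, eval_lin]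
    rw [← hE t ht i, ← hE t ht m, hsum i, hsum m]
    have h1 := hpos t ht i
    have h2 := hpos t ht m
    generalize ∑ j, a j / (1 + a j * x t) = Z
    generalize (linProd a).eval (x t) = D
    rw [inv_mul_eq_div, div_mul_eq_mul_div, eq_div_iff (mul_ne_zero (mul_ne_zero hi hm) hne)]
    have e1 : (1 + a i * x t) * (a i / (1 + a i * x t)) = a i := mul_div_cancel₀ _ h1.ne'
    have e2 : (1 + a m * x t) * (a m / (1 + a m * x t)) = a m := mul_div_cancel₀ _ h2.ne'
    generalize a i / (1 + a i * x t) = w at e1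
    generalize a m / (1 + a m * x t) = w' at e2
    linear_combination (P t * D * a i * a m) * ((1 + a m * x t) * e1 - (1 + a i * x t) * e2)
  obtain ⟨u, hu, v, hv, huv⟩ := Finset.one_lt_card.1 hV
  obtain ⟨hu0, i, hi⟩ := mem_nonzeroValues.1 hu
  obtain ⟨hv0, m, hm⟩ := mem_nonzeroValues.1 hv
  have hQim := hQ i m (hi ▸ hu0) (hm ▸ hv0) (by rw [hi, hm]; exact huv)
  -- `Q i m` does not depend on `i` and `m`, and has the factors `lin (a i)` and `lin (a m)`
  have hdvd : linProd a ∣ Q i m := by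
    refine Finset.prod_dvd_of_coprime (fun v _ w _ hvw => isCoprime_lin hvw) fun w hw => ?_
    obtain ⟨hw0, l, hl⟩ := mem_nonzeroValues.1 hw
    obtain ⟨l', hl'0, hll'⟩ : ∃ l', a l' ≠ 0 ∧ a l ≠ a l' := by
      by_cases h : w = u
      · exact ⟨m, hm ▸ hv0, by rw [hl, hm, h]; exact huv⟩
      · exact ⟨i, hi ▸ hu0, by rw [hl, hi]; exact h⟩
    have heq : Q i m = Q l l' := hext _ _ fun t ht => by
      rw [← hQim t ht, ← hQ l l' (hl ▸ hw0) hl'0 hll' t ht]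
    rw [heq, ← hl]
    exact Dvd.dvd.mul_right ((dvd_mul_right _ _).mul_left _) _
  obtain ⟨p, hp⟩ := hdvd
  refine ⟨p, ?_, fun t ht => ?_⟩
  · by_cases h0 : p = 0
    · simp [h0]
    have hH : ∀ i, (H i).natDegree ≤ (linProd a).natDegree := fun i =>
      natDegree_sum_le_of_forall_le _ _ fun j _ =>
        (natDegree_C_mul_le _ _).trans (natDegree_linProdErase_le a j)
    have h1 : (Q i m).natDegree ≤ (0 + (1 + 1)) + (linProd a).natDegree := by
      refine natDegree_mul_le_of_le (natDegree_mul_le_of_le (natDegree_C (R := ℝ) _).le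
        (natDegree_mul_le_of_le (natDegree_lin_le _) (natDegree_lin_le _))) ?_
      refine (natDegree_sub_le _ _).trans (max_le ((natDegree_sub_le _ _).trans (max_le ?_ ?_))
        (natDegree_C_mul_le _ _))
      · exact (natDegree_C_mul_le _ _).trans (hH i)
      · exact (natDegree_C_mul_le _ _).trans (hH m)
    rw [hp, natDegree_mul (linProd_ne_zero a) h0] at h1
    omega
  · have h1 := hQim t ht
    rw [hp, eval_mul, mul_comm] at h1
    exact mul_left_cancel₀ (hDpos t ht).ne' h1

/-- The equations along a frame curve leave room for at most one nonzero value of `a`. -/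
theorem card_nonzeroValues_le_one (a : ι → ℝ) (k : ι → ι → ℝ) (hk : ∀ i j, k i j = k j i)
    (s f₀ : ℝ) {ε : ℝ} (hε : 0 < ε) {F x : ℝ → ℝ} (hF : ∀ t ∈ Set.Ioo (-ε) ε, 0 < F t)
    (hx : ∀ t ∈ Set.Ioo (-ε) ε, HasDerivAt x ((f₀ + t) / F t) t)
    (hpos : ∀ t ∈ Set.Ioo (-ε) ε, ∀ i, 0 < 1 + a i * x t)
    (hE : ∀ t ∈ Set.Ioo (-ε) ε, ∀ i, 2 * F t * a i + s * (1 + a i * x t)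
        + (f₀ + t) ^ 2 * a i * ∑ j ∈ Finset.univ.erase i, a j / (1 + a j * x t)
      = ∑ j ∈ Finset.univ.erase i, k i j / (1 + a j * x t)) :
    (nonzeroValues a).card ≤ 1 := by
  by_contra hV
  replace hV : 2 ≤ (nonzeroValues a).card := by omega
  -- a subinterval without zeros of `f`, on which `x` is a coordinate
  obtain ⟨b, c, hbc, hJI, hne⟩ : ∃ b c, b < c ∧ Set.Ioo b c ⊆ Set.Ioo (-ε) ε ∧
      ∀ t ∈ Set.Ioo b c, f₀ + t ≠ 0 := by
    by_cases h : 0 ≤ f₀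
    · exact ⟨0, ε, hε, Set.Ioo_subset_Ioo_left (by linarith),
        fun t ht => by have := ht.1; linarith⟩
    · exact ⟨-ε, 0, by linarith, Set.Ioo_subset_Ioo_right hε.le,
        fun t ht => by have := ht.2; linarith⟩
  have hinj : Set.InjOn x (Set.Ioo b c) := by
    have key : ∀ r ∈ Set.Ioo b c, ∀ t ∈ Set.Ioo b c, r < t → x r ≠ x t := by
      intro r hr t ht hrt h
      have hsub : Set.Icc r t ⊆ Set.Ioo b c := fun z hz =>
        ⟨hr.1.trans_le hz.1, hz.2.trans_lt ht.2⟩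
      obtain ⟨z, hz, hz0⟩ := exists_hasDerivAt_eq_zero hrt
        (fun z hz => (hx z (hJI (hsub hz))).continuousAt.continuousWithinAt) h
        (fun z hz => hx z (hJI (hsub (Set.Ioo_subset_Icc_self hz))))
      have hzJ := hsub (Set.Ioo_subset_Icc_self hz)
      exact div_ne_zero (hne z hzJ) (hF z (hJI hzJ)).ne' hz0
    intro r hr t ht h
    rcases lt_trichotomy r t with h1 | h1 | h1
    · exact absurd h (key r hr t ht h1)
    · exact h1
    · exact absurd h.symm (key t ht r hr h1)
  have hinf : (x '' Set.Ioo b c).Infinite := (Set.Ioo_infinite hbc).image hinj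
  obtain ⟨p, hp, hpP⟩ := exists_polynomial a k s hV (P := fun t => (f₀ + t) ^ 2) hinf
    (fun t ht => hpos t (hJI ht)) (fun t ht => hE t (hJI ht))
  -- differentiate `(f₀ + t) ^ 2 = p (x t)` and cancel `f₀ + t`
  have hp' : ∀ t ∈ Set.Ioo b c, 2 * F t = (derivative p).eval (x t) := by
    intro t ht
    have h1 := (p.hasDerivAt (x t)).comp t (hx t (hJI ht))
    have h2 := h1.congr_of_eventuallyEq (f₁ := fun t => (f₀ + t) ^ 2)
      (Filter.eventually_of_mem (isOpen_Ioo.mem_nhds ht) fun z hz => hpP z hz)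
    have h3 := (((hasDerivAt_id t).const_add f₀).pow 2).unique h2
    have h4 := hF t (hJI ht)
    have h5 := hne t ht
    simp at h3
    field_simp at h3
    linarith
  have hzero : derivative p = 0 := by
    refine derivative_eq_zero_of_identities a k hk s p hp hV fun i => ?_
    refine eq_of_infinite_eval_eq _ _ (hinf.mono ?_)
    rintro _ ⟨t, ht, rfl⟩
    have hDe : ∀ i, (linProdErase a (a i)).eval (x t)
        = (linProd a).eval (x t) / (1 + a i * x t) := by
      intro i
      rw [eq_div_iff (hpos t (hJI ht) i).ne', ← linProdErase_mul a i, eval_mul, eval_lin]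
    have hS : ∀ c : ι → ℝ, ∑ j ∈ Finset.univ.erase i,
        c j * ((linProd a).eval (x t) / (1 + a j * x t))
        = (linProd a).eval (x t) * ∑ j ∈ Finset.univ.erase i, c j / (1 + a j * x t) := fun c => by
      rw [Finset.mul_sum]
      exact Finset.sum_congr rfl fun j _ => by ring
    have h1 := hE t (hJI ht) i
    simp only [Set.mem_ofPred_eq, eval_add, eval_mul, eval_C, eval_lin, eval_finsetSum, hDe, hS,
      ← hp' t ht, ← hpP t ht]
    linear_combination (linProd a).eval (x t) * h1
  obtain ⟨t, ht⟩ := Set.nonempty_Ioo.2 hbc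
  have := hp' t ht
  rw [hzero, eval_zero] at this
  linarith [hF t (hJI ht)]

end Algebra

/-! ### Eigenvalues in a static patch -/

section Conclusion

variable {E : Type*} [NormedAddCommGroup E] [NormedSpace ℝ E] [FiniteDimensional ℝ E]
  {ι : Type*} [Fintype ι] [DecidableEq ι]

/-- At each point, `T` has at most one nonzero eigenvalue on the orthogonal complement of `∇f`. -/
theorem StaticPatch.eigenvalue_eq {Ω : Set E} {G : E → E →L[ℝ] E →L[ℝ] ℝ}
    {Γ : E → E →L[ℝ] E →L[ℝ] E} {T : E → E →L[ℝ] E →L[ℝ] ℝ} {f s : E → ℝ} {y : E}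
    (h : StaticPatch Ω G Γ T f s) (hy : y ∈ Ω)
    (hcard : Fintype.card ι + 1 = Module.finrank ℝ E) (e₀ : ι → E) (μ : ι → ℝ)
    (horth : ∀ i j, G y (e₀ i) (e₀ j) = if i = j then 1 else 0)
    (hdf : ∀ i, fderiv ℝ f y (e₀ i) = 0)
    (hT : ∀ i w, T y (e₀ i) w = μ i * G y (e₀ i) w) {i j : ι} (hi : μ i ≠ 0) (hj : μ j ≠ 0) :
    μ i = μ j := by
  obtain ⟨ε, hε, Y, e, x, hc, hY0, -, hx0⟩ := h.exists_frameCurve hy e₀ μ horth hdf hT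
  obtain ⟨k, hk, hE⟩ := h.frameCurve_equations hcard hε hc hx0
  have hF0 := Real.sqrt_pos.2 (h.normSqGrad_pos hy)
  have hcard1 := card_nonzeroValues_le_one _ k hk (s (Y 0)) (f y) hε
    (fun t ht => Real.sqrt_pos.2 (h.normSqGrad_pos (hc.mem t ht))) hc.hasDerivAt_x hc.pos hE
  have h1 := Finset.card_le_one.1 hcard1 _ (mem_nonzeroValues.2 ⟨div_ne_zero hi hF0.ne', i, rfl⟩) _
    (mem_nonzeroValues.2 ⟨div_ne_zero hj hF0.ne', j, rfl⟩)
  exact (div_left_inj' hF0.ne').1 h1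

end Conclusion

/-! ### Tensors in coordinates -/

section Coordinates

variable {n : ℕ}

/-- The `i`-th standard basis vector. -/
abbrev stdVec (i : Fin n) : EuclideanSpace ℝ (Fin n) := EuclideanSpace.single i 1

theorem sum_smul_stdVec (u : EuclideanSpace ℝ (Fin n)) : ∑ i, u i • stdVec i = u := by
  ext k
  simp [Finset.sum_apply, Pi.single_apply]

theorem eq_of_stdVec {F : Type*} [AddCommGroup F] [Module ℝ F] {A B : EuclideanSpace ℝ (Fin n) → F}
    (hA : IsLinearMap ℝ A) (hB : IsLinearMap ℝ B) (h : ∀ i, A (stdVec i) = B (stdVec i))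
    (u : EuclideanSpace ℝ (Fin n)) : A u = B u := by
  have : hA.mk' A = hB.mk' B := by
    apply (EuclideanSpace.basisFun (Fin n) ℝ).toBasis.ext
    intro i
    simpa using h i
  exact congrArg (fun L => L u) this

theorem traceL_eq_sum (L : EuclideanSpace ℝ (Fin n) →L[ℝ] EuclideanSpace ℝ (Fin n)) :
    traceL L = ∑ i, L (stdVec i) i := by
  rw [traceL_apply, LinearMap.trace_eq_matrix_trace ℝ (EuclideanSpace.basisFun (Fin n) ℝ).toBasis,
    Matrix.trace]
  refine Finset.sum_congr rfl fun i _ => ?_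
  simp [LinearMap.toMatrix_apply]

/-- The bilinear form with the matrix `m`. -/
def formOf (m : Matrix (Fin n) (Fin n) ℝ) :
    EuclideanSpace ℝ (Fin n) →L[ℝ] EuclideanSpace ℝ (Fin n) →L[ℝ] ℝ :=
  ∑ i, ∑ j, m i j • (EuclideanSpace.proj i : EuclideanSpace ℝ (Fin n) →L[ℝ] ℝ).smulRight
    (EuclideanSpace.proj j : EuclideanSpace ℝ (Fin n) →L[ℝ] ℝ)

theorem formOf_apply (m : Matrix (Fin n) (Fin n) ℝ) (u v : EuclideanSpace ℝ (Fin n)) :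
    formOf m u v = ∑ i, ∑ j, m i j * u i * v j := by
  simp [formOf, sum_apply, mul_assoc]

theorem formOf_stdVec (m : Matrix (Fin n) (Fin n) ℝ) (i j : Fin n) :
    formOf m (stdVec i) (stdVec j) = m i j := by
  simp [formOf_apply]

/-- The Levi-Civita connection of the metric with the matrix field `gm`. -/
def connOf (gm : EuclideanSpace ℝ (Fin n) → Matrix (Fin n) (Fin n) ℝ)
    (y : EuclideanSpace ℝ (Fin n)) :
    EuclideanSpace ℝ (Fin n) →L[ℝ] EuclideanSpace ℝ (Fin n) →L[ℝ] EuclideanSpace ℝ (Fin n) :=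
  ∑ i, ∑ j, ∑ k, christoffel gm k i j y •
    (EuclideanSpace.proj i : EuclideanSpace ℝ (Fin n) →L[ℝ] ℝ).smulRight
      ((EuclideanSpace.proj j : EuclideanSpace ℝ (Fin n) →L[ℝ] ℝ).smulRight (stdVec k))

variable {gm : EuclideanSpace ℝ (Fin n) → Matrix (Fin n) (Fin n) ℝ} {y : EuclideanSpace ℝ (Fin n)}

theorem connOf_stdVec (i j : Fin n) :
    connOf gm y (stdVec i) (stdVec j) = ∑ k, christoffel gm k i j y • stdVec k := by
  simp [connOf, sum_apply, ite_smul]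

theorem connOf_stdVec_apply (i j k : Fin n) :
    connOf gm y (stdVec i) (stdVec j) k = christoffel gm k i j y := by
  simp [connOf_stdVec, Pi.single_apply]

theorem contDiffAt_formOf {m : EuclideanSpace ℝ (Fin n) → Matrix (Fin n) (Fin n) ℝ}
    (h : ∀ i j, ContDiffAt ℝ ∞ (fun z => m z i j) y) : ContDiffAt ℝ ∞ (fun z => formOf (m z)) y :=
  ContDiffAt.sum fun i _ => ContDiffAt.sum fun j _ => (h i j).smul contDiffAt_const

theorem contDiffAt_partialDeriv {F : EuclideanSpace ℝ (Fin n) → ℝ} (h : ContDiffAt ℝ ∞ F y)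
    (i : Fin n) : ContDiffAt ℝ ∞ (partialDeriv i F) y :=
  (h.fderiv_right (by simp)).clm_apply contDiffAt_const

theorem contDiffAt_det {m : EuclideanSpace ℝ (Fin n) → Matrix (Fin n) (Fin n) ℝ}
    (h : ∀ i j, ContDiffAt ℝ ∞ (fun z => m z i j) y) : ContDiffAt ℝ ∞ (fun z => (m z).det) y := by
  simp only [Matrix.det_apply]
  refine ContDiffAt.sum fun σ _ => ContDiffAt.const_smul _ ?_
  exact contDiffAt_prod fun i _ => h _ _

theorem contDiffAt_inv {m : EuclideanSpace ℝ (Fin n) → Matrix (Fin n) (Fin n) ℝ}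
    (h : ∀ i j, ContDiffAt ℝ ∞ (fun z => m z i j) y) (hdet : (m y).det ≠ 0) (i j : Fin n) :
    ContDiffAt ℝ ∞ (fun z => (m z)⁻¹ i j) y := by
  simp only [Matrix.inv_def, Ring.inverse_eq_inv', Matrix.smul_apply, smul_eq_mul,
    Matrix.adjugate_apply]
  refine ((contDiffAt_det h).inv hdet).mul (contDiffAt_det fun k l => ?_)
  by_cases hk : k = j
  · subst hk; simp only [Matrix.updateRow_self]; exact contDiffAt_const
  · simp only [Matrix.updateRow_ne hk]; exact h k l

theorem contDiffAt_christoffel (h : ∀ i j, ContDiffAt ℝ ∞ (fun z => gm z i j) y)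
    (hdet : (gm y).det ≠ 0) (k i j : Fin n) : ContDiffAt ℝ ∞ (christoffel gm k i j) y := by
  refine contDiffAt_const.mul (ContDiffAt.sum fun l _ => (contDiffAt_inv h hdet k l).mul ?_)
  exact ((contDiffAt_partialDeriv (h j l) i).add (contDiffAt_partialDeriv (h i l) j)).sub
    (contDiffAt_partialDeriv (h i j) l)

theorem contDiffAt_connOf (h : ∀ i j, ContDiffAt ℝ ∞ (fun z => gm z i j) y)
    (hdet : (gm y).det ≠ 0) : ContDiffAt ℝ ∞ (connOf gm) y :=
  ContDiffAt.sum fun i _ => ContDiffAt.sum fun j _ => ContDiffAt.sum fun k _ =>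
    (contDiffAt_christoffel h hdet k i j).smul contDiffAt_const

theorem partialDeriv_coord {F : EuclideanSpace ℝ (Fin n) → EuclideanSpace ℝ (Fin n)}
    {L : EuclideanSpace ℝ (Fin n) →L[ℝ] EuclideanSpace ℝ (Fin n)} (h : HasFDerivAt F L y)
    (l i : Fin n) : partialDeriv i (fun z => F z l) y = L (stdVec i) l := by
  have h1 : HasFDerivAt (fun z => F z l)
      ((EuclideanSpace.proj l : EuclideanSpace ℝ (Fin n) →L[ℝ] ℝ).comp L) y :=
    (EuclideanSpace.proj l : EuclideanSpace ℝ (Fin n) →L[ℝ] ℝ).hasFDerivAt.comp y h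
  rw [partialDeriv, h1.fderiv]
  rfl

theorem riemann_eq (h : ContDiffAt ℝ ∞ (connOf gm) y) (l i j k : Fin n) :
    riemann gm l i j k y = curv (connOf gm) y (stdVec j) (stdVec k) (stdVec i) l := by
  have hd : DifferentiableAt ℝ (connOf gm) y := h.differentiableAt (by simp)
  have h1 : ∀ j k, partialDeriv j (christoffel gm l k i) y
      = fderiv ℝ (connOf gm) y (stdVec j) (stdVec k) (stdVec i) l := by
    intro j k
    have := partialDeriv_coord (hasFDerivAt_apply₂ hd (stdVec k) (stdVec i)) l j
    simp only [connOf_stdVec_apply] at this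
    exact this
  have h2 : ∀ j k, (connOf gm y (stdVec j) (connOf gm y (stdVec k) (stdVec i))) l
      = ∑ m, christoffel gm l j m y * christoffel gm m k i y := by
    intro j k
    rw [connOf_stdVec, map_sum]
    simp [connOf_stdVec_apply, mul_comm]
  simp only [curv_apply, riemann, h1, Finset.sum_sub_distrib, ← h2, PiLp.sub_apply, PiLp.add_apply]
  ring

theorem nablaRiemann_eq (h : ∀ᶠ z in 𝓝 y, ContDiffAt ℝ ∞ (connOf gm) z) (m l i j k : Fin n) :
    nablaRiemann gm m l i j k y
      = covCurv (connOf gm) y (stdVec m) (stdVec j) (stdVec k) (stdVec i) l := by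
  have h0 := h.self_of_nhds
  have hd : DifferentiableAt ℝ (curv (connOf gm)) y :=
    (contDiffAt_curv h0).differentiableAt (by simp)
  have h1 : partialDeriv m (riemann gm l i j k) y
      = fderiv ℝ (curv (connOf gm)) y (stdVec m) (stdVec j) (stdVec k) (stdVec i) l := by
    have h2 : riemann gm l i j k =ᶠ[𝓝 y]
        fun z => curv (connOf gm) z (stdVec j) (stdVec k) (stdVec i) l :=
      h.mono fun z hz => riemann_eq hz l i j k
    rw [partialDeriv, h2.fderiv_eq]
    have h3 := (hasFDerivAt_apply₂ hd (stdVec j) (stdVec k)).clm_apply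
      (hasFDerivAt_const (stdVec i) y)
    have h4 := partialDeriv_coord h3 l m
    simpa [partialDeriv] using h4
  have e1 : (connOf gm y (stdVec m) (curv (connOf gm) y (stdVec j) (stdVec k) (stdVec i))) l
      = ∑ p, christoffel gm l m p y * riemann gm p i j k y := by
    conv_lhs => rw [← sum_smul_stdVec (curv (connOf gm) y (stdVec j) (stdVec k) (stdVec i))]
    rw [map_sum]
    simp [connOf_stdVec_apply, riemann_eq h0, mul_comm]
  have e2 : (curv (connOf gm) y (connOf gm y (stdVec m) (stdVec j)) (stdVec k) (stdVec i)) l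
      = ∑ p, christoffel gm p m j y * riemann gm l i p k y := by
    rw [connOf_stdVec, map_sum]
    simp [sum_apply, riemann_eq h0]
  have e3 : (curv (connOf gm) y (stdVec j) (connOf gm y (stdVec m) (stdVec k)) (stdVec i)) l
      = ∑ p, christoffel gm p m k y * riemann gm l i j p y := by
    rw [connOf_stdVec, map_sum]
    simp [sum_apply, riemann_eq h0]
  have e4 : (curv (connOf gm) y (stdVec j) (stdVec k) (connOf gm y (stdVec m) (stdVec i))) l
      = ∑ p, christoffel gm p m i y * riemann gm l p j k y := by
    rw [connOf_stdVec, map_sum]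
    simp [riemann_eq h0]
  simp only [covCurv, nablaRiemann, PiLp.sub_apply, PiLp.add_apply, e1, e2, e3, e4, h1,
    Finset.sum_sub_distrib]
  ring

theorem isLinearMap_covCurv (Γ : EuclideanSpace ℝ (Fin n) →
      EuclideanSpace ℝ (Fin n) →L[ℝ] EuclideanSpace ℝ (Fin n) →L[ℝ] EuclideanSpace ℝ (Fin n))
    (m u v w : EuclideanSpace ℝ (Fin n)) :
    IsLinearMap ℝ (fun m => covCurv Γ y m u v w) ∧ IsLinearMap ℝ (fun u => covCurv Γ y m u v w) ∧
    IsLinearMap ℝ (fun v => covCurv Γ y m u v w) ∧ IsLinearMap ℝ (fun w => covCurv Γ y m u v w) := by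
  refine ⟨⟨?_, ?_⟩, ⟨?_, ?_⟩, ⟨?_, ?_⟩, ⟨?_, ?_⟩⟩ <;> intros <;>
    simp only [covCurv, map_add, add_apply, map_smul, smul_apply, smul_add, smul_sub] <;> abel

theorem ricciCoord_eq (h : ContDiffAt ℝ ∞ (connOf gm) y) (i j : Fin n) :
    ricciCoord gm i j y =
      traceL (((curv (connOf gm) y).flip (stdVec j)).flip (stdVec i)) := by
  rw [traceL_eq_sum]
  exact Finset.sum_congr rfl fun l _ => riemann_eq h l i l j

end Coordinates

/-! ### Static patches from coordinate expressions -/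

section CoordinatePatch

variable {n : ℕ} {gm : EuclideanSpace ℝ (Fin n) → Matrix (Fin n) (Fin n) ℝ}
  {y : EuclideanSpace ℝ (Fin n)}

theorem christoffel_symm (h : ∀ᶠ z in 𝓝 y, ∀ i j, gm z i j = gm z j i) (k i j : Fin n) :
    christoffel gm k i j y = christoffel gm k j i y := by
  have h1 : ∀ l, partialDeriv l (fun z => gm z i j) y = partialDeriv l (fun z => gm z j i) y := by
    intro l
    have : (fun z => gm z i j) =ᶠ[𝓝 y] fun z => gm z j i := h.mono fun z hz => hz i j
    rw [partialDeriv, this.fderiv_eq, partialDeriv]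
  simp only [christoffel]
  congr 1
  refine Finset.sum_congr rfl fun l _ => ?_
  rw [h1 l]; ring

theorem connOf_symm (h : ∀ᶠ z in 𝓝 y, ∀ i j, gm z i j = gm z j i)
    (u v : EuclideanSpace ℝ (Fin n)) : connOf gm y u v = connOf gm y v u := by
  refine eq_of_stdVec (A := fun u => connOf gm y u v) (B := fun u => connOf gm y v u)
    ⟨by simp, by simp⟩ ⟨by simp, by simp⟩ (fun i => ?_) u
  refine eq_of_stdVec (A := fun v => connOf gm y (stdVec i) v)
    (B := fun v => connOf gm y v (stdVec i)) ⟨by simp, by simp⟩ ⟨by simp, by simp⟩ (fun j => ?_) v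
  simp only [connOf_stdVec, fun k => christoffel_symm h k i j]

/-- Lowering the index of the Christoffel symbols. -/
theorem sum_christoffel (hsymm : ∀ i j, gm y i j = gm y j i) (hdet : (gm y).det ≠ 0)
    (i j k : Fin n) :
    ∑ m, gm y m k * christoffel gm m i j y =
      1 / 2 * (partialDeriv i (fun z => gm z j k) y + partialDeriv j (fun z => gm z i k) y
        - partialDeriv k (fun z => gm z i j) y) := by
  have hmul : gm y * (gm y)⁻¹ = 1 := Matrix.mul_nonsing_inv _ (isUnit_iff_ne_zero.2 hdet)
  have hinv : ∀ l, ∑ m, gm y m k * (gm y)⁻¹ m l = if k = l then 1 else 0 := by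
    intro l
    rw [← Matrix.one_apply, ← hmul, Matrix.mul_apply]
    exact Finset.sum_congr rfl fun m _ => by rw [hsymm]
  simp only [christoffel, Finset.mul_sum]
  rw [Finset.sum_comm]
  have : ∀ l, ∑ m, gm y m k * (1 / 2 * ((gm y)⁻¹ m l *
      (partialDeriv i (fun z => gm z j l) y + partialDeriv j (fun z => gm z i l) y
        - partialDeriv l (fun z => gm z i j) y))) = (if k = l then 1 else 0) * (1 / 2 *
      (partialDeriv i (fun z => gm z j l) y + partialDeriv j (fun z => gm z i l) y
        - partialDeriv l (fun z => gm z i j) y)) := by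
    intro l
    rw [← hinv, Finset.sum_mul]
    exact Finset.sum_congr rfl fun m _ => by ring
  simp only [this, ite_mul, one_mul, zero_mul, Finset.sum_ite_eq, Finset.mem_univ, if_true]

theorem connOf_compat (hsm : ∀ i j, ContDiffAt ℝ ∞ (fun z => gm z i j) y)
    (hsymm : ∀ᶠ z in 𝓝 y, ∀ i j, gm z i j = gm z j i) (hdet : (gm y).det ≠ 0)
    (a v w : EuclideanSpace ℝ (Fin n)) :
    fderiv ℝ (fun z => formOf (gm z)) y a v w
      = formOf (gm y) (connOf gm y a v) w + formOf (gm y) v (connOf gm y a w) := by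
  have hd : DifferentiableAt ℝ (fun z => formOf (gm z)) y :=
    (contDiffAt_formOf hsm).differentiableAt (by simp)
  have hs := hsymm.self_of_nhds
  refine eq_of_stdVec (A := fun a => fderiv ℝ (fun z => formOf (gm z)) y a v w)
    (B := fun a => formOf (gm y) (connOf gm y a v) w + formOf (gm y) v (connOf gm y a w))
    ⟨by simp, by simp⟩ ⟨fun _ _ => by simp; ring, fun _ _ => by simp; ring⟩ (fun i => ?_) a
  refine eq_of_stdVec (A := fun v => fderiv ℝ (fun z => formOf (gm z)) y (stdVec i) v w)
    (B := fun v => formOf (gm y) (connOf gm y (stdVec i) v) w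
      + formOf (gm y) v (connOf gm y (stdVec i) w))
    ⟨by simp, by simp⟩ ⟨fun _ _ => by simp; ring, fun _ _ => by simp; ring⟩ (fun j => ?_) v
  refine eq_of_stdVec (A := fun w => fderiv ℝ (fun z => formOf (gm z)) y (stdVec i) (stdVec j) w)
    (B := fun w => formOf (gm y) (connOf gm y (stdVec i) (stdVec j)) w
      + formOf (gm y) (stdVec j) (connOf gm y (stdVec i) w))
    ⟨by simp, by simp⟩ ⟨fun _ _ => by simp; ring, fun _ _ => by simp; ring⟩ (fun k => ?_) w
  have h1 : fderiv ℝ (fun z => formOf (gm z)) y (stdVec i) (stdVec j) (stdVec k)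
      = partialDeriv i (fun z => gm z j k) y := by
    have h2 := (hasFDerivAt_apply₂ hd (stdVec j) (stdVec k))
    simp only [formOf_stdVec] at h2
    rw [partialDeriv, h2.fderiv]
    rfl
  have h3 : ∀ j k, formOf (gm y) (connOf gm y (stdVec i) (stdVec j)) (stdVec k)
      = 1 / 2 * (partialDeriv i (fun z => gm z j k) y + partialDeriv j (fun z => gm z i k) y
        - partialDeriv k (fun z => gm z i j) y) := by
    intro j k
    rw [← sum_christoffel hs hdet, connOf_stdVec, map_sum, sum_apply]
    exact Finset.sum_congr rfl fun m _ => by simp [formOf_stdVec, mul_comm]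
  have h4 : formOf (gm y) (stdVec j) (connOf gm y (stdVec i) (stdVec k))
      = formOf (gm y) (connOf gm y (stdVec i) (stdVec k)) (stdVec j) := by
    rw [connOf_stdVec, map_sum, map_sum, sum_apply]
    exact Finset.sum_congr rfl fun m _ => by simp [formOf_stdVec, hs j m]
  have h5 : ∀ l a b, partialDeriv l (fun z => gm z a b) y = partialDeriv l (fun z => gm z b a) y := by
    intro l a b
    have : (fun z => gm z a b) =ᶠ[𝓝 y] fun z => gm z b a := hsymm.mono fun z hz => hz a b
    rw [partialDeriv, this.fderiv_eq, partialDeriv]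
  rw [h4, h1, h3, h3, h5 i k j]
  ring

/-- The bilinear form `Ric - R / (n - 1) g` of the metric with the matrix field `gm`. -/
def staticForm (gm : EuclideanSpace ℝ (Fin n) → Matrix (Fin n) (Fin n) ℝ)
    (y : EuclideanSpace ℝ (Fin n)) :
    EuclideanSpace ℝ (Fin n) →L[ℝ] EuclideanSpace ℝ (Fin n) →L[ℝ] ℝ :=
  formOf (Matrix.of fun i j => ricciCoord gm i j y
    - scalarCoord gm y / ((n : ℝ) - 1) * gm y i j)

theorem staticForm_stdVec (i j : Fin n) : staticForm gm y (stdVec i) (stdVec j)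
    = ricciCoord gm i j y - scalarCoord gm y / ((n : ℝ) - 1) * gm y i j :=
  formOf_stdVec _ i j

theorem contDiffAt_ricciCoord (hconn : ∀ᶠ z in 𝓝 y, ContDiffAt ℝ ∞ (connOf gm) z) (i j : Fin n) :
    ContDiffAt ℝ ∞ (ricciCoord gm i j) y := by
  have h1 : ContDiffAt ℝ ∞ (fun z => ricL (stdVec i) (stdVec j) (curv (connOf gm) z)) y :=
    (ricL (stdVec i) (stdVec j)).contDiff.contDiffAt.comp y
      (contDiffAt_curv hconn.self_of_nhds)
  exact h1.congr_of_eventuallyEq (hconn.mono fun z hz => ricciCoord_eq hz i j)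

/-- In coordinates, a vacuum static space with harmonic curvature is a static patch. -/
theorem staticPatch_of_coord (hn : 2 ≤ n) {Ω : Set (EuclideanSpace ℝ (Fin n))} (hΩ : IsOpen Ω)
    (hsm : ∀ y ∈ Ω, ∀ i j, ContDiffAt ℝ ∞ (fun z => gm z i j) y)
    (hsymm : ∀ y ∈ Ω, ∀ i j, gm y i j = gm y j i)
    (hpos : ∀ y ∈ Ω, ∀ u, u ≠ 0 → 0 < formOf (gm y) u u)
    {F : EuclideanSpace ℝ (Fin n) → ℝ} (hF : ∀ y ∈ Ω, ContDiffAt ℝ ∞ F y)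
    (hdF : ∀ y ∈ Ω, fderiv ℝ F y ≠ 0)
    (hstatic : ∀ y ∈ Ω, ∀ i j, hessCoord gm F i j y = F y * (ricciCoord gm i j y
        - scalarCoord gm y / ((n : ℝ) - 1) * gm y i j))
    (hharm : ∀ y ∈ Ω, ∀ i j k, divRiemann gm i j k y = 0) :
    StaticPatch Ω (fun y => formOf (gm y)) (connOf gm) (staticForm gm) F
      (fun y => scalarCoord gm y / ((n : ℝ) - 1)) := by
  have hdet : ∀ y ∈ Ω, (gm y).det ≠ 0 := by
    intro y hy h0
    obtain ⟨v, hv, hv0⟩ := Matrix.exists_mulVec_eq_zero_iff.2 h0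
    have hv' : (WithLp.toLp 2 v : EuclideanSpace ℝ (Fin n)) ≠ 0 := by
      intro h; apply hv; ext i; exact congrArg (fun w : EuclideanSpace ℝ (Fin n) => w i) h
    have h1 := hpos y hy _ hv'
    rw [formOf_apply] at h1
    have h2 : ∑ i, ∑ j, gm y i j * v i * v j = 0 := by
      refine Finset.sum_eq_zero fun i _ => ?_
      have h3 := congrFun hv0 i
      simp only [Matrix.mulVec, dotProduct, Pi.zero_apply] at h3
      rw [← mul_zero (v i), ← h3, Finset.mul_sum]
      exact Finset.sum_congr rfl fun j _ => by ring
    exact h1.ne' h2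
  have hev : ∀ y ∈ Ω, ∀ᶠ z in 𝓝 y, z ∈ Ω := fun y hy => hΩ.mem_nhds hy
  have hconn : ∀ y ∈ Ω, ContDiffAt ℝ ∞ (connOf gm) y := fun y hy =>
    contDiffAt_connOf (hsm y hy) (hdet y hy)
  have hconn' : ∀ y ∈ Ω, ∀ᶠ z in 𝓝 y, ContDiffAt ℝ ∞ (connOf gm) z := fun y hy =>
    (hev y hy).mono hconn
  have hsymm' : ∀ y ∈ Ω, ∀ᶠ z in 𝓝 y, ∀ i j, gm z i j = gm z j i := fun y hy =>
    (hev y hy).mono hsymm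
  have hn1 : (n : ℝ) - 1 ≠ 0 := by
    have : (2 : ℝ) ≤ n := by exact_mod_cast hn
    linarith
  have hscal : ∀ y ∈ Ω, ContDiffAt ℝ ∞ (fun y => scalarCoord gm y / ((n : ℝ) - 1)) y :=
    fun y hy => (ContDiffAt.sum fun i _ => ContDiffAt.sum fun j _ =>
      (contDiffAt_inv (hsm y hy) (hdet y hy) i j).mul
        (contDiffAt_ricciCoord (hconn' y hy) i j)).div_const _
  refine
    { isOpen := hΩ
      smoothG := fun y hy => contDiffAt_formOf (hsm y hy)
      smoothΓ := hconn
      smoothT := fun y hy => contDiffAt_formOf fun i j =>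
        (contDiffAt_ricciCoord (hconn' y hy) i j).sub ((hscal y hy).mul (hsm y hy i j))
      smoothf := hF
      smooths := hscal
      symm := fun y hy u v => ?_
      pos := hpos
      torsion := fun y hy => connOf_symm (hsymm' y hy)
      compat := fun y hy => connOf_compat (hsm y hy) (hsymm' y hy) (hdet y hy)
      ric := fun y hy v w => ?_
      scal := fun y hy L hL => ?_
      static := fun y hy u v => ?_
      harmonic := fun y hy u v w L hL => ?_
      df_ne := hdF
      two_le := by simpa using hn }
  · rw [formOf_apply, formOf_apply, Finset.sum_comm]
    exact Finset.sum_congr rfl fun i _ => Finset.sum_congr rfl fun j _ => by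
      rw [hsymm y hy]; ring
  · refine eq_of_stdVec (A := fun v => staticForm gm y v w
        + scalarCoord gm y / ((n : ℝ) - 1) * formOf (gm y) v w)
      (B := fun v => traceL (((curv (connOf gm) y).flip w).flip v))
      ⟨fun _ _ => by simp; ring, fun _ _ => by simp; ring⟩ ⟨by simp, by simp⟩ (fun i => ?_) v
    refine eq_of_stdVec (A := fun w => staticForm gm y (stdVec i) w
        + scalarCoord gm y / ((n : ℝ) - 1) * formOf (gm y) (stdVec i) w)
      (B := fun w => traceL (((curv (connOf gm) y).flip w).flip (stdVec i)))
      ⟨fun _ _ => by simp; ring, fun _ _ => by simp; ring⟩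
      ⟨fun _ _ => by rw [← map_add traceL]; simp [ContinuousLinearMap.flip_add],
        fun _ _ => by rw [← map_smul traceL]; simp [ContinuousLinearMap.flip_smul]⟩ (fun j => ?_) w
    simp only [staticForm_stdVec, formOf_stdVec, ← ricciCoord_eq (hconn y hy)]
    ring
  · have hmul : gm y * (gm y)⁻¹ = 1 := Matrix.mul_nonsing_inv _ (isUnit_iff_ne_zero.2 (hdet y hy))
    have hL' : ∀ j k, ∑ i, L (stdVec j) i * gm y i k = ricciCoord gm j k y
        - scalarCoord gm y / ((n : ℝ) - 1) * gm y j k := by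
      intro j k
      rw [← staticForm_stdVec, ← hL]
      conv_rhs => rw [← sum_smul_stdVec (L (stdVec j))]
      rw [map_sum, sum_apply]
      exact Finset.sum_congr rfl fun i _ => by simp [formOf_stdVec]
    have hinvs : ∀ i j, (gm y)⁻¹ i j = (gm y)⁻¹ j i := by
      intro i j
      have : (gm y).transpose = gm y := by ext i j; exact hsymm y hy j i
      conv_lhs => rw [← this, ← Matrix.transpose_nonsing_inv]
      rfl
    have hLj : ∀ j, L (stdVec j) j = ∑ k, (ricciCoord gm j k y
        - scalarCoord gm y / ((n : ℝ) - 1) * gm y j k) * (gm y)⁻¹ k j := by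
      intro j
      simp only [← hL', Finset.sum_mul]
      rw [Finset.sum_comm]
      have : ∀ i, ∑ k, L (stdVec j) i * gm y i k * (gm y)⁻¹ k j
          = L (stdVec j) i * (1 : Matrix (Fin n) (Fin n) ℝ) i j := fun i => by
        rw [← hmul, Matrix.mul_apply, Finset.mul_sum]
        exact Finset.sum_congr rfl fun k _ => by ring
      simp [this, Matrix.one_apply]
    have h1 : ∀ j, ∑ k, gm y j k * (gm y)⁻¹ k j = 1 := fun j => by
      rw [← Matrix.mul_apply, hmul, Matrix.one_apply_eq]
    have h2 : ∑ j, ∑ k, ricciCoord gm j k y * (gm y)⁻¹ k j = scalarCoord gm y :=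
      Finset.sum_congr rfl fun j _ => Finset.sum_congr rfl fun k _ => by
        rw [hinvs k j, mul_comm]
    rw [traceL_eq_sum]
    simp only [hLj, sub_mul, Finset.sum_sub_distrib, h2, mul_assoc, ← Finset.mul_sum, h1]
    simp
    field_simp
    ring
  · have hd1 : DifferentiableAt ℝ (fderiv ℝ F) y :=
      ((hF y hy).fderiv_right (m := ∞) (by simp)).differentiableAt (by simp)
    refine eq_of_stdVec (A := fun u => fderiv ℝ (fderiv ℝ F) y u v - fderiv ℝ F y (connOf gm y u v))
      (B := fun u => F y * staticForm gm y u v)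
      ⟨fun _ _ => by simp; ring, fun _ _ => by simp; ring⟩
      ⟨fun _ _ => by simp; ring, fun _ _ => by simp; ring⟩ (fun i => ?_) u
    refine eq_of_stdVec (A := fun v => fderiv ℝ (fderiv ℝ F) y (stdVec i) v
        - fderiv ℝ F y (connOf gm y (stdVec i) v))
      (B := fun v => F y * staticForm gm y (stdVec i) v)
      ⟨fun _ _ => by simp; ring, fun _ _ => by simp; ring⟩
      ⟨fun _ _ => by simp; ring, fun _ _ => by simp; ring⟩ (fun j => ?_) v
    have h1 := hstatic y hy i j
    have h2 : partialDeriv i (partialDeriv j F) y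
        = fderiv ℝ (fderiv ℝ F) y (stdVec i) (stdVec j) := by
      have h3 := hd1.hasFDerivAt.clm_apply (hasFDerivAt_const (stdVec j) y)
      change fderiv ℝ (fun z => fderiv ℝ F z (stdVec j)) y (stdVec i) = _
      rw [h3.fderiv]
      simp
    rw [hessCoord, h2] at h1
    simp only [staticForm_stdVec]
    rw [← h1, connOf_stdVec, map_sum]
    simp only [map_smul, smul_eq_mul]
    rfl
  · rw [traceL_eq_sum]
    simp only [hL]
    have hlin := fun l u v w => isLinearMap_covCurv (y := y) (connOf gm) (stdVec l) u v w
    refine eq_of_stdVec (A := fun u => ∑ l, covCurv (connOf gm) y (stdVec l) u v w l)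
      (B := fun _ => (0 : ℝ)) ⟨fun a b => ?_, fun c a => ?_⟩ ⟨by simp, by simp⟩ (fun j => ?_) u
    · simp only [(hlin _ u v w).2.1.map_add a b, PiLp.add_apply, Finset.sum_add_distrib]
    · simp only [(hlin _ u v w).2.1.map_smul c a, PiLp.smul_apply, Finset.smul_sum]
    refine eq_of_stdVec (A := fun v => ∑ l, covCurv (connOf gm) y (stdVec l) (stdVec j) v w l)
      (B := fun _ => (0 : ℝ)) ⟨fun a b => ?_, fun c a => ?_⟩ ⟨by simp, by simp⟩ (fun k => ?_) v
    · simp only [(hlin _ (stdVec j) v w).2.2.1.map_add a b, PiLp.add_apply, Finset.sum_add_distrib]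
    · simp only [(hlin _ (stdVec j) v w).2.2.1.map_smul c a, PiLp.smul_apply, Finset.smul_sum]
    refine eq_of_stdVec (A := fun w =>
        ∑ l, covCurv (connOf gm) y (stdVec l) (stdVec j) (stdVec k) w l)
      (B := fun _ => (0 : ℝ)) ⟨fun a b => ?_, fun c a => ?_⟩ ⟨by simp, by simp⟩ (fun i => ?_) w
    · simp only [(hlin _ (stdVec j) (stdVec k) w).2.2.2.map_add a b, PiLp.add_apply,
        Finset.sum_add_distrib]
    · simp only [(hlin _ (stdVec j) (stdVec k) w).2.2.2.map_smul c a, PiLp.smul_apply,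
        Finset.smul_sum]
    rw [← hharm y hy i j k, divRiemann]
    exact Finset.sum_congr rfl fun l _ => (nablaRiemann_eq (hconn' y hy) l l i j k).symm

end CoordinatePatch

/-! ### Passage to a chart of the manifold -/

section CoordVec

variable {n : ℕ} {M : Type*} [TopologicalSpace M] [ChartedSpace (EuclideanSpace ℝ (Fin n)) M]
  {φ : OpenPartialHomeomorph M (EuclideanSpace ℝ (Fin n))} {y : EuclideanSpace ℝ (Fin n)}

/-- The vector with components `u` at the point with coordinates `y`. -/
theorem sum_smul_coordVec (u : EuclideanSpace ℝ (Fin n)) :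
    ∑ i, u i • coordVec φ i y = mfderiv (𝓡 n) (𝓡 n) φ.symm y u := by
  let L : EuclideanSpace ℝ (Fin n) →L[ℝ] TangentSpace (𝓡 n) (φ.symm y) :=
    mfderiv (𝓡 n) (𝓡 n) φ.symm y
  change ∑ i, u i • L (stdVec i) = L u
  conv_rhs => rw [← sum_smul_stdVec u]
  simp only [map_sum, map_smul]

end CoordVec

section Chart

variable {n : ℕ} {M : Type*} [TopologicalSpace M] [ChartedSpace (EuclideanSpace ℝ (Fin n)) M]
  [IsManifold (𝓡 n) ∞ M] {φ : OpenPartialHomeomorph M (EuclideanSpace ℝ (Fin n))}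
  {y : EuclideanSpace ℝ (Fin n)}

theorem contMDiffOn_chart_symm (hφ : φ ∈ atlas (EuclideanSpace ℝ (Fin n)) M) :
    ContMDiffOn (𝓡 n) (𝓡 n) ∞ φ.symm φ.target :=
  contMDiffOn_symm_of_mem_maximalAtlas (IsManifold.subset_maximalAtlas hφ)

/-- The coordinate vector fields are smooth. -/
theorem contMDiffAt_coordVec (hφ : φ ∈ atlas (EuclideanSpace ℝ (Fin n)) M) (hy : y ∈ φ.target)
    (i : Fin n) :
    ContMDiffAt (𝓡 n) (𝓡 n).tangent ∞
      (fun z => (⟨φ.symm z, coordVec φ i z⟩ : TangentBundle (𝓡 n) M)) y := by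
  have h1 := (contMDiffOn_chart_symm hφ).contMDiffOn_tangentMapWithin (m := ∞) (by simp)
    φ.open_target.uniqueMDiffOn
  have h2 : ContMDiffAt (𝓡 n) (𝓡 n).tangent ∞
      (fun z => (⟨z, stdVec i⟩ : TangentBundle (𝓡 n) (EuclideanSpace ℝ (Fin n)))) y :=
    contMDiffAt_vectorSpace_iff_contDiffAt.2 contDiffAt_const
  have h3 := (h1 ⟨y, stdVec i⟩ hy).contMDiffAt
    ((φ.open_target.preimage (FiberBundle.continuous_proj _ _)).mem_nhds hy)
  refine (ContMDiffAt.comp y h3 h2).congr_of_eventuallyEq ?_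
  filter_upwards [φ.open_target.mem_nhds hy] with z hz
  simp only [Function.comp, tangentMapWithin, mfderivWithin_of_isOpen φ.open_target hz]
  rfl

theorem contDiffAt_metricCoord (g : Metric n M) (hφ : φ ∈ atlas (EuclideanSpace ℝ (Fin n)) M)
    (hy : y ∈ φ.target) (i j : Fin n) : ContDiffAt ℝ ∞ (fun z => metricCoord g φ z i j) y := by
  have hb : ContMDiffAt (𝓡 n) (𝓡 n) ∞ φ.symm y :=
    (contMDiffOn_chart_symm hφ).contMDiffAt (φ.open_target.mem_nhds hy)
  have h1 := ContMDiffAt.comp y g.contMDiff.contMDiffAt hb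
  have h2 := ContMDiffAt.clm_bundle_apply₂ (F₃ := ℝ) (E₃ := Bundle.Trivial M ℝ) (b := φ.symm)
    (ψ := fun z => g.inner (φ.symm z)) h1
    (contMDiffAt_coordVec hφ hy i) (contMDiffAt_coordVec hφ hy j)
  simp only [Bundle.contMDiffAt_totalSpace] at h2
  exact h2.2.contDiffAt

theorem contDiffAt_comp_chart_symm {f : M → ℝ} (hf : ContMDiff (𝓡 n) 𝓘(ℝ, ℝ) ∞ f)
    (hφ : φ ∈ atlas (EuclideanSpace ℝ (Fin n)) M) (hy : y ∈ φ.target) :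
    ContDiffAt ℝ ∞ (f ∘ φ.symm) y := by
  have hb : ContMDiffAt (𝓡 n) (𝓡 n) ∞ φ.symm y :=
    (contMDiffOn_chart_symm hφ).contMDiffAt (φ.open_target.mem_nhds hy)
  exact (ContMDiffAt.comp y hf.contMDiffAt hb).contDiffAt

theorem metricCoord_symm (g : Metric n M) (i j : Fin n) :
    metricCoord g φ y i j = metricCoord g φ y j i :=
  g.symm _ _ _

theorem formOf_metricCoord (g : Metric n M) (u v : EuclideanSpace ℝ (Fin n)) :
    formOf (metricCoord g φ y) u v = g.inner (φ.symm y) (mfderiv (𝓡 n) (𝓡 n) φ.symm y u)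
      (mfderiv (𝓡 n) (𝓡 n) φ.symm y v) := by
  rw [← sum_smul_coordVec, ← sum_smul_coordVec, formOf_apply]
  simp only [map_sum, map_smul, sum_apply, smul_apply, smul_eq_mul, metricCoord, Matrix.of_apply]
  rw [Finset.sum_comm]
  refine Finset.sum_congr rfl fun i _ => ?_
  rw [Finset.mul_sum]
  exact Finset.sum_congr rfl fun j _ => by ring

theorem formOf_metricCoord_pos (g : Metric n M) (hφ : φ ∈ atlas (EuclideanSpace ℝ (Fin n)) M)
    (hy : y ∈ φ.target) (u : EuclideanSpace ℝ (Fin n)) (hu : u ≠ 0) :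
    0 < formOf (metricCoord g φ y) u u := by
  rw [formOf_metricCoord]
  refine g.pos _ _ fun h => hu ?_
  have h1 := congrArg (fun L => L u) ((mdifferentiable_of_mem_atlas (I := 𝓡 n) hφ).comp_symm_deriv hy)
  change mfderiv (𝓡 n) (𝓡 n) φ (φ.symm y) (mfderiv (𝓡 n) (𝓡 n) φ.symm y u) = u at h1
  rw [← h1, h, map_zero]
  rfl

variable {g : Metric n M} {f : M → ℝ}

/-- In a chart, a vacuum static space with harmonic curvature is a `StaticPatch` away from the
critical points of `f`. -/
theorem staticPatch_chart (hn : 2 ≤ n) (hs : IsVacuumStatic g f) (hh : HasHarmonicCurvature g)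
    (hφ : φ ∈ atlas (EuclideanSpace ℝ (Fin n)) M) :
    StaticPatch (φ.target ∩ {y | fderiv ℝ (f ∘ φ.symm) y ≠ 0})
      (fun y => formOf (metricCoord g φ y)) (connOf (metricCoord g φ))
      (staticForm (metricCoord g φ)) (f ∘ φ.symm)
      (fun y => scalarCoord (metricCoord g φ) y / ((n : ℝ) - 1)) := by
  have hF : ∀ y ∈ φ.target, ContDiffAt ℝ ∞ (f ∘ φ.symm) y := fun y hy =>
    contDiffAt_comp_chart_symm hs.smooth hφ hy
  refine staticPatch_of_coord hn ?_ (fun y hy => contDiffAt_metricCoord g hφ hy.1)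
    (fun y _ => metricCoord_symm g) (fun y hy => formOf_metricCoord_pos g hφ hy.1)
    (fun y hy => hF y hy.1) (fun y hy => hy.2) (fun y hy => hs.static φ hφ y hy.1)
    (fun y hy => hh φ hφ y hy.1)
  refine ContinuousOn.isOpen_inter_preimage (f := fderiv ℝ (f ∘ φ.symm)) (fun y hy => ?_)
    φ.open_target isOpen_compl_singleton
  exact ((hF y hy).fderiv_right (m := ∞) (by simp)).continuousAt.continuousWithinAt

/-- The components of a tangent vector at `x` in the preferred chart. -/
def coords (x : M) : TangentSpace (𝓡 n) x →L[ℝ] EuclideanSpace ℝ (Fin n) :=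
  mfderiv (𝓡 n) (𝓡 n) (chartAt (EuclideanSpace ℝ (Fin n)) x) x

/-- The tangent vector at `x` with given components in the preferred chart. -/
def ofCoords (x : M) : EuclideanSpace ℝ (Fin n) →L[ℝ] TangentSpace (𝓡 n) x :=
  mfderiv (𝓡 n) (𝓡 n) (chartAt (EuclideanSpace ℝ (Fin n)) x).symm
    (chartAt (EuclideanSpace ℝ (Fin n)) x x)

theorem ofCoords_coords (x : M) (v : TangentSpace (𝓡 n) x) : ofCoords x (coords x v) = v :=
  congrArg (fun L => L v) ((mdifferentiable_chart (I := 𝓡 n) x).symm_comp_deriv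
    (mem_chart_source (EuclideanSpace ℝ (Fin n)) x))

theorem coords_ofCoords (x : M) (u : EuclideanSpace ℝ (Fin n)) :
    coords x (ofCoords x u) = u := by
  -- `φ.symm (φ x) = x` is not definitional, so the base point is generalized
  have key : ∀ (x' : M) (_ : x' = x) (a : EuclideanSpace ℝ (Fin n)),
      (show EuclideanSpace ℝ (Fin n) from mfderiv (𝓡 n) (𝓡 n)
        (chartAt (EuclideanSpace ℝ (Fin n)) x) x (show TangentSpace (𝓡 n) x from a))
      = mfderiv (𝓡 n) (𝓡 n) (chartAt (EuclideanSpace ℝ (Fin n)) x) x'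
        (show TangentSpace (𝓡 n) x' from a) := by
    rintro _ rfl a; rfl
  refine (key _ ((chartAt (EuclideanSpace ℝ (Fin n)) x).left_inv
    (mem_chart_source (EuclideanSpace ℝ (Fin n)) x)) _).trans ?_
  exact congrArg (fun L => L u) ((mdifferentiable_chart (I := 𝓡 n) x).comp_symm_deriv
    (mem_chart_target (EuclideanSpace ℝ (Fin n)) x))

theorem formOf_coords (g : Metric n M) (x : M) (v w : TangentSpace (𝓡 n) x) :
    formOf (metricCoord g (chartAt (EuclideanSpace ℝ (Fin n)) x)
      (chartAt (EuclideanSpace ℝ (Fin n)) x x)) (coords x v) (coords x w) = g.inner x v w := by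
  -- `φ.symm (φ x) = x` is not definitional, so the base point is generalized
  have key : ∀ (x' : M) (_ : x' = x) (a b : EuclideanSpace ℝ (Fin n)),
      g.inner x' (show TangentSpace (𝓡 n) x' from a) (show TangentSpace (𝓡 n) x' from b)
        = g.inner x (show TangentSpace (𝓡 n) x from a) (show TangentSpace (𝓡 n) x from b) := by
    rintro _ rfl a b; rfl
  rw [formOf_metricCoord]
  refine (key _ ((chartAt (EuclideanSpace ℝ (Fin n)) x).left_inv
    (mem_chart_source (EuclideanSpace ℝ (Fin n)) x)) _ _).trans ?_
  change g.inner x (ofCoords x (coords x v)) (ofCoords x (coords x w)) = _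
  rw [ofCoords_coords, ofCoords_coords]

/-- The decomposition `Ric = T + s g`, with the right-hand side read off in the preferred chart. -/
theorem ricci_eq (g : Metric n M) (x : M) (v w : TangentSpace (𝓡 n) x) :
    ricci g x v w = staticForm (metricCoord g (chartAt (EuclideanSpace ℝ (Fin n)) x))
        (chartAt (EuclideanSpace ℝ (Fin n)) x x) (coords x v) (coords x w)
      + scalarCoord (metricCoord g (chartAt (EuclideanSpace ℝ (Fin n)) x))
          (chartAt (EuclideanSpace ℝ (Fin n)) x x) / ((n : ℝ) - 1) * g.inner x v w := by
  rw [← formOf_coords, staticForm, formOf_apply, formOf_apply, Finset.mul_sum,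
    ← Finset.sum_add_distrib, ricci]
  refine Finset.sum_congr rfl fun i _ => ?_
  rw [Finset.mul_sum, ← Finset.sum_add_distrib]
  refine Finset.sum_congr rfl fun j _ => ?_
  rw [show component (chartAt (EuclideanSpace ℝ (Fin n)) x) x v i = coords x v i from rfl,
    show component (chartAt (EuclideanSpace ℝ (Fin n)) x) x w j = coords x w j from rfl,
    Matrix.of_apply]
  ring

theorem fderiv_coords (hf : ContMDiff (𝓡 n) 𝓘(ℝ, ℝ) ∞ f) (x : M) (v : TangentSpace (𝓡 n) x) :
    fderiv ℝ (f ∘ (chartAt (EuclideanSpace ℝ (Fin n)) x).symm)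
      (chartAt (EuclideanSpace ℝ (Fin n)) x x) (coords x v) = mfderiv (𝓡 n) 𝓘(ℝ, ℝ) f x v := by
  have hx := (chartAt (EuclideanSpace ℝ (Fin n)) x).left_inv
    (mem_chart_source (EuclideanSpace ℝ (Fin n)) x)
  have hsymm : MDifferentiableAt (𝓡 n) (𝓡 n) (chartAt (EuclideanSpace ℝ (Fin n)) x).symm
      (chartAt (EuclideanSpace ℝ (Fin n)) x x) :=
    ((contMDiffOn_chart_symm (chart_mem_atlas _ x)).contMDiffAt
      ((chartAt (EuclideanSpace ℝ (Fin n)) x).open_target.mem_nhds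
        (mem_chart_target _ x))).mdifferentiableAt (by simp)
  have hfx : MDifferentiableAt (𝓡 n) 𝓘(ℝ, ℝ) f x := hf.contMDiffAt.mdifferentiableAt (by simp)
  rw [← mfderiv_eq_fderiv, mfderiv_comp_of_eq (y := x) hfx hsymm hx]
  -- `φ.symm (φ x) = x` is not definitional, so the base point is generalized
  have key : ∀ (x' : M) (_ : x' = x) (a : EuclideanSpace ℝ (Fin n)),
      (show ℝ from mfderiv (𝓡 n) 𝓘(ℝ, ℝ) f x' (show TangentSpace (𝓡 n) x' from a))
      = mfderiv (𝓡 n) 𝓘(ℝ, ℝ) f x (show TangentSpace (𝓡 n) x from a) := by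
    rintro _ rfl a; rfl
  refine (key _ hx _).trans ?_
  exact congrArg (mfderiv (𝓡 n) 𝓘(ℝ, ℝ) f x) (ofCoords_coords x v)

theorem grad_ne_zero_iff (hf : ContMDiff (𝓡 n) 𝓘(ℝ, ℝ) ∞ f) (x : M) :
    grad g f x ≠ 0 ↔ fderiv ℝ (f ∘ (chartAt (EuclideanSpace ℝ (Fin n)) x).symm)
      (chartAt (EuclideanSpace ℝ (Fin n)) x x) ≠ 0 := by
  refine not_congr ⟨fun h => ?_, fun h => ?_⟩
  · ext u
    rw [← coords_ofCoords x u, fderiv_coords hf, ← inner_grad g, h]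
    simp
  · by_contra h0
    have h1 := g.pos x _ h0
    rw [inner_grad, ← fderiv_coords hf, h] at h1
    simp at h1

theorem grad_ne_zero_of_fderiv (hf : ContMDiff (𝓡 n) 𝓘(ℝ, ℝ) ∞ f)
    (hφ : φ ∈ atlas (EuclideanSpace ℝ (Fin n)) M) (hy : y ∈ φ.target)
    (h : fderiv ℝ (f ∘ φ.symm) y ≠ 0) : grad g f (φ.symm y) ≠ 0 := by
  intro h0
  apply h
  have hb : MDifferentiableAt (𝓡 n) (𝓡 n) φ.symm y :=
    ((contMDiffOn_chart_symm hφ).contMDiffAt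
      (φ.open_target.mem_nhds hy)).mdifferentiableAt (by simp)
  have hfx : MDifferentiableAt (𝓡 n) 𝓘(ℝ, ℝ) f (φ.symm y) :=
    hf.contMDiffAt.mdifferentiableAt (by simp)
  ext u
  rw [← mfderiv_eq_fderiv, mfderiv_comp y hfx hb]
  refine (inner_grad g f (φ.symm y) (mfderiv (𝓡 n) (𝓡 n) φ.symm y u)).symm.trans ?_
  rw [h0]
  simp

end Chart

/-! ### Adapted frames and the eigenvalue count -/

section Eigenframe

variable {V : Type*} [AddCommGroup V] [Module ℝ V] [FiniteDimensional ℝ V]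
  (B S : LinearMap.BilinForm ℝ V)

/-- A symmetric form `S` can be diagonalized in an orthonormal basis of a scalar product `B`. -/
theorem exists_orthonormal_eigenbasis (hB : ∀ u v, B u v = B v u) (hpos : ∀ u, u ≠ 0 → 0 < B u u)
    (hS : ∀ u v, S u v = S v u) {m : ℕ} (hm : Module.finrank ℝ V = m) :
    ∃ (e : Fin m → V) (lam : Fin m → ℝ), (∀ i j, B (e i) (e j) = if i = j then 1 else 0) ∧
      ∀ i j, S (e i) (e j) = if i = j then lam i else 0 := by
  have hnd : B.Nondegenerate := by
    refine ⟨fun v hv => ?_, fun v hv => ?_⟩ <;>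
    · by_contra h
      exact (hpos v h).ne' (hv v)
  let A : V →ₗ[ℝ] V := (B.toDual hnd).symm.toLinearMap ∘ₗ S
  have hA : ∀ u v, B (A u) v = S u v := fun u v =>
    LinearMap.BilinForm.apply_toDual_symm_apply (B := B) (hB := hnd) (S u) v
  let core : InnerProductSpace.Core ℝ V :=
    { inner := fun u v => B u v
      conj_inner_symm := fun u v => hB v u
      re_inner_nonneg := fun u => by
        rcases eq_or_ne u 0 with rfl | hu
        · simp
        · exact (hpos u hu).le
      add_left := fun u v w => by simp
      smul_left := fun u v r => by simp
      definite := fun u hu => by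
        by_contra h
        exact (hpos u h).ne' hu }
  let : NormedAddCommGroup V := core.toNormedAddCommGroup
  let : InnerProductSpace ℝ V := InnerProductSpace.ofCore core.toCore
  have hAs : A.IsSymmetric := fun u v => by
    change B (A u) v = B u (A v)
    rw [hB u, hA, hA, hS]
  let b := hAs.eigenvectorBasis hm
  have hb : ∀ i j, B (b i) (b j) = if i = j then 1 else 0 := fun i j =>
    orthonormal_iff_ite.1 b.orthonormal i j
  refine ⟨b, hAs.eigenvalues hm, hb, fun i j => ?_⟩
  rw [← hA, hAs.apply_eigenvectorBasis hm i, map_smul, LinearMap.smul_apply, hb]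
  simp

/-- If moreover `N` is an eigenvector, then the basis can be chosen to start with `N / |N|`. -/
theorem exists_orthonormal_eigenframe (hB : ∀ u v, B u v = B v u)
    (hpos : ∀ u, u ≠ 0 → 0 < B u u) (hS : ∀ u v, S u v = S v u) {N : V} (hN : N ≠ 0) {c : ℝ}
    (hc : ∀ w, S N w = c * B N w) {m : ℕ} (hm : Module.finrank ℝ V = m + 1) :
    ∃ (e : Fin (m + 1) → V) (lam : Fin (m + 1) → ℝ),
      (∀ i j, B (e i) (e j) = if i = j then 1 else 0) ∧ e 0 = (Real.sqrt (B N N))⁻¹ • N ∧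
      ∀ i j, S (e i) (e j) = if i = j then lam i else 0 := by
  have hNN := hpos N hN
  let W : Submodule ℝ V := LinearMap.ker (B N)
  have hW : Module.finrank ℝ W = m := by
    have h1 : Module.finrank ℝ W + 1 = Module.finrank ℝ V :=
      Module.Dual.finrank_ker_add_one_of_ne_zero fun h => hNN.ne' (by rw [h]; rfl)
    omega
  obtain ⟨e, lam, he, hlam⟩ := exists_orthonormal_eigenbasis
    (B.restrict W) (S.restrict W) (fun u v => hB u v)
    (fun u hu => hpos u fun h => hu (Subtype.ext h)) (fun u v => hS u v) hW
  have he0 : ∀ i, B N (e i) = 0 := fun i => (e i).2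
  have hsq := Real.mul_self_sqrt hNN.le
  have hs0 := (Real.sqrt_pos.2 hNN).ne'
  refine ⟨Fin.cons ((Real.sqrt (B N N))⁻¹ • N) fun i => (e i : V), Fin.cons c lam, ?_, rfl, ?_⟩
  · intro i j
    refine Fin.cases ?_ (fun i => ?_) i <;> refine Fin.cases ?_ (fun j => ?_) j
    · simp only [Fin.cons_zero, map_smul, LinearMap.smul_apply, smul_eq_mul, if_true]
      generalize Real.sqrt (B N N) = r at *
      rw [← hsq]
      field_simp
    · simp [he0, (Fin.succ_ne_zero j).symm]
    · simp [he0, hB _ N]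
    · simpa using he i j
  · intro i j
    refine Fin.cases ?_ (fun i => ?_) i <;> refine Fin.cases ?_ (fun j => ?_) j
    · simp only [Fin.cons_zero, map_smul, LinearMap.smul_apply, smul_eq_mul, if_true, hc]
      generalize Real.sqrt (B N N) = r at *
      rw [← hsq]
      field_simp
    · simp [he0, hc, (Fin.succ_ne_zero j).symm]
    · simp [he0, hS _ N, hc]
    · simpa using hlam i j

end Eigenframe

section Pointwise

variable {n : ℕ} {M : Type*} [TopologicalSpace M] [ChartedSpace (EuclideanSpace ℝ (Fin n)) M]
  [IsManifold (𝓡 n) ∞ M] {g : Metric n M} {f : M → ℝ} {x : M}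

theorem chart_mem_patch (hf : ContMDiff (𝓡 n) 𝓘(ℝ, ℝ) ∞ f) (hx : grad g f x ≠ 0) :
    chartAt (EuclideanSpace ℝ (Fin n)) x x ∈ (chartAt (EuclideanSpace ℝ (Fin n)) x).target ∩
      {y | fderiv ℝ (f ∘ (chartAt (EuclideanSpace ℝ (Fin n)) x).symm) y ≠ 0} :=
  ⟨mem_chart_target _ x, (grad_ne_zero_iff hf x).1 hx⟩

theorem ricci_symm (hn : 2 ≤ n) (hs : IsVacuumStatic g f) (hh : HasHarmonicCurvature g)
    (hx : grad g f x ≠ 0) (v w : TangentSpace (𝓡 n) x) : ricci g x v w = ricci g x w v := by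
  rw [ricci_eq, ricci_eq, (staticPatch_chart hn hs hh (chart_mem_atlas _ x)).T_symm
    (chart_mem_patch hs.smooth hx), g.symm x v w]

/-- The gradient of `f` is an eigenvector of the Ricci tensor. -/
theorem exists_ricci_grad (hn : 2 ≤ n) (hs : IsVacuumStatic g f) (hh : HasHarmonicCurvature g)
    (hx : grad g f x ≠ 0) : ∃ c, ∀ w, ricci g x (grad g f x) w = c * g.inner x (grad g f x) w := by
  have hP := staticPatch_chart hn hs hh (chart_mem_atlas _ x)
  have hy := chart_mem_patch hs.smooth hx
  have hN : ofCoords x (gradG (fun y => formOf (metricCoord g (chartAt _ x) y))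
      (f ∘ (chartAt (EuclideanSpace ℝ (Fin n)) x).symm) (chartAt _ x x)) = grad g f x := by
    have h1 : ∀ w, g.inner x (ofCoords x (gradG (fun y => formOf (metricCoord g (chartAt _ x) y))
        (f ∘ (chartAt (EuclideanSpace ℝ (Fin n)) x).symm) (chartAt _ x x))) w
        = g.inner x (grad g f x) w := fun w => by
      rw [← formOf_coords, coords_ofCoords, hP.G_gradG hy, fderiv_coords hs.smooth, inner_grad]
    rw [← sub_eq_zero]
    by_contra h0
    refine (g.pos x _ h0).ne' ?_
    rw [map_sub (g.inner x), sub_apply, h1, sub_self]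
  have hN' := congrArg (coords x) hN
  rw [coords_ofCoords] at hN'
  obtain ⟨c, hc⟩ : ∃ c, ∀ w, staticForm (metricCoord g (chartAt (EuclideanSpace ℝ (Fin n)) x))
      (chartAt _ x x) (gradG (fun y => formOf (metricCoord g (chartAt _ x) y))
        (f ∘ (chartAt (EuclideanSpace ℝ (Fin n)) x).symm) (chartAt _ x x)) w
      = c * fderiv ℝ (f ∘ (chartAt (EuclideanSpace ℝ (Fin n)) x).symm) (chartAt _ x x) w :=
    ⟨_, hP.T_gradG hy⟩
  refine ⟨c + scalarCoord (metricCoord g (chartAt (EuclideanSpace ℝ (Fin n)) x))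
    (chartAt (EuclideanSpace ℝ (Fin n)) x x) / ((n : ℝ) - 1), fun w => ?_⟩
  rw [ricci_eq, ← hN', hc, fderiv_coords hs.smooth, inner_grad]
  exact (add_mul _ _ _).symm

/-- Adapted Ricci frames exist at the regular points of `f`. -/
theorem exists_isAdaptedRicciFrame (hn : 2 ≤ n) (hs : IsVacuumStatic g f)
    (hh : HasHarmonicCurvature g) (hx : grad g f x ≠ 0) :
    ∃ e lam, IsAdaptedRicciFrame g f x e lam := by
  obtain ⟨c, hc⟩ := exists_ricci_grad hn hs hh hx
  let S : LinearMap.BilinForm ℝ (TangentSpace (𝓡 n) x) := LinearMap.mk₂ ℝ (ricci g x)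
    (fun u v w => by simp only [ricci_eq, map_add, add_apply]; ring)
    (fun r u v => by simp only [ricci_eq, map_smul, smul_apply, smul_eq_mul]; ring)
    (fun u v w => by simp only [ricci_eq, map_add]; ring)
    (fun r u v => by simp only [ricci_eq, map_smul, smul_eq_mul]; ring)
  obtain ⟨m, rfl⟩ : ∃ m, n = m + 1 := ⟨n - 1, by omega⟩
  obtain ⟨e, lam, he, he0, hlam⟩ := exists_orthonormal_eigenframe (metricBilin g x) S
    (g.symm x) (g.pos x) (ricci_symm hn hs hh hx) hx hc (m := m)
    (finrank_euclideanSpace_fin (𝕜 := ℝ) (n := m + 1))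
  refine ⟨e, lam, he, fun i hi => ?_, hlam⟩
  rw [show i = 0 from Fin.ext hi, he0]
  rfl

/-- In an adapted Ricci frame at a regular point of `f`, the Ricci eigenvalues of the vectors
orthogonal to `∇f` that differ from `R / (n - 1)` are all equal. -/
theorem IsAdaptedRicciFrame.encard_le_two (hn : 2 ≤ n) (hs : IsVacuumStatic g f)
    (hh : HasHarmonicCurvature g) (hx : grad g f x ≠ 0) {e : Fin n → TangentSpace (𝓡 n) x}
    {lam : Fin n → ℝ} (he : IsAdaptedRicciFrame g f x e lam) :
    (lam '' {i : Fin n | (i : ℕ) ≠ 0}).encard ≤ 2 := by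
  have hP := staticPatch_chart hn hs hh (chart_mem_atlas _ x)
  have hy := chart_mem_patch hs.smooth hx
  obtain ⟨m, rfl⟩ : ∃ m, n = m + 1 := ⟨n - 1, by omega⟩
  let s := scalarCoord (metricCoord g (chartAt (EuclideanSpace ℝ (Fin (m + 1))) x))
          (chartAt (EuclideanSpace ℝ (Fin (m + 1))) x x) / (((m + 1 : ℕ) : ℝ) - 1)
  have hG : ∀ i j, formOf (metricCoord g (chartAt (EuclideanSpace ℝ (Fin (m + 1))) x)
      (chartAt _ x x)) (coords x (e i)) (coords x (e j)) = if i = j then 1 else 0 := fun i j => by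
    rw [formOf_coords, he.orthonormal]
  have hT : ∀ i w, staticForm (metricCoord g (chartAt (EuclideanSpace ℝ (Fin (m + 1))) x))
      (chartAt _ x x) (coords x (e i)) w = (lam i - s) *
        formOf (metricCoord g (chartAt _ x) (chartAt _ x x)) (coords x (e i)) w := by
    intro i w
    have h1 := (hP.orthogonal_frame hy (κ := Fin (m + 1)) (by simp) (fun j => coords x (e j))
      (fun i j hij => by rw [hG, if_neg hij])
      (fun i h0 => by have := hG i i; rw [h0] at this; simp at this)).1
      (sharpT (fun y => formOf (metricCoord g (chartAt _ x) y))
        (staticForm (metricCoord g (chartAt _ x))) (chartAt _ x x) (coords x (e i))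
        - (lam i - s) • coords x (e i)) fun j => by
      have h2 := he.diagonal i j
      rw [ricci_eq, he.orthonormal] at h2
      rw [map_sub, sub_apply, hP.G_sharpT hy, map_smul, smul_apply, hG, smul_eq_mul]
      change _ + s * _ = _ at h2
      rw [← eq_sub_iff_add_eq] at h2
      rw [h2]
      split_ifs <;> ring
    rw [← hP.G_sharpT hy, sub_eq_zero.1 h1, map_smul, smul_apply, smul_eq_mul]
  have hdf : ∀ i : Fin m, fderiv ℝ (f ∘ (chartAt (EuclideanSpace ℝ (Fin (m + 1))) x).symm)
      (chartAt _ x x) (coords x (e i.succ)) = 0 := by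
    intro i
    have h1 := he.orthonormal 0 i.succ
    rw [he.first 0 rfl, map_smul, smul_apply, if_neg (Fin.succ_ne_zero i).symm, smul_eq_mul] at h1
    rw [fderiv_coords hs.smooth, ← inner_grad g]
    exact (mul_eq_zero.1 h1).resolve_left (inv_ne_zero (Real.sqrt_pos.2 (g.pos x _ hx)).ne')
  have heq : ∀ i j : Fin m, lam i.succ - s ≠ 0 → lam j.succ - s ≠ 0 →
      lam i.succ - s = lam j.succ - s := fun i j =>
    hP.eigenvalue_eq hy (ι := Fin m) (by simp) (fun i => coords x (e i.succ)) (fun i => lam i.succ - s)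
      (fun i j => by rw [hG]; simp) hdf (fun i => hT i.succ)
  obtain ⟨t, ht⟩ : ∃ t, ∀ j : Fin m, lam j.succ = s ∨ lam j.succ = t := by
    by_cases h : ∃ i : Fin m, lam i.succ - s ≠ 0
    · obtain ⟨i, hi⟩ := h
      refine ⟨lam i.succ, fun j => ?_⟩
      by_cases hj : lam j.succ - s = 0
      · exact Or.inl (sub_eq_zero.1 hj)
      · exact Or.inr (sub_left_inj.1 (heq j i hj hi))
    · push Not at h
      exact ⟨s, fun j => Or.inl (sub_eq_zero.1 (h j))⟩
  refine (Set.encard_le_encard (t := {s, t}) ?_).trans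
    ((Set.encard_insert_le _ _).trans (by rw [Set.encard_singleton]; norm_num))
  rintro _ ⟨i, hi, rfl⟩
  obtain ⟨j, rfl⟩ := Fin.exists_succ_eq.2 (fun h : i = 0 => hi (by rw [h]; rfl))
  exact ht j

theorem isOpen_ricciRegularSet (g : Metric n M) : IsOpen (ricciRegularSet g) := by
  rw [isOpen_iff_mem_nhds]
  intro x hx
  filter_upwards [eventually_eventually_nhds.2 hx, hx] with y hy hyx
  exact hy.mono fun z hz => hz.trans hyx.symm

theorem isOpen_grad_ne_zero (g : Metric n M) (hf : ContMDiff (𝓡 n) 𝓘(ℝ, ℝ) ∞ f) :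
    IsOpen {x | grad g f x ≠ 0} := by
  rw [isOpen_iff_mem_nhds]
  intro x hx
  have hφ := chart_mem_atlas (EuclideanSpace ℝ (Fin n)) x
  have hxs := mem_chart_source (EuclideanSpace ℝ (Fin n)) x
  have hcont : ContinuousAt (fun z => fderiv ℝ (f ∘ (chartAt (EuclideanSpace ℝ (Fin n)) x).symm)
      (chartAt _ x z)) x :=
    ((contDiffAt_comp_chart_symm hf hφ (mem_chart_target _ x)).fderiv_right
      (m := ∞) (by simp)).continuousAt.comp ((chartAt _ x).continuousAt hxs)
  filter_upwards [hcont.eventually_ne ((grad_ne_zero_iff hf x).1 hx),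
    (chartAt (EuclideanSpace ℝ (Fin n)) x).open_source.mem_nhds hxs] with z hz hzs
  have h1 := grad_ne_zero_of_fderiv (g := g) hf hφ ((chartAt _ x).map_source hzs) hz
  rwa [(chartAt _ x).left_inv hzs] at h1

end Pointwise

end StaticSpace

theorem mainTheorem4 {n : ℕ} (hn : 4 ≤ n)
    {M : Type*} [TopologicalSpace M] [ChartedSpace (EuclideanSpace ℝ (Fin n)) M]
    [IsManifold (𝓡 n) ∞ M]
    (g : StaticSpace.Metric n M) (f : M → ℝ)
    (hstatic : StaticSpace.IsVacuumStatic g f)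
    (hharm : StaticSpace.HasHarmonicCurvature g)
    (p : M) (hp : p ∈ StaticSpace.ricciRegularSet g ∩ {x | StaticSpace.grad g f x ≠ 0}) :
    ∃ U : Set M, IsOpen U ∧ p ∈ U ∧
      U ⊆ StaticSpace.ricciRegularSet g ∩ {x | StaticSpace.grad g f x ≠ 0} ∧
      ∀ x ∈ U,
        (∃ e lam, StaticSpace.IsAdaptedRicciFrame g f x e lam) ∧
        ∀ e lam, StaticSpace.IsAdaptedRicciFrame g f x e lam →
          (lam '' {i : Fin n | (i : ℕ) ≠ 0}).encard ≤ 2 := by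
  have hn2 : 2 ≤ n := by omega
  refine ⟨_, (StaticSpace.isOpen_ricciRegularSet g).inter
    (StaticSpace.isOpen_grad_ne_zero g hstatic.smooth), hp, subset_rfl, fun x hx => ?_⟩
  exact ⟨StaticSpace.exists_isAdaptedRicciFrame hn2 hstatic hharm hx.2,
    fun e lam he => he.encard_le_two hn2 hstatic hharm hx.2⟩
end
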